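/- All graphs are finite and simple. A graph $G$ is $n$-connected if it has more than $n$ vertices and $G-X$ is connected for every set $X$ of fewer than $n$ vertices. Let $k\ge 0$ be an integer. A set of $k$ terminal pairs is a set $S=\{\{s_1,t_1\},\ldots,\{s_k,t_k\}\}$ where $s_1,\ldots,s_k,t_1,\ldots,t_k$ are $2k$ distinct vertices of $G$. The graph $G$ is parity-$k$-linked if for every set of $k$ terminal pairs and every prescription of a parity (odd or even) for each $i\in\{1,\dots,k\}$ there are pairwise vertex-disjoint paths $P_1,\ldots,P_k$ in $G$ such that $P_i$ joins $s_i$ and $t_i$ and has length of the prescribed parity. An odd cycle cover of $G$ is a set $X$ of vertices such that $G-X$ is bipartite; it is minimum if it has the smallest possible size. A partition of $G$ is a partition $(A,B)$ of $V(G)$ into two (possibly empty) sets, and $G_{A,B}$ denotes $G[A]\cup G[B]$. A partition $(A,B)$ is nice if there is a minimum odd cycle cover $X$ of $G$ such that $G$ has no edge inside $A\setminus X$ and no edge inside $B\setminus X$, every vertex of $X$ with more neighbors in $B\setminus X$ than in $A\setminus X$ lies in $A$, and every vertex of $X$ with more neighbors in $A\setminus X$ than in $B\setminus X$ lies in $B$.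 A parity breaking matching of size $k$ for $S$ with respect to $(A,B)$ is a family of $k$ pairwise disjoint edges $m_1,\ldots,m_k$ of $G_{A,B}$ such that $m_i\cap\{s_j,t_j\}=\emptyset$ whenever $i\ne j$. Let $G$ be a $50k$-connected graph. Then exactly one of the following two statements holds. (i) $G$ is parity-$k$-linked. (ii) There is a set $S$ of $k$ terminal pairs such that for every nice partition $(A,B)$ of $G$ there is no parity breaking matching of size $k$ for $S$ with respect to $(A,B)$. -/

import Mathlib

namespace ParityLinkage

/-- `G` is `n`-connected: it has more than `n` vertices, and it remains connected whenever fewer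
than `n` vertices are deleted. -/
def IsVertexConnected {V : Type*} (G : SimpleGraph V) (n : ℕ) : Prop :=
  n < Nat.card V ∧ ∀ X : Set V, X.ncard < n → (G.induce Xᶜ).Connected

/-- A set `{{s₁, t₁}, …, {sₖ, tₖ}}` of `k` terminal pairs; the `2k` terminals are distinct. -/
structure TerminalPairs (V : Type*) (k : ℕ) where
  s : Fin k → V
  t : Fin k → V
  s_injective : Function.Injective s
  t_injective : Function.Injective t
  s_ne_t : ∀ i j, s i ≠ t j

/-- `G` is parity-`k`-linked: any `k` terminal pairs can be joined by `k` pairwise vertex-disjoint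
paths, where the parity of the length of each path can be prescribed individually (the paths with
index in `O` are the ones prescribed to be odd). -/
def IsParityLinked {V : Type*} (G : SimpleGraph V) (k : ℕ) : Prop :=
  ∀ (S : TerminalPairs V k) (O : Set (Fin k)),
    ∃ P : ∀ i, G.Walk (S.s i) (S.t i),
      (∀ i, (P i).IsPath) ∧
      (∀ i j, i ≠ j → ∀ v, v ∈ (P i).support → v ∉ (P j).support) ∧
      ∀ i, Odd (P i).length ↔ i ∈ O

/-- A set `X` of vertices such that `G - X` is bipartite. -/
def IsOddCycleCover {V : Type*} (G : SimpleGraph V) (X : Set V) : Prop :=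
  (G.induce Xᶜ).IsBipartite

/-- An odd cycle cover of minimum size. -/
def IsMinOddCycleCover {V : Type*} (G : SimpleGraph V) (X : Set V) : Prop :=
  IsOddCycleCover G X ∧ ∀ Y : Set V, IsOddCycleCover G Y → X.ncard ≤ Y.ncard

/-- The graph `G[A] ∪ G[B]`, with `V` as its vertex set. -/
def insideGraph {V : Type*} (G : SimpleGraph V) (A B : Set V) : SimpleGraph V where
  Adj u v := G.Adj u v ∧ ((u ∈ A ∧ v ∈ A) ∨ (u ∈ B ∧ v ∈ B))
  symm := ⟨fun _ _ h => ⟨h.1.symm, h.2.imp And.symm And.symm⟩⟩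
  loopless := ⟨fun _ h => G.irrefl h.1⟩

/-- `(A, B)` is a partition of the vertex set into two (possibly empty) sets. -/
def IsPartition {V : Type*} (A B : Set V) : Prop :=
  Disjoint A B ∧ A ∪ B = Set.univ

/-- The number of neighbours of `v` in `Z`. -/
noncomputable def degreeInto {V : Type*} (G : SimpleGraph V) (v : V) (Z : Set V) : ℕ :=
  (G.neighborSet v ∩ Z).ncard

/-- `(A, B)` is a nice partition of `G`: for some minimum odd cycle cover `X`, the sets
`A \ X` and `B \ X` form a bipartition of `G - X`, and every vertex of `X` that has strictly more
neighbours in one of these two sets lies on the opposite side. -/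
def IsNicePartition {V : Type*} (G : SimpleGraph V) (A B : Set V) : Prop :=
  IsPartition A B ∧ ∃ X : Set V, IsMinOddCycleCover G X ∧
    insideGraph G (A \ X) (B \ X) = ⊥ ∧
    (∀ v ∈ X, degreeInto G v (A \ X) < degreeInto G v (B \ X) → v ∈ A) ∧
    (∀ v ∈ X, degreeInto G v (B \ X) < degreeInto G v (A \ X) → v ∈ B)

/-- `m₁, …, mₖ` is a parity breaking matching (of size `k`) for the `k` terminal pairs `S` with
respect to the partition `(A, B)`: a matching of edges of `G[A] ∪ G[B]` such that `mᵢ` avoids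
`{sⱼ, tⱼ}` for all `j ≠ i`. -/
def IsParityBreakingMatching {V : Type*} (G : SimpleGraph V) (A B : Set V) {k : ℕ}
    (S : TerminalPairs V k) (m : Fin k → Sym2 V) : Prop :=
  (∀ i, m i ∈ (insideGraph G A B).edgeSet) ∧
  (∀ i j, i ≠ j → ∀ v, v ∈ m i → v ∉ m j) ∧
  ∀ i j, i ≠ j → S.s j ∉ m i ∧ S.t j ∉ m i

end ParityLinkage

namespace ParityLinkage
open scoped Classical

/-! ### Walks inside a vertex set, and Menger's theorem -/

section

variable {V : Type*}

/-! The two statements exclude each other for a simple reason. Given a partition `(A, B)`, prescribe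
for each pair the parity that contradicts the sides of its terminals. Each path of such a linkage
must contain an edge inside `A` or inside `B`, and since the paths are disjoint, these edges form a
parity breaking matching (`IsParityLinked.exists_matching`). Nice partitions exist
(`exists_isNicePartition`), so (i) refutes (ii).

Conversely, suppose that every set of pairs has a parity breaking matching for some nice partition.
Parities are controlled through a 2-colouring `χ` of the vertices. If the terminals and the ends of
`k` disjoint monochromatic edges together form a linked set of the bipartite graph `cut G χ`, then
every choice of parities can be realised: a pair is joined inside the cut if this already gives the
right parity, and otherwise by way of its monochromatic edge (`exists_parity_paths`). It remains to
find `χ` and the edges.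

If some odd cycle cover has fewer than `6k` vertices, the colouring comes from a nice partition and
the edges from the given matching. The graph outside the cover is bipartite and still highly
connected, and each vertex of the cover sends at least half of its edges leaving the cover across
the cut, so the cut is linked enough (`linked_cut`).

If every odd cycle cover has at least `6k` vertices, the edges are found without help from the
hypothesis (`exists_linked_breaking`). A maximum cut contains a highly linked bipartite subgraph on
a set `U` (`exists_linked_cut`). Tutte's theorem, applied to a graph made of two layers of `G`,
yields either a cover with fewer than `6k` vertices or a system of many paths between vertices of
`U` having the wrong parity for `χ` (`exists_breaking_graph`). The terminals are routed to `U` so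
that enough of these paths stay untouched (`exists_disjoint_paths_along`). Recolouring along all the
paths puts one monochromatic edge on each of `k` wrong-parity paths (`exists_linked_recolouring`).

In both cases linkedness comes from a form of the Thomas–Wollan theorem, `Massed.linked`: a graph
with many edges outside the roots, but not behind small separators, links its roots. Edges are
deleted or contracted and small separators reduced until some vertex has a small closed
neighbourhood of high minimum degree. That neighbourhood contains a linked part
(`exists_linked_part`), which Menger's theorem connects to the roots. -/

/-- `a` and `b` are joined by a walk of `G` all of whose vertices lie in `P`. -/
def Joins (G : SimpleGraph V) (P : Set V) (a b : V) : Prop :=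
  ∃ w : G.Walk a b, ∀ v ∈ w.support, v ∈ P

namespace Joins

variable {G H : SimpleGraph V} {P Q : Set V} {a b c : V}

theorem left_mem (h : Joins G P a b) : a ∈ P := by
  obtain ⟨w, hw⟩ := h
  exact hw _ w.start_mem_support

theorem right_mem (h : Joins G P a b) : b ∈ P := by
  obtain ⟨w, hw⟩ := h
  exact hw _ w.end_mem_support

theorem refl (h : a ∈ P) : Joins G P a a :=
  ⟨.nil, by simpa using h⟩

theorem symm (h : Joins G P a b) : Joins G P b a := by
  obtain ⟨w, hw⟩ := h
  exact ⟨w.reverse, by simpa using hw⟩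

theorem trans (h : Joins G P a b) (h' : Joins G P b c) : Joins G P a c := by
  obtain ⟨w, hw⟩ := h
  obtain ⟨w', hw'⟩ := h'
  refine ⟨w.append w', fun v hv => ?_⟩
  rw [SimpleGraph.Walk.mem_support_append_iff] at hv
  exact hv.elim (hw v) (hw' v)

theorem mono (h : Joins G P a b) (hPQ : P ⊆ Q) : Joins G Q a b := by
  obtain ⟨w, hw⟩ := h
  exact ⟨w, fun v hv => hPQ (hw v hv)⟩

theorem of_adj (h : G.Adj a b) (ha : a ∈ P) (hb : b ∈ P) : Joins G P a b :=
  ⟨h.toWalk, by simp [ha, hb]⟩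

theorem cons (h : G.Adj a b) (ha : a ∈ P) (h' : Joins G P b c) : Joins G P a c :=
  (of_adj h ha h'.left_mem).trans h'

/-- Transfer of a joining walk along a map of steps. -/
theorem transfer (h : Joins G P a b) (ha : a ∈ Q)
    (hs : ∀ u v, G.Adj u v → u ∈ P → v ∈ P → u ∈ Q → Joins H Q u v) : Joins H Q a b := by
  obtain ⟨w, hw⟩ := h
  induction w with
  | nil => exact refl ha
  | cons h p ih =>
    have h1 := hs _ _ h (hw _ (by simp)) (hw _ (by simp)) ha
    exact h1.trans (ih h1.right_mem fun v hv => hw v (by simp [hv]))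

theorem mono_graph (h : Joins G P a b)
    (hs : ∀ u v, G.Adj u v → u ∈ P → v ∈ P → H.Adj u v) : Joins H P a b :=
  h.transfer h.left_mem fun u v huv hu hv _ => of_adj (hs u v huv hu hv) hu hv

theorem le (h : Joins G P a b) (hGH : G ≤ H) : Joins H P a b :=
  h.mono_graph fun _ _ h _ _ => hGH h

/-- The vertices on a joining walk are themselves joined to its start. -/
theorem reached (h : Joins G P a b) : Joins G {v | Joins G P a v} a b :=
  h.transfer (refl h.left_mem) fun _ _ huv _ hv hu =>
    of_adj huv hu (hu.trans (of_adj huv hu.right_mem hv))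

theorem reached_right (h : Joins G P a b) : Joins G {v | Joins G P v b} a b :=
  h.symm.reached.symm.mono fun _ hv => hv.symm

theorem exists_exit {A : Set V} (h : Joins G P a b) (ha : a ∈ A) (hb : b ∉ A) :
    ∃ u v, G.Adj u v ∧ u ∈ A ∧ v ∉ A ∧ u ∈ P ∧ v ∈ P := by
  obtain ⟨w, hw⟩ := h
  induction w with
  | nil => exact absurd ha hb
  | @cons u v w h p ih =>
    by_cases hv : v ∈ A
    · exact ih hv hb fun z hz => hw z (by simp [hz])
    · exact ⟨u, v, h, ha, hv, hw _ (by simp), hw _ (by simp)⟩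

/-- The first vertex of a joining walk that lies in `Q`. -/
theorem first (h : Joins G P a b) (hb : b ∈ Q) :
    a ∈ Q ∨ ∃ u q, Joins G (P \ Q) a u ∧ G.Adj u q ∧ q ∈ Q ∧ q ∈ P := by
  obtain ⟨w, hw⟩ := h
  induction w with
  | nil => exact Or.inl hb
  | @cons u v w h p ih =>
    by_cases hu : u ∈ Q
    · exact Or.inl hu
    right
    have huP : u ∈ P \ Q := ⟨hw _ (by simp), hu⟩
    rcases ih hb fun v hv => hw v (by simp [hv]) with hv | ⟨u', q, h1, h2, h3, h4⟩
    · exact ⟨u, v, refl huP, h, hv, hw _ (by simp)⟩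
    · exact ⟨u', q, cons h huP h1, h2, h3, h4⟩

end Joins

/-- The subgraph of `G` formed by the edges inside `Q`. -/
def restr (G : SimpleGraph V) (Q : Set V) : SimpleGraph V where
  Adj u v := G.Adj u v ∧ u ∈ Q ∧ v ∈ Q
  symm := ⟨fun _ _ h => ⟨h.1.symm, h.2.2, h.2.1⟩⟩
  loopless := ⟨fun _ h => G.irrefl h.1⟩

theorem restr_le (G : SimpleGraph V) (Q : Set V) : restr G Q ≤ G := fun _ _ h => h.1

theorem restr_mono (G : SimpleGraph V) {Q R : Set V} (h : Q ⊆ R) : restr G Q ≤ restr G R :=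
  fun _ _ h' => ⟨h'.1, h h'.2.1, h h'.2.2⟩

/-- `T` meets every walk of `G` from `X` to `Q`. -/
def Sep (G : SimpleGraph V) (T X Q : Finset V) : Prop :=
  ∀ x ∈ X, ∀ q ∈ Q, ¬ Joins G {v | v ∉ T} x q

/-- Pairwise disjoint paths from all elements `x` of `X` to elements `π x` of `Q`, meeting `Q` only
at the end. The colouring `c` exhibits the disjointness. -/
def DisjointPaths (G : SimpleGraph V) (X Q : Finset V) : Prop :=
  ∃ c π : V → V, ∀ x ∈ X, π x ∈ Q ∧ Joins G {v | c v = x ∧ (v ∈ Q → v = π x)} x (π x)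

theorem DisjointPaths.le {G H : SimpleGraph V} {X Q : Finset V} (h : DisjointPaths G X Q)
    (hGH : G ≤ H) : DisjointPaths H X Q := by
  obtain ⟨c, π, h⟩ := h
  exact ⟨c, π, fun x hx => ⟨(h x hx).1, (h x hx).2.le hGH⟩⟩

/-- A walk from `X` to `Q` avoiding `S` leaves the set reached from `X` only by the extra edge, and
read backwards it leaves the set reaching `Q` only by that edge. The edge is used in the same
direction both times, since otherwise the two sets would meet although `S` separates in `G'`. -/
theorem Sep.exists_edge {G G' : SimpleGraph V} {S X Q : Finset V} {x y : V}
    (hG' : ∀ u v, G.Adj u v → G'.Adj u v ∨ (u = x ∧ v = y) ∨ (u = y ∧ v = x))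
    (hS : Sep G' S X Q) (hS' : ¬ Sep G S X Q) :
    ∃ u v, ((u = x ∧ v = y) ∨ (u = y ∧ v = x)) ∧ G.Adj u v ∧
      (∃ a ∈ X, Joins G' {v | v ∉ S} a u) ∧ (∃ q ∈ Q, Joins G' {v | v ∉ S} v q) := by
  simp only [Sep, not_forall, not_not] at hS'
  obtain ⟨a, ha, q, hq, hj⟩ := hS'
  obtain ⟨u, v, huv, ⟨a', ha', hu⟩, hv, huS, hvS⟩ :=
    hj.exists_exit (A := {u | ∃ a ∈ X, Joins G' {v | v ∉ S} a u}) ⟨a, ha, .refl hj.left_mem⟩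
      (fun ⟨a', ha', h'⟩ => hS a' ha' q hq h')
  obtain ⟨v', u', huv', ⟨q', hq', hv'⟩, hu', huS', hvS'⟩ :=
    hj.symm.exists_exit (A := {u | ∃ q ∈ Q, Joins G' {v | v ∉ S} u q})
      ⟨q, hq, .refl hj.right_mem⟩ (fun ⟨q', hq', h'⟩ => hS a ha q' hq' h')
  have h1 := (hG' u v huv).resolve_left fun h =>
    hv ⟨a', ha', hu.trans (.of_adj h hu.right_mem hvS)⟩
  have h2 := (hG' v' u' huv').resolve_left fun h =>
    hu' ⟨q', hq', .cons h.symm hvS' hv'⟩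
  refine ⟨u, v, h1, huv, ⟨a', ha', hu⟩, ?_⟩
  have : v' = v ∨ v' = u := by
    rcases h1 with ⟨rfl, rfl⟩ | ⟨rfl, rfl⟩ <;> rcases h2 with ⟨rfl, rfl⟩ | ⟨rfl, rfl⟩ <;> simp
  rcases this with rfl | rfl
  · exact ⟨q', hq', hv'⟩
  · exact absurd (hu.trans hv') (hS a' ha' q' hq')

/-- Two systems of disjoint paths, from `X` to `S ∪ {x}` and from `S ∪ {y}` to `Q`, are joined along
the edge `xy`. -/
theorem DisjointPaths.glue {G G' : SimpleGraph V} {S X Q : Finset V} {x y : V}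
    (hle : G' ≤ G) (hxy : G.Adj x y) (hS : Sep G' S X Q) (hxS : x ∉ S)
    (hx : ∃ a ∈ X, Joins G' {v | v ∉ S} a x) (hy : ∃ q ∈ Q, Joins G' {v | v ∉ S} y q)
    (h1 : DisjointPaths G' X (insert x S)) (h2 : DisjointPaths G' (insert y S) Q) :
    DisjointPaths G X Q := by
  obtain ⟨c₁, π₁, h1⟩ := h1
  obtain ⟨c₂, π₂, h2⟩ := h2
  have hc1 : ∀ z ∈ X, c₁ (π₁ z) = z := fun z hz => (h1 z hz).2.right_mem.1
  have hinj : Set.InjOn π₁ X := fun z hz z' hz' h => by rw [← hc1 z hz, h, hc1 z' hz']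
  have hyS : y ∉ S := by
    obtain ⟨q, _, h⟩ := hy
    exact h.left_mem
  -- The side of `X`. Paths of the first system stay in it until they end in `S ∪ {x}`, and paths of
  -- the second system never enter it, so colouring the two sides by the two systems keeps the
  -- joined paths disjoint.
  let RA : Set V := {v | ∃ a ∈ X, Joins G' {v | v ∉ S} a v}
  have hRAS : ∀ v ∈ RA, v ∉ S := fun v ⟨a, _, h⟩ => h.right_mem
  have hRB : ∀ v q, q ∈ Q → Joins G' {v | v ∉ S} v q → v ∉ RA := fun v q hq h ⟨a, ha, h'⟩ =>
    hS a ha q hq (h'.trans h)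
  -- Where a path ending at `p` is continued: at `p` itself, except that the path ending at `x`
  -- crosses to `y`. Below, `τ` recovers the starting vertex from the continuation.
  let σ : V → V := fun p => if p = x then y else p
  have hσS : ∀ p ∈ S, σ p = p := fun p hp => if_neg (by rintro rfl; exact hxS hp)
  have hσ : ∀ z ∈ X, σ (π₁ z) ∈ insert y S := by
    intro z hz
    rcases Finset.mem_insert.1 (h1 z hz).1 with h | h
    · simp [σ, h]
    · rw [hσS _ h]
      exact Finset.mem_insert_of_mem h
  have hσinj : ∀ z ∈ X, ∀ z' ∈ X, σ (π₁ z) = σ (π₁ z') → z = z' := by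
    intro z hz z' hz' h
    apply hinj hz hz'
    have a1 := (h1 z hz).1
    have a2 := (h1 z' hz').1
    simp only [σ] at h
    grind
  let τ : V → V := fun p => if h : ∃ z ∈ X, σ (π₁ z) = p then h.choose else p
  have hτ : ∀ z ∈ X, τ (σ (π₁ z)) = z := by
    intro z hz
    have h : ∃ z' ∈ X, σ (π₁ z') = σ (π₁ z) := ⟨z, hz, rfl⟩
    simp only [τ, dif_pos h]
    exact hσinj _ h.choose_spec.1 _ hz h.choose_spec.2
  refine ⟨fun v => if v ∈ RA then c₁ v else τ (c₂ v), fun z => π₂ (σ (π₁ z)), fun z hz => ?_⟩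
  have hz2 := h2 _ (hσ z hz)
  refine ⟨hz2.1, ?_⟩
  set T : Set V := {v | (if v ∈ RA then c₁ v else τ (c₂ v)) = z ∧ (v ∈ Q → v = π₂ (σ (π₁ z)))}
  have hmem2 : ∀ v, v ∉ RA → c₂ v = σ (π₁ z) → (v ∈ Q → v = π₂ (σ (π₁ z))) → v ∈ T := by
    intro v hv hc hQ
    refine ⟨?_, hQ⟩
    rw [if_neg hv, hc, hτ z hz]
  have hmem1 : ∀ v, v ∈ RA → c₁ v = z → v ∈ T := by
    intro v hv hc
    exact ⟨by rw [if_pos hv, hc], fun hQ =>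
      absurd hv (hRB v v hQ (Joins.refl (show v ∈ {v | v ∉ S} from hRAS v hv)))⟩
  have hp2 : σ (π₁ z) ∈ T ∧ Joins G T (σ (π₁ z)) (π₂ (σ (π₁ z))) := by
    have hpRA : σ (π₁ z) ∉ RA := by
      rcases Finset.mem_insert.1 (hσ z hz) with h | h
      · obtain ⟨q, hq, hyq⟩ := hy
        rw [h]
        exact hRB y q hq hyq
      · exact fun h' => hRAS _ h' h
    have hpT : σ (π₁ z) ∈ T := hmem2 _ hpRA hz2.2.left_mem.1 hz2.2.left_mem.2
    refine ⟨hpT, ?_⟩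
    -- A second path may return to `S ∪ {y}` only at its own start, so following it backwards from
    -- `Q` to its first vertex in `S ∪ {y}` gives a piece that avoids `S` up to its end.
    have huniq : ∀ v ∈ insert y S, c₂ v = σ (π₁ z) → v = σ (π₁ z) := fun v hv hc => by
      rw [← (h2 v hv).2.left_mem.1, hc]
    rcases hz2.2.symm.first (Q := (insert y S : Finset V)) (hσ z hz) with h | ⟨u, p, hj, hup, hp, hpP⟩
    · have := huniq _ h hz2.2.right_mem.1
      rw [this]
      exact .refl hpT
    · have : p = σ (π₁ z) := huniq p hp hpP.1
      subst this
      have hj' : Joins G T u (π₂ (σ (π₁ z))) := by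
        refine (hj.symm.reached_right.le hle).mono fun v hv => ?_
        have hv' := hv.left_mem
        refine hmem2 v (hRB v _ hz2.1 (hv.mono fun v' hv' hS' => ?_)) hv'.1.1 hv'.1.2
        exact hv'.2 (Finset.mem_coe.2 (Finset.mem_insert_of_mem hS'))
      exact .cons (hle hup.symm) hpT hj'
  have hp1 : z = π₁ z ∨ ∃ u, Joins G T z u ∧ G'.Adj u (π₁ z) ∧ u ∈ RA := by
    have hz1 := h1 z hz
    rcases hz1.2.first (Q := (insert x S : Finset V)) hz1.1 with h | ⟨u, p, hj, hup, hp, hpP⟩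
    · exact Or.inl (hz1.2.left_mem.2 h)
    · right
      have : p = π₁ z := hpP.2 hp
      subst this
      have hRA : ∀ v, Joins G' ({v | c₁ v = z ∧ (v ∈ insert x S → v = π₁ z)} \
          ((insert x S : Finset V) : Set V)) z v → v ∈ RA := fun v hv =>
        ⟨z, hz, hv.mono fun v' hv' hS' => hv'.2 (Finset.mem_coe.2 (Finset.mem_insert_of_mem hS'))⟩
      exact ⟨u, (hj.reached.le hle).mono fun v hv => hmem1 v (hRA v hv) hv.right_mem.1.1, hup,
        hRA u hj⟩
  show Joins G T z (π₂ (σ (π₁ z)))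
  by_cases hpx : π₁ z = x
  · have hxRA : x ∈ RA := hx
    have hxT : x ∈ T := hmem1 x hxRA (by rw [← hpx, hc1 z hz])
    have hσx : σ (π₁ z) = y := by simp [σ, hpx]
    rw [hσx] at hp2 ⊢
    have hzx : Joins G T z x := by
      rcases hp1 with h | ⟨u, hj, hu, _⟩
      · rw [h, hpx]
        exact .refl hxT
      · rw [hpx] at hu
        exact hj.trans (.of_adj (hle hu) hj.right_mem hxT)
    exact hzx.trans (.cons hxy hxT hp2.2)
  · have hpS : π₁ z ∈ S := (Finset.mem_insert.1 (h1 z hz).1).resolve_left hpx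
    have hσp : σ (π₁ z) = π₁ z := hσS _ hpS
    rw [hσp] at hp2 ⊢
    rcases hp1 with h | ⟨u, hj, hu, _⟩
    · have := hp2.2
      rwa [← h] at this ⊢
    · exact hj.trans (.cons (hle hu) hj.right_mem hp2.2)

/-- **Menger's theorem**. -/
theorem menger [Finite V] (G : SimpleGraph V) (X Q : Finset V)
    (h : ∀ T, Sep G T X Q → X.card ≤ T.card) : DisjointPaths G X Q := by
  induction hn : G.edgeSet.ncard using Nat.strong_induction_on generalizing G X Q with
  | _ n ih =>
  by_cases hE : ∃ x y, G.Adj x y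
  · obtain ⟨x, y, hxy⟩ := hE
    set G' := G.deleteEdges {s(x, y)} with hG'
    have hle : G' ≤ G := SimpleGraph.deleteEdges_le _
    have hlt : G'.edgeSet.ncard < n := by
      rw [← hn]
      refine Set.ncard_lt_ncard ?_ (Set.toFinite _)
      refine ⟨SimpleGraph.edgeSet_mono hle, fun h => ?_⟩
      have := h ((SimpleGraph.mem_edgeSet G).2 hxy)
      simp [hG'] at this
    have hG'' : ∀ u v, G.Adj u v → G'.Adj u v ∨ (u = x ∧ v = y) ∨ (u = y ∧ v = x) := by
      intro u v huv
      by_cases hh : (u = x ∧ v = y) ∨ (u = y ∧ v = x)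
      · exact Or.inr hh
      · left
        rw [hG', SimpleGraph.deleteEdges_adj]
        refine ⟨huv, ?_⟩
        simpa using hh
    -- If deleting the edge lowers no separator below `X.card`, induction suffices. Otherwise a
    -- smaller separator `S` of `G'` appears, and with one end of the edge it separates in `G`, so
    -- it is exactly one short.
    by_cases hall : ∀ T, Sep G' T X Q → X.card ≤ T.card
    · exact (ih _ hlt G' X Q hall rfl).le hle
    push Not at hall
    obtain ⟨S, hS, hSc⟩ := hall
    have hS' : ¬ Sep G S X Q := fun h' => absurd (h S h') (by omega)
    obtain ⟨u, v, huv, hadj, hu, hv⟩ := hS.exists_edge hG'' hS'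
    have huS : u ∉ S := by obtain ⟨_, _, hj⟩ := hu; exact hj.right_mem
    have hvS : v ∉ S := by obtain ⟨_, _, hj⟩ := hv; exact hj.left_mem
    have hnew : ∀ a b, G.Adj a b → G'.Adj a b ∨ (a = u ∧ b = v) ∨ (a = v ∧ b = u) := by
      intro a b hab
      have := hG'' a b hab
      rcases huv with ⟨rfl, rfl⟩ | ⟨rfl, rfl⟩ <;> tauto
    have hsepu : Sep G (insert u S) X Q := by
      intro a ha q hq hj
      refine hS a ha q hq ((hj.mono_graph (H := G') fun c d hcd hc hd => ?_).mono
        fun c hc hcS => hc (Finset.mem_insert_of_mem hcS))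
      rcases hnew c d hcd with h | ⟨rfl, _⟩ | ⟨_, rfl⟩
      · exact h
      · exact absurd (Finset.mem_insert_self _ _) hc
      · exact absurd (Finset.mem_insert_self _ _) hd
    have hcard : S.card + 1 = X.card := by
      have := h _ hsepu
      rw [Finset.card_insert_of_notMem huS] at this
      omega
    refine DisjointPaths.glue hle hadj hS huS hu hv (ih _ hlt G' _ _ ?_ rfl)
      (ih _ hlt G' _ _ ?_ rfl)
    -- A set separating `X` from `S ∪ {u}` in `G'` also separates `X` from `Q` in `G`: a walk to `Q`
    -- must reach `S ∪ {u}`, and until then it cannot use the edge `uv`, because `v` lies on the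
    -- side of `Q`.
    · intro T hT
      refine h T fun a ha q hq hj => ?_
      have hB : Joins G {v | v ∉ T} a q → False := by
        intro hj
        by_cases ha' : a ∈ insert u S
        · exact hT a ha a ha' (.refl hj.left_mem)
        have hex := hj.exists_exit (A := {z | Joins G' ({v | v ∉ T} \ (insert u S : Finset V)) a z})
          (.refl ⟨hj.left_mem, ha'⟩) (fun h' => hS a ha q hq
            (h'.mono fun z hz hzS => hz.2 (Finset.mem_coe.2 (Finset.mem_insert_of_mem hzS))))
        obtain ⟨c, d, hcd, hc, hd, hcT, hdT⟩ := hex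
        have hcS : c ∉ insert u S := hc.right_mem.2
        have hcv : c ≠ v := by
          rintro rfl
          obtain ⟨q', hq', hj'⟩ := hv
          exact hS a ha q' hq' ((hc.mono fun z hz hzS =>
            hz.2 (Finset.mem_coe.2 (Finset.mem_insert_of_mem hzS))).trans hj')
        have hcd' : G'.Adj c d := by
          rcases hnew c d hcd with h | ⟨rfl, _⟩ | ⟨h, _⟩
          · exact h
          · exact absurd (Finset.mem_insert_self _ _) hcS
          · exact absurd h hcv
        by_cases hdS : d ∈ insert u S
        · exact hT a ha d hdS ((hc.mono fun z hz => hz.1).trans (.of_adj hcd' hcT hdT))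
        · exact hd (hc.trans (.of_adj hcd' hc.right_mem ⟨hdT, hdS⟩))
      exact hB hj
    · intro T hT
      rw [Finset.card_insert_of_notMem hvS, hcard]
      refine h T fun a ha q hq hj => ?_
      by_cases hq' : q ∈ insert v S
      · exact hT q hq' q hq (.refl hj.right_mem)
      have hex := hj.symm.exists_exit
        (A := {z | Joins G' ({v | v ∉ T} \ (insert v S : Finset V)) z q})
        (.refl ⟨hj.right_mem, hq'⟩) (fun h' => hS a ha q hq
          (h'.mono fun z hz hzS => hz.2 (Finset.mem_coe.2 (Finset.mem_insert_of_mem hzS))))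
      obtain ⟨c, d, hcd, hc, hd, hcT, hdT⟩ := hex
      have hcS : c ∉ insert v S := hc.left_mem.2
      have hcu : c ≠ u := by
        rintro rfl
        obtain ⟨a', ha', hj'⟩ := hu
        exact hS a' ha' q hq (hj'.trans (hc.mono fun z hz hzS =>
          hz.2 (Finset.mem_coe.2 (Finset.mem_insert_of_mem hzS))))
      have hcd' : G'.Adj c d := by
        rcases hnew c d hcd with h | ⟨h, _⟩ | ⟨rfl, _⟩
        · exact h
        · exact absurd h hcu
        · exact absurd (Finset.mem_insert_self _ _) hcS
      by_cases hdS : d ∈ insert v S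
      · exact hT d hdS q hq (.cons hcd'.symm hdT (hc.mono fun z hz => hz.1))
      · exact hd (.cons hcd'.symm ⟨hdT, hdS⟩ hc)
  · push Not at hE
    have hXQ : X ⊆ Q := by
      have hsep : Sep G (X ∩ Q) X Q := by
        intro x hx q hq hj
        by_cases hxq : x = q
        · subst hxq
          exact hj.left_mem (Finset.mem_inter.2 ⟨hx, hq⟩)
        · obtain ⟨u, v, huv, _⟩ := hj.exists_exit (A := {x}) rfl (fun h => hxq h.symm)
          exact hE u v huv
      have := Finset.eq_of_subset_of_card_le Finset.inter_subset_left (h _ hsep)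
      exact fun x hx => (Finset.mem_inter.1 (this ▸ hx)).2
    exact ⟨id, id, fun x hx => ⟨hXQ hx, .refl ⟨rfl, fun _ => rfl⟩⟩⟩

end

/-! ### Shortest paths and the exchange of a vertex -/

section

variable {V : Type*}

theorem exists_argmin {α : Type*} {P : α → Prop} (f : α → ℕ) (h : ∃ a, P a) :
    ∃ a, P a ∧ ∀ b, P b → f a ≤ f b := by
  obtain ⟨a, ha⟩ := h
  induction hn : f a using Nat.strong_induction_on generalizing a with
  | _ n ih =>
    by_cases hb : ∃ b, P b ∧ f b < n
    · obtain ⟨b, hb, hlt⟩ := hb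
      exact ih _ hlt b hb rfl
    · push Not at hb
      exact ⟨a, ha, fun b hb' => hn ▸ hb b hb'⟩

namespace Joins

variable {G : SimpleGraph V} {s t : V}

theorem of_seq (f : ℕ → V) {a b : ℕ} (hab : a ≤ b)
    (h : ∀ i, a ≤ i → i < b → G.Adj (f i) (f (i + 1))) : Joins G (f '' Set.Icc a b) (f a) (f b) := by
  induction b, hab using Nat.le_induction with
  | base => exact .refl ⟨a, by simp, rfl⟩
  | succ n hn ih =>
    refine ((ih fun i h1 h2 => h i h1 (by omega)).mono ?_).trans
      (.of_adj (h n hn (by omega)) ⟨n, by simp [hn], rfl⟩ ⟨n + 1, by simp; omega, rfl⟩)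
    exact Set.image_mono (Set.Icc_subset_Icc_right (by omega))

/-- A smallest set joining `s` to `t` inside `P` consists of the vertices of a path that cannot be
shortened. -/
theorem exists_path_of_minimal {C : Finset V} {P : Set V} (hC : ↑C ⊆ P) (h : Joins G C s t)
    (hmin : ∀ C' : Finset V, ↑C' ⊆ P → Joins G C' s t → C.card ≤ C'.card) :
    ∃ (p : ℕ) (f : ℕ → V), f 0 = s ∧ f p = t ∧ Set.InjOn f (Set.Iic p) ∧
      C = (Finset.range (p + 1)).image f ∧ C.card = p + 1 ∧ (∀ i < p, G.Adj (f i) (f (i + 1))) ∧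
      ∀ i j, i < j → j ≤ p → ∀ E : Finset V, ↑E ⊆ P →
        Joins G (insert (f i) (insert (f j) (E : Set V))) (f i) (f j) → j ≤ i + 1 + E.card := by
  obtain ⟨w, hw⟩ := h
  set q := w.toPath
  set f := (q : G.Walk s t).getVert
  set p := (q : G.Walk s t).length
  have hf0 : f 0 = s := SimpleGraph.Walk.getVert_zero _
  have hfp : f p = t := SimpleGraph.Walk.getVert_length _
  have hinj : Set.InjOn f (Set.Iic p) := fun i hi j hj hij =>
    q.2.getVert_injOn hi hj hij
  have hadj : ∀ i < p, G.Adj (f i) (f (i + 1)) := fun i hi =>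
    SimpleGraph.Walk.adj_getVert_succ _ hi
  have hfC : ∀ i ≤ p, f i ∈ C := fun i hi => hw _
    (SimpleGraph.Walk.support_toPath_subset_support w (SimpleGraph.Walk.getVert_mem_support _ _))
  have hcard : ((Finset.range (p + 1)).image f).card = p + 1 := by
    rw [Finset.card_image_of_injOn, Finset.card_range]
    exact hinj.mono fun i hi => by simp at hi ⊢; omega
  have hsub : (Finset.range (p + 1)).image f ⊆ C := by
    intro v hv
    obtain ⟨i, hi, rfl⟩ := Finset.mem_image.1 hv
    exact hfC i (by simp at hi; omega)
  have hCeq : C = (Finset.range (p + 1)).image f := by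
    symm
    apply Finset.eq_of_subset_of_card_le hsub
    refine hmin _ (fun v hv => hC (hsub hv)) ?_
    have := of_seq (G := G) f (Nat.zero_le p) fun i _ hi => hadj i hi
    rw [hf0, hfp] at this
    refine this.mono ?_
    rintro _ ⟨i, hi, rfl⟩
    exact Finset.mem_coe.2 (Finset.mem_image_of_mem f (by simp at hi ⊢; omega))
  refine ⟨p, f, hf0, hfp, hinj, hCeq, by rw [hCeq, hcard], hadj, ?_⟩
  -- Replacing the stretch of the path strictly between positions `i` and `j` by `E` gives another
  -- joining set, which cannot be smaller.
  intro i j hij hj E hE hJ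
  have h1 := hmin ((Finset.range (i + 1)).image f ∪ E ∪ (Finset.Icc j p).image f) ?_ ?_
  · have h2 := Finset.card_union_le ((Finset.range (i + 1)).image f ∪ E) ((Finset.Icc j p).image f)
    have h3 := Finset.card_union_le ((Finset.range (i + 1)).image f) E
    have h4 := Finset.card_image_le (s := Finset.range (i + 1)) (f := f)
    have h5 := Finset.card_image_le (s := Finset.Icc j p) (f := f)
    rw [hCeq, hcard] at h1
    simp at h4 h5
    omega
  · intro v hv
    simp only [Finset.coe_union, Set.mem_union, Finset.mem_coe, Finset.mem_image] at hv
    rcases hv with (⟨l, hl, rfl⟩ | hv) | ⟨l, hl, rfl⟩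
    · exact hC (hfC l (by simp at hl; omega))
    · exact hE hv
    · exact hC (hfC l (by simp at hl; omega))
  · have e1 := of_seq (G := G) f (Nat.zero_le i) fun l _ hl => hadj l (by omega)
    have e2 := of_seq (G := G) f hj fun l _ hl => hadj l (by omega)
    rw [hf0] at e1
    rw [hfp] at e2
    refine ((e1.mono ?_).trans (hJ.mono ?_)).trans (e2.mono ?_)
    · rintro _ ⟨l, hl, rfl⟩
      simp only [Finset.coe_union, Set.mem_union, Finset.mem_coe, Finset.mem_image]
      exact Or.inl (Or.inl ⟨l, by simp at hl ⊢; omega, rfl⟩)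
    · intro v hv
      simp only [Finset.coe_union, Set.mem_union, Finset.mem_coe, Finset.mem_image]
      rcases hv with rfl | rfl | hv
      · exact Or.inl (Or.inl ⟨i, by simp, rfl⟩)
      · exact Or.inr ⟨j, by simp [hj], rfl⟩
      · exact Or.inl (Or.inr hv)
    · rintro _ ⟨l, hl, rfl⟩
      simp only [Finset.coe_union, Set.mem_union, Finset.mem_coe, Finset.mem_image]
      exact Or.inr ⟨l, by simp at hl ⊢; omega, rfl⟩

end Joins

/-- The number of neighbours of `x` in `C`. -/
noncomputable def dIn (G : SimpleGraph V) (C : Finset V) (x : V) : ℕ := (C.filter (G.Adj x)).card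

theorem dIn_le (G : SimpleGraph V) (C : Finset V) (x : V) : dIn G C x ≤ C.card :=
  Finset.card_filter_le _ _

theorem dIn_lt {G : SimpleGraph V} {C : Finset V} {x : V} (hx : x ∈ C) : dIn G C x < C.card := by
  refine Finset.card_lt_card (Finset.filter_ssubset.2 ⟨x, hx, G.irrefl⟩)

theorem dIn_eq_card {G : SimpleGraph V} {C : Finset V} {x : V} (h : dIn G C x = C.card) :
    ∀ v ∈ C, G.Adj x v := by
  intro v hv
  rw [← Finset.eq_of_subset_of_card_le (Finset.filter_subset (G.Adj x) C) h.ge] at hv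
  exact (Finset.mem_filter.1 hv).2

theorem dIn_union {G : SimpleGraph V} {C D : Finset V} (h : Disjoint C D) (x : V) :
    dIn G (C ∪ D) x = dIn G C x + dIn G D x := by
  rw [dIn, Finset.filter_union, Finset.card_union_of_disjoint]
  · rfl
  · exact Finset.disjoint_filter_filter h

theorem exists_adj_of_dIn {G : SimpleGraph V} {C : Finset V} {x : V} (E : Finset V)
    (h : E.card < dIn G C x) : ∃ v ∈ C, G.Adj x v ∧ v ∉ E := by
  obtain ⟨v, hv, hvE⟩ := Finset.exists_mem_notMem_of_card_lt_card h
  exact ⟨v, (Finset.mem_filter.1 hv).1, (Finset.mem_filter.1 hv).2, hvE⟩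

/-- A vertex outside a shortest path has at most three neighbours on it, and if it has three, then
it can replace an inner vertex. -/
theorem exchange {G : SimpleGraph V} {C : Finset V} {s t x : V} (h : Joins G C s t)
    (hmin : ∀ C' : Finset V, C' ⊆ insert x C → Joins G C' s t → C.card ≤ C'.card) :
    dIn G C x ≤ 3 ∧ (dIn G C x = 3 →
      ∃ m ∈ C, m ≠ s ∧ m ≠ t ∧ Joins G (insert x (C.erase m) : Finset V) s t) := by
  obtain ⟨p, f, hf0, hfp, hinj, hC, hcard, hadj, hshort⟩ :=
    h.exists_path_of_minimal (P := ↑(insert x C)) (by simp) fun C' h1 h2 =>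
      hmin C' (Finset.coe_subset.1 h1) h2
  set I := (Finset.range (p + 1)).filter fun i => G.Adj x (f i) with hI
  have hd : dIn G C x = I.card := by
    rw [dIn, hC, Finset.filter_image, Finset.card_image_of_injOn]
    exact hinj.mono fun i hi => by simp at hi ⊢; omega
  -- The detour through `x` costs one vertex, so two neighbours of `x` on the path are at most two
  -- steps apart. Three neighbours must be consecutive, and then the middle one can be replaced by
  -- `x`.
  have hI2 : ∀ i ∈ I, ∀ j ∈ I, j ≤ i + 2 := by
    intro i hi j hj
    simp only [hI, Finset.mem_filter, Finset.mem_range] at hi hj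
    by_contra hlt
    have := hshort i j (by omega) (by omega) {x} (by simp)
      (.cons hi.2.symm (by simp) (.of_adj hj.2 (by simp) (by simp)))
    simp at this
    omega
  rcases I.eq_empty_or_nonempty with h0 | hne
  · rw [hd, h0]
    simp
  set a := I.min' hne with ha
  have hsub : I ⊆ Finset.Icc a (a + 2) := fun i hi =>
    Finset.mem_Icc.2 ⟨Finset.min'_le _ _ hi, hI2 a (Finset.min'_mem _ _) i hi⟩
  have hc3 : (Finset.Icc a (a + 2)).card = 3 := by simp; omega
  refine ⟨by rw [hd, ← hc3]; exact Finset.card_le_card hsub, fun h3 => ?_⟩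
  have hIeq := Finset.eq_of_subset_of_card_le hsub (by rw [hc3, ← hd, h3])
  have hmem : ∀ i, i ∈ I ↔ i ≤ p ∧ G.Adj x (f i) := fun i => by simp [hI]
  have ha0 := (hmem a).1 (by rw [hIeq]; simp)
  have ha2 := (hmem (a + 2)).1 (by rw [hIeq]; simp)
  have hne' : ∀ i ≤ p, i ≠ a + 1 → f i ≠ f (a + 1) := fun i hi hia h =>
    hia (hinj (by simpa using hi) (by simp; omega) h)
  have hmemC : ∀ i ≤ p, i ≠ a + 1 → f i ∈ insert x (C.erase (f (a + 1))) := fun i hi hia =>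
    Finset.mem_insert_of_mem (Finset.mem_erase.2 ⟨hne' i hi hia, by
      rw [hC]; exact Finset.mem_image_of_mem f (by simp; omega)⟩)
  refine ⟨f (a + 1), ?_, ?_, ?_, ?_⟩
  · rw [hC]
    exact Finset.mem_image_of_mem f (by simp; omega)
  · rw [← hf0]
    exact (hne' 0 (by omega) (by omega)).symm
  · rw [← hfp]
    exact (hne' p (by omega) (by omega)).symm
  · have e1 := Joins.of_seq (G := G) f (Nat.zero_le a) fun l _ hl => hadj l (by omega)
    have e2 := Joins.of_seq (G := G) f ha2.1 fun l _ hl => hadj l (by omega)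
    rw [hf0] at e1
    rw [hfp] at e2
    refine (e1.mono ?_).trans (.cons ha0.2.symm (hmemC a ha0.1 (by omega))
      (.cons ha2.2 (by simp) (e2.mono ?_)))
    · rintro _ ⟨l, hl, rfl⟩
      simp only [Set.mem_Icc] at hl
      exact hmemC l (by omega) (by omega)
    · rintro _ ⟨l, hl, rfl⟩
      simp only [Set.mem_Icc] at hl
      exact hmemC l (by omega) (by omega)

end

/-! ### Optimal partial linkings -/

section

variable {V : Type*} {G : SimpleGraph V} {W : Finset V} {K : ℕ} {S : TerminalPairs V K}

/-- Disjoint sets `C i ⊆ W` joining the terminal pairs with index in `F`; the other sets consist of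
the two terminals only. -/
structure Linking (G : SimpleGraph V) (W : Finset V) {K : ℕ} (S : TerminalPairs V K)
    (F : Finset (Fin K)) (C : Fin K → Finset V) : Prop where
  subset : ∀ i, C i ⊆ W
  disj : ∀ i j, i ≠ j → Disjoint (C i) (C j)
  joins : ∀ i ∈ F, Joins G (C i) (S.s i) (S.t i)
  eq : ∀ i ∉ F, C i = {S.s i, S.t i}

/-- The vertices of `W` not used by `C`. -/
noncomputable def rest (W : Finset V) (C : Fin K → Finset V) : Finset V :=
  W \ Finset.univ.biUnion C

theorem mem_rest {C : Fin K → Finset V} {v : V} : v ∈ rest W C ↔ v ∈ W ∧ ∀ i, v ∉ C i := by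
  simp [rest]

/-- The number of vertices used by `C`. -/
def size (C : Fin K → Finset V) : ℕ := ∑ i, (C i).card

theorem size_update (C : Fin K → Finset V) (j : Fin K) (Y : Finset V) :
    size (Function.update C j Y) + (C j).card = size C + Y.card := by
  have h1 := Finset.add_sum_erase Finset.univ (fun i => (C i).card) (Finset.mem_univ j)
  have h2 := Finset.add_sum_erase Finset.univ (fun i => (Function.update C j Y i).card)
    (Finset.mem_univ j)
  have h3 : ∑ i ∈ Finset.univ.erase j, (Function.update C j Y i).card =
      ∑ i ∈ Finset.univ.erase j, (C i).card :=
    Finset.sum_congr rfl fun i hi => by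
      rw [Function.update_of_ne (Finset.ne_of_mem_erase hi)]
  simp only [Function.update_self] at h2
  simp only [size]
  omega

namespace Linking

variable {F : Finset (Fin K)} {C : Fin K → Finset V}

theorem s_mem (h : Linking G W S F C) (i : Fin K) : S.s i ∈ C i := by
  by_cases hi : i ∈ F
  · exact (h.joins i hi).left_mem
  · rw [h.eq i hi]
    simp

theorem t_mem (h : Linking G W S F C) (i : Fin K) : S.t i ∈ C i := by
  by_cases hi : i ∈ F
  · exact (h.joins i hi).right_mem
  · rw [h.eq i hi]
    simp

theorem two_le (h : Linking G W S F C) (i : Fin K) : 2 ≤ (C i).card :=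
  Finset.one_lt_card.2 ⟨_, h.s_mem i, _, h.t_mem i, S.s_ne_t i i⟩

theorem card_eq_two (h : Linking G W S F C) {i : Fin K} (hi : i ∉ F) : (C i).card = 2 := by
  rw [h.eq i hi, Finset.card_pair (S.s_ne_t i i)]

theorem eq_of_mem (h : Linking G W S F C) {i j : Fin K} {v : V} (hi : v ∈ C i) (hj : v ∈ C j) :
    i = j := by
  by_contra hij
  exact Finset.disjoint_left.1 (h.disj i j hij) hi hj

theorem card_rest (h : Linking G W S F C) : (rest W C).card + size C = W.card := by
  have : (Finset.univ.biUnion C).card = size C :=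
    Finset.card_biUnion fun i _ j _ hij => h.disj i j hij
  rw [← this]
  exact Finset.card_sdiff_add_card_eq_card (Finset.biUnion_subset.2 fun i _ => h.subset i)

theorem dIn_eq (h : Linking G W S F C) (x : V) :
    dIn G W x = dIn G (rest W C) x + ∑ i, dIn G (C i) x := by
  have h1 : W = rest W C ∪ Finset.univ.biUnion C :=
    (Finset.sdiff_union_of_subset (Finset.biUnion_subset.2 fun i _ => h.subset i)).symm
  have h2 : dIn G (Finset.univ.biUnion C) x = ∑ i, dIn G (C i) x := by
    rw [dIn, Finset.filter_biUnion, Finset.card_biUnion]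
    · rfl
    · exact fun i _ j _ hij => Finset.disjoint_filter_filter (h.disj i j hij)
  rw [← h2, rest, ← dIn_union Finset.sdiff_disjoint]
  rw [rest] at h1
  exact congrArg (dIn G · x) h1

theorem update (h : Linking G W S F C) {j : Fin K} {Y : Finset V} (hY : Y ⊆ rest W C ∪ C j)
    (hJ : Joins G Y (S.s j) (S.t j)) :
    Linking G W S (insert j F) (Function.update C j Y) := by
  have hd : ∀ i, i ≠ j → Disjoint Y (C i) := by
    intro i hij
    rw [Finset.disjoint_left]
    intro v hv hvi
    rcases Finset.mem_union.1 (hY hv) with h' | h'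
    · exact (mem_rest.1 h').2 i hvi
    · exact hij (h.eq_of_mem hvi h')
  refine ⟨fun i => ?_, fun i i' hi => ?_, fun i hi => ?_, fun i hi => ?_⟩
  · by_cases hij : i = j
    · subst hij
      rw [Function.update_self]
      intro v hv
      rcases Finset.mem_union.1 (hY hv) with h' | h'
      · exact (mem_rest.1 h').1
      · exact h.subset _ h'
    · rw [Function.update_of_ne hij]
      exact h.subset i
  · by_cases hij : i = j
    · subst hij
      rw [Function.update_self, Function.update_of_ne (Ne.symm hi)]
      exact hd i' (Ne.symm hi)
    · rw [Function.update_of_ne hij]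
      by_cases hij' : i' = j
      · subst hij'
        rw [Function.update_self]
        exact (hd i hij).symm
      · rw [Function.update_of_ne hij']
        exact h.disj i i' hi
  · by_cases hij : i = j
    · subst hij
      rwa [Function.update_self]
    · rw [Function.update_of_ne hij]
      exact h.joins i ((Finset.mem_insert.1 hi).resolve_left hij)
  · rw [Finset.mem_insert, not_or] at hi
    rw [Function.update_of_ne hi.1]
    exact h.eq i hi.2

theorem unlink (h : Linking G W S F C) (j : Fin K) :
    Linking G W S (F.erase j) (Function.update C j {S.s j, S.t j}) := by
  have hsub : ∀ i, Function.update C j {S.s j, S.t j} i ⊆ C i := by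
    intro i
    by_cases hij : i = j
    · subst hij
      rw [Function.update_self]
      exact Finset.insert_subset (h.s_mem i) (Finset.singleton_subset_iff.2 (h.t_mem i))
    · rw [Function.update_of_ne hij]
  refine ⟨fun i => (hsub i).trans (h.subset i), fun i i' hi =>
    Finset.disjoint_of_subset_left (hsub i) (Finset.disjoint_of_subset_right (hsub i')
      (h.disj i i' hi)), fun i hi => ?_, fun i hi => ?_⟩
  · rw [Finset.mem_erase] at hi
    rw [Function.update_of_ne hi.1]
    exact h.joins i hi.2
  · by_cases hij : i = j
    · subst hij
      rw [Function.update_self]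
    · rw [Function.update_of_ne hij]
      exact h.eq i fun hi' => hi (Finset.mem_erase.2 ⟨hij, hi'⟩)

end Linking

/-- A linking that links as many pairs as possible (among the linkings satisfying a size bound), and
subject to this uses as few vertices as possible. -/
structure Opt (G : SimpleGraph V) (W : Finset V) (S : TerminalPairs V K) (g : ℕ → ℕ)
    (F : Finset (Fin K)) (C : Fin K → Finset V) : Prop where
  linking : Linking G W S F C
  size_le : size C ≤ g F.card
  max : ∀ F' C', Linking G W S F' C' → size C' ≤ g F'.card → F'.card ≤ F.card
  min : ∀ F' C', Linking G W S F' C' → F'.card = F.card → size C ≤ size C'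

theorem exists_opt {g : ℕ → ℕ} (hS : ∀ i, S.s i ∈ W ∧ S.t i ∈ W) (hg : 2 * K ≤ g 0) :
    ∃ F C, Opt G W S g F C := by
  have h0 : Linking G W S ∅ fun i => {S.s i, S.t i} := by
    refine ⟨fun i => Finset.insert_subset (hS i).1 (Finset.singleton_subset_iff.2 (hS i).2),
      fun i j hij => ?_, by simp, by simp⟩
    have h1 := S.s_injective.ne hij
    have h2 := S.t_injective.ne hij
    have h3 := S.s_ne_t i j
    have h4 := S.s_ne_t j i
    simp only [Finset.disjoint_left, Finset.mem_insert, Finset.mem_singleton]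
    grind
  have h0' : size (fun i => {S.s i, S.t i}) ≤ g 0 := by
    refine le_trans (le_of_eq ?_) hg
    simp [size, Finset.card_pair (S.s_ne_t _ _), mul_comm]
  -- The number of linked pairs is maximised by minimising `K - p.1.card`; the size is minimised
  -- only afterwards, among the linkings with that many pairs.
  obtain ⟨⟨F₁, C₁⟩, ⟨h1, h1'⟩, hmax⟩ := exists_argmin
    (P := fun p : Finset (Fin K) × (Fin K → Finset V) =>
      Linking G W S p.1 p.2 ∧ size p.2 ≤ g p.1.card)
    (fun p => K - p.1.card) ⟨⟨∅, fun i => {S.s i, S.t i}⟩, h0, h0'⟩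
  obtain ⟨⟨F₂, C₂⟩, ⟨h2, h2', h2''⟩, hmin⟩ := exists_argmin
    (P := fun p : Finset (Fin K) × (Fin K → Finset V) =>
      Linking G W S p.1 p.2 ∧ size p.2 ≤ g p.1.card ∧ p.1.card = F₁.card)
    (fun p => size p.2) ⟨⟨F₁, C₁⟩, h1, h1', rfl⟩
  have hK : ∀ F : Finset (Fin K), F.card ≤ K := fun F => by
    simpa using Finset.card_le_univ F
  refine ⟨F₂, C₂, h2, h2', fun F' C' h hs => ?_, fun F' C' h hc => ?_⟩
  · have := hmax (F', C') ⟨h, hs⟩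
    have a1 := hK F'
    have a2 := hK F₁
    simp only at this h2''
    omega
  · by_contra hlt
    push Not at hlt
    simp only at h2' h2'' hmin
    have := hmin (F', C') ⟨h, by simp only; rw [hc]; omega, hc.trans h2''⟩
    simp only at this
    omega

namespace Opt

variable {g : ℕ → ℕ} {F : Finset (Fin K)} {C : Fin K → Finset V}

/-- Exchange arguments trade an optimal linking for another one with as many pairs and no more
vertices; by this lemma every consequence of optimality is then available for the new linking. -/
theorem of_eq (h : Opt G W S g F C) {F' : Finset (Fin K)} {C' : Fin K → Finset V}
    (hL : Linking G W S F' C') (hF : F'.card = F.card) (hs : size C' ≤ size C) :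
    Opt G W S g F' C' :=
  ⟨hL, by rw [hF]; exact hs.trans h.size_le, fun _ _ h1 h2 => hF ▸ h.max _ _ h1 h2,
    fun _ _ h1 h2 => hs.trans (h.min _ _ h1 (h2.trans hF))⟩

/-- A smaller set inside `insert x (C j)` joining the terminals would give a smaller linking of the
same pairs, so `C j` is still shortest when the unused vertex `x` is offered to it. -/
theorem exchange (h : Opt G W S g F C) {j : Fin K} (hj : j ∈ F) {x : V} (hx : x ∈ rest W C) :
    dIn G (C j) x ≤ 3 ∧ (dIn G (C j) x = 3 → ∃ m ∈ C j, m ≠ S.s j ∧ m ≠ S.t j ∧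
      Joins G (insert x ((C j).erase m) : Finset V) (S.s j) (S.t j)) := by
  refine ParityLinkage.exchange (h.linking.joins j hj) fun C' hC' hJ => ?_
  have hl := h.linking.update (j := j) (Y := C') (fun v hv => ?_) hJ
  · have := h.min _ _ hl (by rw [Finset.insert_eq_self.2 hj])
    have := size_update C j C'
    omega
  · rcases Finset.mem_insert.1 (hC' hv) with rfl | h'
    · exact Finset.mem_union_left _ hx
    · exact Finset.mem_union_right _ h'

/-- Replacing an inner vertex of a linked set by an unused vertex. -/
theorem swap (h : Opt G W S g F C) {j : Fin K} (hj : j ∈ F) {x m : V} (hx : x ∈ rest W C)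
    (hm : m ∈ C j) (hJ : Joins G (insert x ((C j).erase m) : Finset V) (S.s j) (S.t j)) :
    ∃ C', Opt G W S g F C' ∧ (∀ i, i ≠ j → C' i = C i) ∧ C' j = insert x ((C j).erase m) ∧
      rest W C' = insert m ((rest W C).erase x) := by
  have hl := h.linking.update (j := j) (fun v hv => ?_) hJ
  · have hxC := (mem_rest.1 hx).2
    have hsz := size_update C j (insert x ((C j).erase m))
    rw [Finset.card_insert_of_notMem (fun h' => hxC j (Finset.mem_of_mem_erase h')),
      Finset.card_erase_add_one hm] at hsz
    rw [Finset.insert_eq_self.2 hj] at hl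
    refine ⟨_, h.of_eq hl rfl (by omega), fun i hi => Function.update_of_ne hi _ _,
      Function.update_self _ _ _, ?_⟩
    ext v
    simp only [mem_rest, Finset.mem_insert, Finset.mem_erase]
    constructor
    · rintro ⟨h1, h2⟩
      have h2j := h2 j
      rw [Function.update_self, Finset.mem_insert, Finset.mem_erase] at h2j
      by_cases hvm : v = m
      · exact Or.inl hvm
      · refine Or.inr ⟨fun h' => h2j (Or.inl h'), h1, fun i hi => ?_⟩
        by_cases hij : i = j
        · subst hij
          exact h2j (Or.inr ⟨hvm, hi⟩)
        · have := h2 i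
          rw [Function.update_of_ne hij] at this
          exact this hi
    · rintro (rfl | ⟨h1, h2, h3⟩)
      · refine ⟨h.linking.subset j hm, fun i hi => ?_⟩
        by_cases hij : i = j
        · subst hij
          rw [Function.update_self, Finset.mem_insert, Finset.mem_erase] at hi
          rcases hi with rfl | hi
          · exact hxC i hm
          · exact hi.1 rfl
        · rw [Function.update_of_ne hij] at hi
          exact hij (h.linking.eq_of_mem hi hm)
      · refine ⟨h2, fun i hi => ?_⟩
        by_cases hij : i = j
        · subst hij
          rw [Function.update_self, Finset.mem_insert, Finset.mem_erase] at hi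
          rcases hi with rfl | hi
          · exact h1 rfl
          · exact h3 i hi.2
        · rw [Function.update_of_ne hij] at hi
          exact h3 i hi
  · rcases Finset.mem_insert.1 hv with rfl | h'
    · exact Finset.mem_union_left _ hx
    · exact Finset.mem_union_right _ (Finset.mem_of_mem_erase h')

/-- No further pair can be linked within the size bound. -/
theorem lt_of_add (h : Opt G W S g F C) {j : Fin K} (hj : j ∉ F) {Y : Finset V}
    (hY : Y ⊆ rest W C ∪ C j) (hJ : Joins G Y (S.s j) (S.t j)) :
    g (F.card + 1) + 2 < size C + Y.card := by
  by_contra hle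
  have hl := h.linking.update hY hJ
  have h1 := h.max _ _ hl (by
    have := size_update C j Y
    rw [h.linking.card_eq_two hj] at this
    rw [Finset.card_insert_of_notMem hj]
    omega)
  rw [Finset.card_insert_of_notMem hj] at h1
  omega

theorem not_adj (h : Opt G W S g F C) {j : Fin K} (hj : j ∉ F) (hg : size C ≤ g (F.card + 1)) :
    ¬ G.Adj (S.s j) (S.t j) := by
  intro hadj
  have := h.lt_of_add hj (Y := C j) Finset.subset_union_right
    (.of_adj hadj (h.linking.s_mem j) (h.linking.t_mem j))
  rw [h.linking.card_eq_two hj] at this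
  omega

theorem not_common (h : Opt G W S g F C) {j : Fin K} (hj : j ∉ F)
    (hg : size C + 1 ≤ g (F.card + 1)) {x : V} (hx : x ∈ rest W C) (h1 : G.Adj (S.s j) x)
    (h2 : G.Adj x (S.t j)) : False := by
  have := h.lt_of_add hj (Y := {S.s j, x, S.t j}) (by
      have := h.linking.s_mem j
      have := h.linking.t_mem j
      intro v
      simp only [Finset.mem_insert, Finset.mem_singleton, Finset.mem_union]
      rintro (rfl | rfl | rfl) <;> tauto)
    (.cons h1 (by simp) (.of_adj h2 (by simp) (by simp)))
  have := Finset.card_le_three (a := S.s j) (b := x) (c := S.t j)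
  omega

theorem dIn_le_one (h : Opt G W S g F C) {j : Fin K} (hj : j ∉ F)
    (hg : size C + 1 ≤ g (F.card + 1)) {x : V} (hx : x ∈ rest W C) : dIn G (C j) x ≤ 1 := by
  by_contra hlt
  have h2 : dIn G (C j) x = (C j).card := by
    have := dIn_le G (C j) x
    rw [h.linking.card_eq_two hj] at this ⊢
    omega
  have h3 := dIn_eq_card h2
  exact h.not_common hj hg hx (h3 _ (h.linking.s_mem j)).symm (h3 _ (h.linking.t_mem j))

theorem dIn_terminal (h : Opt G W S g F C) {j : Fin K} (hj : j ∉ F)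
    (hg : size C ≤ g (F.card + 1)) {z : V} (hz : z ∈ C j) : dIn G (C j) z = 0 := by
  rw [h.linking.eq j hj] at hz ⊢
  have := h.not_adj hj hg
  have h2 : ¬ G.Adj (S.t j) (S.s j) := fun h' => this h'.symm
  rw [dIn, Finset.card_eq_zero, Finset.filter_eq_empty_iff]
  simp only [Finset.mem_insert, Finset.mem_singleton] at hz ⊢
  rintro v (rfl | rfl) <;> rcases hz with rfl | rfl <;> simp [*]

end Opt

end

/-! ### Linkages when the minimum degree exceeds half the order -/

section

variable {V : Type*} {G : SimpleGraph V} {W : Finset V} {K : ℕ} {S : TerminalPairs V K}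

theorem sum_indicator {K : ℕ} (J : Finset (Fin K)) :
    ∑ j, (if j ∈ J then 1 else 0) = J.card := by
  simp

namespace Opt

variable {g : ℕ → ℕ} {F : Finset (Fin K)} {C : Fin K → Finset V}

/-- Linking the pair `o` by `q ∈ C j` instead of linking the pair `j`. -/
theorem exchange_pairs (h : Opt G W S g F C) {o j : Fin K} (ho : o ∉ F) (hj : j ∈ F) {q : V}
    (hq : q ∈ C j) (hqs : q ≠ S.s j) (hqt : q ≠ S.t j) (h1 : G.Adj (S.s o) q)
    (h2 : G.Adj q (S.t o)) :
    ∃ F' C', Linking G W S F' C' ∧ F'.card = F.card ∧ j ∉ F' ∧ size C' + (C j).card ≤ size C + 3 ∧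
      C' j = {S.s j, S.t j} ∧ rest W C ⊆ rest W C' := by
  have hoj : o ≠ j := by rintro rfl; exact ho hj
  set C₁ := Function.update C j {S.s j, S.t j} with hC₁
  have hl1 : Linking G W S (F.erase j) C₁ := h.linking.unlink j
  have hC₁o : C₁ o = C o := Function.update_of_ne hoj _ _
  have hl2 := hl1.update (j := o) (Y := {S.s o, q, S.t o}) (fun v hv => ?_)
    (.cons h1 (by simp) (.of_adj h2 (by simp) (by simp)))
  · refine ⟨_, _, hl2, ?_, ?_, ?_, ?_, fun v hv => ?_⟩
    · rw [Finset.card_insert_of_notMem (fun h' => ho (Finset.mem_of_mem_erase h')),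
        Finset.card_erase_add_one hj]
    · simp [hoj.symm]
    · have e1 := size_update C j {S.s j, S.t j}
      have e2 := size_update C₁ o {S.s o, q, S.t o}
      have e3 := Finset.card_le_three (a := S.s o) (b := q) (c := S.t o)
      rw [hC₁o, h.linking.card_eq_two ho] at e2
      rw [Finset.card_pair (S.s_ne_t j j), ← hC₁] at e1
      omega
    · rw [Function.update_of_ne hoj.symm, hC₁, Function.update_self]
    · rw [mem_rest] at hv ⊢
      refine ⟨hv.1, fun i hi => ?_⟩
      by_cases hio : i = o
      · subst hio
        rw [Function.update_self] at hi
        simp only [Finset.mem_insert, Finset.mem_singleton] at hi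
        rcases hi with rfl | rfl | rfl
        · exact hv.2 _ (h.linking.s_mem i)
        · exact hv.2 _ hq
        · exact hv.2 _ (h.linking.t_mem i)
      · rw [Function.update_of_ne hio] at hi
        by_cases hij : i = j
        · subst hij
          rw [hC₁, Function.update_self] at hi
          simp only [Finset.mem_insert, Finset.mem_singleton] at hi
          rcases hi with rfl | rfl
          · exact hv.2 _ (h.linking.s_mem i)
          · exact hv.2 _ (h.linking.t_mem i)
        · rw [hC₁, Function.update_of_ne hij] at hi
          exact hv.2 i hi
  · simp only [Finset.mem_insert, Finset.mem_singleton] at hv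
    rcases hv with rfl | rfl | rfl
    · exact Finset.mem_union_right _ (hl1.s_mem o)
    · refine Finset.mem_union_left _ (mem_rest.2 ⟨h.linking.subset j hq, fun i hi => ?_⟩)
      by_cases hij : i = j
      · subst hij
        rw [hC₁, Function.update_self] at hi
        simp [hqs, hqt] at hi
      · rw [hC₁, Function.update_of_ne hij] at hi
        exact hij (h.linking.eq_of_mem hi hq)
    · exact Finset.mem_union_right _ (hl1.t_mem o)

/-- The linked triples whose middle vertex is a common neighbour of the terminals of the pair `o`. -/
noncomputable def triples (G : SimpleGraph V) (S : TerminalPairs V K) (F : Finset (Fin K))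
    (C : Fin K → Finset V) (o : Fin K) : Finset (Fin K) :=
  F.filter fun j => (C j).card = 3 ∧
    ∃ m ∈ C j, m ≠ S.s j ∧ m ≠ S.t j ∧ G.Adj (S.s o) m ∧ G.Adj m (S.t o)

/-- Linking `o` through the middle vertex of the triple and giving up `j` costs nothing, so the new
linking is optimal too. There `j` is unlinked, hence `x` sees at most one of its terminals, and the
middle vertex adds at most one. -/
theorem dIn_triple (h : Opt G W S g F C) {o j : Fin K} (ho : o ∉ F)
    (hj : j ∈ triples G S F C o) (hg : size C + 1 ≤ g (F.card + 1)) {x : V} (hx : x ∈ rest W C) :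
    dIn G (C j) x ≤ 2 := by
  obtain ⟨hjF, hj3, m, hm, hms, hmt, h1, h2⟩ := Finset.mem_filter.1 hj
  obtain ⟨F', C', hl, hF', hjF', hsz, hC'j, hsub⟩ := h.exchange_pairs ho hjF hm hms hmt h1 h2
  have hopt : Opt G W S g F' C' := h.of_eq hl hF' (by omega)
  have hle := hopt.dIn_le_one hjF' (by rw [hF']; omega) (hsub hx)
  rw [hC'j] at hle
  have hCj : C j = insert m {S.s j, S.t j} := by
    symm
    apply Finset.eq_of_subset_of_card_le
    · intro v
      simp only [Finset.mem_insert, Finset.mem_singleton]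
      rintro (rfl | rfl | rfl)
      · exact hm
      · exact h.linking.s_mem j
      · exact h.linking.t_mem j
    · rw [hj3, Finset.card_insert_of_notMem (by simp [hms, hmt]), Finset.card_pair (S.s_ne_t j j)]
  have : dIn G (C j) x ≤ dIn G {S.s j, S.t j} x + 1 := by
    rw [hCj, dIn, Finset.filter_insert]
    split_ifs
    · exact Finset.card_insert_le _ _
    · exact Nat.le_succ _
  omega

end Opt

section Dense

variable {δ : ℕ} {F : Finset (Fin K)} {C : Fin K → Finset V} {o : Fin K}

/-- The bound leaves at least one unused vertex. It has at most three neighbours in each set, so a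
degree of at least `3 * K + 1` forces an unused neighbour. -/
theorem Opt.two_le_rest (hδ : ∀ x ∈ W, δ ≤ dIn G W x) (h2 : 3 * K + 1 ≤ δ) (hW : W.Nonempty)
    (h : Opt G W S (fun _ => W.card - 1) F C) : size C + 1 ≤ W.card - 1 := by
  have hW' := hW.card_pos
  have hs := h.size_le
  have hc := h.linking.card_rest
  obtain ⟨x, hx⟩ : (rest W C).Nonempty := Finset.card_pos.1 (by omega)
  have h3 : ∑ j, dIn G (C j) x ≤ ∑ _j : Fin K, 3 := by
    refine Finset.sum_le_sum fun j _ => ?_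
    by_cases hj : j ∈ F
    · exact (h.exchange hj hx).1
    · have := dIn_le G (C j) x
      rw [h.linking.card_eq_two hj] at this
      omega
  have h4 := h.linking.dIn_eq x
  have h5 := hδ x (mem_rest.1 hx).1
  have h6 := dIn_lt (G := G) hx
  simp at h3
  omega

/-- The two terminals of the unlinked pair have degree sum at least `|W| + 2K + 3` but no common
unused neighbour. The excess must be found in the sets `C j`, and only a triple can supply more than
`|C j| + 2`. -/
theorem Opt.triples_le_card (hδ : ∀ x ∈ W, δ ≤ dIn G W x) (h1 : W.card + 2 * K + 3 ≤ 2 * δ)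
    (h2 : 3 * K + 1 ≤ δ) (hW : W.Nonempty)
    (h : Opt G W S (fun _ => W.card - 1) F C) (ho : o ∉ F) (B : Finset (Fin K))
    (hB : ∀ j ∈ B, j ∈ F ∧
      dIn G (C j) (S.s o) + dIn G (C j) (S.t o) + 1 ≤ (C j).card + 2) :
    B.card + 7 ≤ (Opt.triples G S F C o).card := by
  have hg := h.two_le_rest hδ h2 hW
  set J := Opt.triples G S F C o with hJ
  have hR : dIn G (rest W C) (S.s o) + dIn G (rest W C) (S.t o) ≤ (rest W C).card := by
    rw [dIn, dIn, ← Finset.card_union_of_disjoint]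
    · exact Finset.card_le_card (Finset.union_subset (Finset.filter_subset _ _)
        (Finset.filter_subset _ _))
    · rw [Finset.disjoint_left]
      intro v hv hv'
      rw [Finset.mem_filter] at hv hv'
      exact h.not_common ho hg hv.1 hv.2 hv'.2.symm
  -- Each set is allotted `|C j| + 2`. The pair `o` contributes nothing and falls short by 4,
  -- members of `B` fall short by 1, and only a triple in `J` can exceed its allotment, by 1.
  -- Summation gives the constant 7 as `4 + 3`.
  have hpt : ∀ j, dIn G (C j) (S.s o) + dIn G (C j) (S.t o) + 
      (if j ∈ ({o} : Finset (Fin K)) then 1 else 0) * 4 + (if j ∈ B then 1 else 0) ≤ (C j).card + 2 + (if j ∈ J then 1 else 0) := by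
    intro j
    have hs := dIn_le G (C j) (S.s o)
    have ht := dIn_le G (C j) (S.t o)
    by_cases hjo : j = o
    · subst hjo
      have hjB : j ∉ B := fun h' => ho (hB j h').1
      have e1 := h.dIn_terminal ho (by omega) (h.linking.s_mem j)
      have e2 := h.dIn_terminal ho (by omega) (h.linking.t_mem j)
      have e3 := h.linking.card_eq_two ho
      simp [hjB]
      omega
    by_cases hjB : j ∈ B
    · have := (hB j hjB).2
      simp [hjo, hjB]
      omega
    simp only [hjo, hjB, Finset.mem_singleton, if_false]
    by_cases hjF : j ∈ F
    · by_cases hp4 : 4 ≤ (C j).card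
      · suffices dIn G (C j) (S.s o) + dIn G (C j) (S.t o) ≤ (C j).card + 2 by omega
        by_contra hlt
        -- Three common neighbours in `C j` include one that is not a terminal of `j`; exchanging
        -- the pairs through it would save a vertex, as `C j` has at least four.
        have hun := Finset.card_union_add_card_inter ((C j).filter (G.Adj (S.s o)))
          ((C j).filter (G.Adj (S.t o)))
        have hun' : ((C j).filter (G.Adj (S.s o)) ∪ (C j).filter (G.Adj (S.t o))).card ≤
            (C j).card := Finset.card_le_card (Finset.union_subset (Finset.filter_subset _ _)
          (Finset.filter_subset _ _))
        have h3 : ({S.s j, S.t j} : Finset V).card < ((C j).filter (G.Adj (S.s o)) ∩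
            (C j).filter (G.Adj (S.t o))).card := by
          rw [Finset.card_pair (S.s_ne_t j j)]
          unfold dIn at hlt
          omega
        obtain ⟨q, hq, hq'⟩ := Finset.exists_mem_notMem_of_card_lt_card h3
        simp only [Finset.mem_inter, Finset.mem_filter, Finset.mem_insert,
          Finset.mem_singleton, not_or] at hq hq'
        obtain ⟨F', C', hl, hF', -, hsz, -⟩ :=
          h.exchange_pairs ho hjF hq.1.1 hq'.1 hq'.2 hq.1.2 hq.2.2.symm
        have := h.min _ _ hl hF'
        omega
      · by_cases hjJ : j ∈ J
        · have := (Finset.mem_filter.1 hjJ).2.1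
          simp only [hjJ, if_true]
          omega
        · by_contra hlt
          simp only [hjJ, if_false] at hlt
          have h3 : (C j).card = 3 := by have := h.linking.two_le j; omega
          obtain ⟨m, hm, hm'⟩ := Finset.exists_mem_notMem_of_card_lt_card
            (s := {S.s j, S.t j}) (t := C j) (by rw [Finset.card_pair (S.s_ne_t j j)]; omega)
          simp only [Finset.mem_insert, Finset.mem_singleton, not_or] at hm'
          exact hjJ (Finset.mem_filter.2 ⟨hjF, h3, m, hm, hm'.1, hm'.2,
            dIn_eq_card (by omega) m hm, (dIn_eq_card (C := C j) (by omega) m hm).symm⟩)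
    · have := h.linking.card_eq_two hjF
      omega
  have hsum := Finset.sum_le_sum fun j (_ : j ∈ Finset.univ) => hpt j
  simp only [Finset.sum_add_distrib, ← Finset.sum_mul, sum_indicator] at hsum
  have e1 := h.linking.dIn_eq (S.s o)
  have e2 := h.linking.dIn_eq (S.t o)
  have e3 := hδ _ (h.linking.subset o (h.linking.s_mem o))
  have e4 := hδ _ (h.linking.subset o (h.linking.t_mem o))
  have e5 := h.linking.card_rest
  have hsz : size C = ∑ i, (C i).card := rfl
  simp at hsum
  omega

/-- An unused vertex has at most three neighbours in each set, at most two in each of the seven or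
more triples, and at most one in the pair `o`. So at least `3K + 1 - (3K - 2 - 7) = 10` of its
neighbours are unused, which leaves room in the size bound for the short detours tried later. -/
theorem Opt.dIn_rest_ge (hδ : ∀ x ∈ W, δ ≤ dIn G W x) (h1 : W.card + 2 * K + 3 ≤ 2 * δ)
    (h2 : 3 * K + 1 ≤ δ) (hW : W.Nonempty)
    (h : Opt G W S (fun _ => W.card - 1) F C) (ho : o ∉ F) {x : V} (hx : x ∈ rest W C) :
    10 ≤ dIn G (rest W C) x := by
  have hg := h.two_le_rest hδ h2 hW
  have hJ := h.triples_le_card hδ h1 h2 hW ho ∅ (by simp)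
  have hpt : ∀ j, dIn G (C j) x + (if j ∈ ({o} : Finset (Fin K)) then 1 else 0) * 2 +
      (if j ∈ Opt.triples G S F C o then 1 else 0) ≤ 3 := by
    intro j
    by_cases hjJ : j ∈ Opt.triples G S F C o
    · have := h.dIn_triple ho hjJ hg hx
      have hjo : j ≠ o := by rintro rfl; exact ho (Finset.mem_filter.1 hjJ).1
      simp [hjJ, hjo]
      omega
    · by_cases hjF : j ∈ F
      · have := (h.exchange hjF hx).1
        have hjo : j ≠ o := by rintro rfl; exact ho hjF
        simp [hjJ, hjo]
        omega
      · have := h.dIn_le_one hjF hg hx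
        simp only [hjJ, if_false]
        split_ifs <;> omega
  have hsum := Finset.sum_le_sum fun j (_ : j ∈ Finset.univ) => hpt j
  simp only [Finset.sum_add_distrib, ← Finset.sum_mul, sum_indicator] at hsum
  have e1 := h.linking.dIn_eq x
  have e2 := hδ x (mem_rest.1 hx).1
  simp at hsum hJ
  omega

/-- No route from `S.s o` to `S.t o` through `x`, `y` and at most one further unused vertex exists,
so `x` and `y` have few unused neighbours together. Degree counting then demands many triples
completely adjacent to both `x` and `y`, whereas `triples_le_card` says that such triples are
outnumbered by those of `J`. -/
theorem Opt.not_both (hδ : ∀ x ∈ W, δ ≤ dIn G W x) (h1 : W.card + 2 * K + 3 ≤ 2 * δ)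
    (h2 : 3 * K + 1 ≤ δ) (hW : W.Nonempty)
    (h : Opt G W S (fun _ => W.card - 1) F C) (ho : o ∉ F) {x y : V} (hx : x ∈ rest W C)
    (hy : y ∈ rest W C) (hsx : G.Adj (S.s o) x) (hyt : G.Adj y (S.t o)) : False := by
  have hg := h.two_le_rest hδ h2 hW
  have hR := h.dIn_rest_ge hδ h1 h2 hW ho hx
  have hR' := dIn_lt (G := G) hx
  have hc := h.linking.card_rest
  have hso := h.linking.s_mem o
  have hto := h.linking.t_mem o
  have hxy : x ≠ y := by
    rintro rfl
    exact h.not_common ho hg hx hsx hyt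
  have hnadj : ¬ G.Adj x y := by
    intro hadj
    have := h.lt_of_add ho (Y := {S.s o, x, y, S.t o}) (by
        intro v
        simp only [Finset.mem_insert, Finset.mem_singleton, Finset.mem_union]
        rintro (rfl | rfl | rfl | rfl) <;> tauto)
      (.cons hsx (by simp) (.cons hadj (by simp) (.of_adj hyt (by simp) (by simp))))
    have := Finset.card_le_four (a := S.s o) (b := x) (c := y) (d := S.t o)
    omega
  have hncom : ∀ z ∈ rest W C, G.Adj x z → ¬ G.Adj y z := by
    intro z hz h1 h2
    have := h.lt_of_add ho (Y := {S.s o, x, z, y, S.t o}) (by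
        intro v
        simp only [Finset.mem_insert, Finset.mem_singleton, Finset.mem_union]
        rintro (rfl | rfl | rfl | rfl | rfl) <;> tauto)
      (.cons hsx (by simp) (.cons h1 (by simp) (.cons h2.symm (by simp)
        (.of_adj hyt (by simp) (by simp)))))
    have := Finset.card_le_five (a := S.s o) (b := x) (c := z) (d := y) (e := S.t o)
    omega
  have hRsum : dIn G (rest W C) x + dIn G (rest W C) y + 2 ≤ (rest W C).card := by
    have : ((rest W C).filter (G.Adj x) ∪ (rest W C).filter (G.Adj y) ∪ {x, y}).card ≤
        (rest W C).card := by
      refine Finset.card_le_card (Finset.union_subset (Finset.union_subset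
        (Finset.filter_subset _ _) (Finset.filter_subset _ _)) ?_)
      exact Finset.insert_subset hx (Finset.singleton_subset_iff.2 hy)
    rwa [Finset.card_union_of_disjoint, Finset.card_union_of_disjoint, Finset.card_pair hxy] at this
    · rw [Finset.disjoint_left]
      intro v hv hv'
      rw [Finset.mem_filter] at hv hv'
      exact hncom v hv.1 hv.2 hv'.2
    · have hnadj' : ¬ G.Adj y x := fun h' => hnadj h'.symm
      rw [Finset.disjoint_left]
      intro v hv hv'
      simp only [Finset.mem_union, Finset.mem_filter, Finset.mem_insert,
        Finset.mem_singleton] at hv hv'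
      rcases hv' with rfl | rfl <;> rcases hv with hv | hv <;>
        first | exact G.irrefl hv.2 | exact hnadj hv.2 | exact hnadj' hv.2
  set J := Opt.triples G S F C o with hJ
  set B := F.filter fun j => (C j).card = 3 ∧ dIn G (C j) x = 3 ∧ dIn G (C j) y = 3 with hBdef
  have hJx : ∀ j ∈ J, ∀ z ∈ rest W C, dIn G (C j) z ≤ 2 := fun j hj z hz =>
    h.dIn_triple ho hj hg hz
  have hpt : ∀ j, dIn G (C j) x + dIn G (C j) y + (if j ∈ J then 1 else 0) ≤
      (C j).card + 2 + (if j ∈ B then 1 else 0) := by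
    intro j
    have d1 := dIn_le G (C j) x
    have d2 := dIn_le G (C j) y
    have h2 := h.linking.two_le j
    by_cases hjJ : j ∈ J
    · have := hJx j hjJ x hx
      have := hJx j hjJ y hy
      have := (Finset.mem_filter.1 hjJ).2.1
      simp only [hjJ, if_true]
      omega
    simp only [hjJ, if_false]
    by_cases hjF : j ∈ F
    · have a1 := (h.exchange hjF hx).1
      have a2 := (h.exchange hjF hy).1
      by_cases hjB : j ∈ B
      · simp only [hjB, if_true]
        omega
      · simp only [hjB, if_false]
        by_contra hlt
        exact hjB (Finset.mem_filter.2 ⟨hjF, by omega, by omega, by omega⟩)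
    · have := h.linking.card_eq_two hjF
      omega
  have hsum := Finset.sum_le_sum fun j (_ : j ∈ Finset.univ) => hpt j
  simp only [Finset.sum_add_distrib, sum_indicator] at hsum
  have e1 := h.linking.dIn_eq x
  have e2 := h.linking.dIn_eq y
  have e3 := hδ _ (mem_rest.1 hx).1
  have e4 := hδ _ (mem_rest.1 hy).1
  have hBJ := h.triples_le_card hδ h1 h2 hW ho B (by
    intro j hj
    obtain ⟨hjF, hj3, hjx, hjy⟩ := Finset.mem_filter.1 hj
    refine ⟨hjF, ?_⟩
    have ax := dIn_eq_card (hjx.trans hj3.symm)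
    have ay := dIn_eq_card (hjy.trans hj3.symm)
    obtain ⟨m, hm, hm'⟩ := Finset.exists_mem_notMem_of_card_lt_card
      (s := {S.s j, S.t j}) (t := C j) (by rw [Finset.card_pair (S.s_ne_t j j)]; omega)
    simp only [Finset.mem_insert, Finset.mem_singleton, not_or] at hm'
    have hjo : o ≠ j := by rintro rfl; exact ho hjF
    -- As `u` is adjacent to all of the triple, it can replace the middle vertex `m`, which becomes
    -- free to carry a path for the pair `o`. Hence neither terminal of `o` is adjacent to `m`, and
    -- the triple has the deficiency required of members of `B`.
    have key : ∀ u v : V, u ∈ rest W C → v ∈ rest W C → u ≠ v → (∀ w ∈ C j, G.Adj u w) →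
        Joins G ({S.s o, m, v, S.t o} : Finset V) (S.s o) (S.t o) → False := by
      intro u v hu hv huv hadj hJ
      have hJm : Joins G (insert u ((C j).erase m) : Finset V) (S.s j) (S.t j) := by
        have b1 := Finset.mem_erase.2 ⟨Ne.symm hm'.1, h.linking.s_mem j⟩
        have b2 := Finset.mem_erase.2 ⟨Ne.symm hm'.2, h.linking.t_mem j⟩
        exact .cons (hadj _ (h.linking.s_mem j)).symm (Finset.mem_insert_of_mem b1)
          (.of_adj (hadj _ (h.linking.t_mem j)) (Finset.mem_insert_self _ _)
            (Finset.mem_insert_of_mem b2))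
      obtain ⟨C', hopt, hC', -, hrest⟩ := h.swap hjF hu hm hJm
      have := hopt.lt_of_add ho (Y := {S.s o, m, v, S.t o}) (by
        intro w
        have := hopt.linking.s_mem o
        have := hopt.linking.t_mem o
        rw [hrest]
        simp only [Finset.mem_insert, Finset.mem_singleton, Finset.mem_union, Finset.mem_erase]
        rintro (rfl | rfl | rfl | rfl) <;> tauto) hJ
      have e := Finset.card_le_four (a := S.s o) (b := m) (c := v) (d := S.t o)
      have := hopt.size_le
      have := h.min _ _ hopt.linking rfl
      have := hopt.min _ _ h.linking rfl
      omega
    have n1 : ¬ G.Adj (S.s o) m := fun hsm => key x y hx hy hxy ax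
      (.cons hsm (by simp) (.cons (ay m hm).symm (by simp) (.of_adj hyt (by simp) (by simp))))
    have n2 : ¬ G.Adj (S.t o) m := fun htm => key y x hy hx hxy.symm ay
      (.cons hsx (by simp) (.cons (ax m hm) (by simp) (.of_adj htm.symm (by simp) (by simp))))
    have c1 : dIn G (C j) (S.s o) ≠ 3 := fun h' => n1 (dIn_eq_card (h'.trans hj3.symm) m hm)
    have c2 : dIn G (C j) (S.t o) ≠ 3 := fun h' => n2 (dIn_eq_card (h'.trans hj3.symm) m hm)
    have d1 := dIn_le G (C j) (S.s o)
    have d2 := dIn_le G (C j) (S.t o)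
    omega)
  rw [← hJ] at hBJ
  have hsz : size C = ∑ i, (C i).card := rfl
  simp at hsum
  omega

/-- If `z` sees no unused vertex, a degree count for `z` and an unused `x` produces a linked set
that is completely adjacent to `z` and contains three neighbours of `x`. Swapping `x` for an inner
vertex frees a neighbour of `z`. The vertex `u`, found in an earlier application, is never the one
swapped in. -/
theorem Opt.exists_adj_rest (hδ : ∀ x ∈ W, δ ≤ dIn G W x) (h1 : W.card + 2 * K + 3 ≤ 2 * δ)
    (h2 : 3 * K + 1 ≤ δ) (hW : W.Nonempty)
    (h : Opt G W S (fun _ => W.card - 1) F C) {z : V} (hz : z ∈ C o) (u : V) :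
    ∃ C' m, Opt G W S (fun _ => W.card - 1) F C' ∧ m ∈ rest W C' ∧ G.Adj z m ∧
      (u ∈ rest W C → u ∈ rest W C') := by
  by_cases hex : ∃ m ∈ rest W C, G.Adj z m
  · obtain ⟨m, hm, hzm⟩ := hex
    exact ⟨C, m, h, hm, hzm, id⟩
  push Not at hex
  have hg := h.two_le_rest hδ h2 hW
  have hc := h.linking.card_rest
  obtain ⟨x, hx, hxu⟩ := Finset.exists_mem_notMem_of_card_lt_card
    (s := {u}) (t := rest W C) (by simp; omega)
  rw [Finset.mem_singleton] at hxu
  have hz0 : dIn G (rest W C) z = 0 := by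
    rw [dIn, Finset.card_eq_zero, Finset.filter_eq_empty_iff]
    exact hex
  have hxR := dIn_lt (G := G) hx
  by_cases hj : ∃ j ∈ F, dIn G (C j) z = (C j).card ∧ dIn G (C j) x = 3
  · obtain ⟨j, hj, hjz, hjx⟩ := hj
    obtain ⟨m, hm, -, -, hJ⟩ := (h.exchange hj hx).2 hjx
    obtain ⟨C', hopt, -, -, hrest⟩ := h.swap hj hx hm hJ
    refine ⟨C', m, hopt, by rw [hrest]; exact Finset.mem_insert_self _ _, dIn_eq_card hjz m hm,
      fun hu => ?_⟩
    rw [hrest]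
    exact Finset.mem_insert_of_mem (Finset.mem_erase.2 ⟨Ne.symm hxu, hu⟩)
  push Not at hj
  have hpt : ∀ j, dIn G (C j) z + dIn G (C j) x ≤ (C j).card + 2 := by
    intro j
    have d1 := dIn_le G (C j) z
    by_cases hjF : j ∈ F
    · have d2 := (h.exchange hjF hx).1
      have := hj j hjF
      omega
    · have := h.dIn_le_one hjF hg hx
      omega
  have hsum := Finset.sum_le_sum fun j (_ : j ∈ Finset.univ) => hpt j
  simp only [Finset.sum_add_distrib] at hsum
  have e1 := h.linking.dIn_eq x
  have e2 := h.linking.dIn_eq z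
  have e3 := hδ _ (mem_rest.1 hx).1
  have e4 := hδ _ (h.linking.subset o hz)
  have hsz : size C = ∑ i, (C i).card := rfl
  simp at hsum
  omega

end Dense

/-- A graph whose minimum degree is somewhat larger than half the number of vertices is linked. -/
theorem linking_of_dense {δ : ℕ} (hδ : ∀ x ∈ W, δ ≤ dIn G W x)
    (h1 : W.card + 2 * K + 3 ≤ 2 * δ) (h2 : 3 * K + 1 ≤ δ)
    (S : TerminalPairs V K) (hS : ∀ i, S.s i ∈ W ∧ S.t i ∈ W) :
    ∃ C, Linking G W S Finset.univ C := by
  by_cases hK : K = 0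
  · subst hK
    exact ⟨fun _ => ∅, ⟨fun i => i.elim0, fun i => i.elim0, fun i => i.elim0, fun i => i.elim0⟩⟩
  have hW : W.Nonempty := ⟨_, (hS ⟨0, by omega⟩).1⟩
  have hcard : 2 * K ≤ W.card - 1 := by
    obtain ⟨x, hx⟩ := hW
    have := hδ x hx
    have := dIn_lt (G := G) hx
    omega
  obtain ⟨F, C, h⟩ := exists_opt (G := G) (g := fun _ => W.card - 1) hS hcard
  by_cases hF : F = Finset.univ
  · exact ⟨C, hF ▸ h.linking⟩
  exfalso
  obtain ⟨o, ho⟩ : ∃ o, o ∉ F := by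
    by_contra hall
    push Not at hall
    exact hF (Finset.eq_univ_iff_forall.2 hall)
  obtain ⟨C₁, x, h', hx, hsx, -⟩ :=
    h.exists_adj_rest hδ h1 h2 hW (h.linking.s_mem o) (S.s o)
  obtain ⟨C₂, y, h'', hy, hty, hx'⟩ :=
    h'.exists_adj_rest hδ h1 h2 hW (h'.linking.t_mem o) x
  exact h''.not_both hδ h1 h2 hW ho (hx' hx) hy hsx hty.symm

end

/-! ### A linked part when the minimum degree is about half the order -/

section

variable {V : Type*} {G : SimpleGraph V} {W : Finset V} {K : ℕ} {S : TerminalPairs V K}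

theorem Joins.exists_finset {P : Set V} {a b : V} (h : Joins G P a b) :
    ∃ Y : Finset V, ↑Y ⊆ P ∧ Joins G Y a b := by
  obtain ⟨w, hw⟩ := h
  exact ⟨w.support.toFinset, fun v hv => hw v (by simpa using hv), w, fun v hv => by simpa using hv⟩

section Sparse

variable {δ : ℕ} {F : Finset (Fin K)} {C : Fin K → Finset V} {o : Fin K}

-- Four vertices for each linked pair in addition to all `2K` terminals. With an unlinked pair left,
-- fewer than `6K` vertices are in use, so a minimum degree of `6K` guarantees unused neighbours,
-- while linking one more pair with at most four new vertices stays affordable.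
local notation "bound" => fun f : ℕ => 4 * f + 2 * K

theorem Opt.card_lt (ho : o ∉ F) : F.card < K := by
  simpa using Finset.card_lt_univ_of_notMem ho

theorem Opt.dIn_rest_ge' (hδ : ∀ x ∈ W, δ ≤ dIn G W x) (hK : 6 * K ≤ δ)
    (h : Opt G W S bound F C) (ho : o ∉ F) {v : V} (hv : v ∈ W) : 4 ≤ dIn G (rest W C) v := by
  have h1 := hδ v hv
  have h2 := h.linking.dIn_eq v
  have h3 : ∑ i, dIn G (C i) v ≤ size C := Finset.sum_le_sum fun i _ => dIn_le _ _ _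
  have h4 := h.size_le
  have h5 := Opt.card_lt ho
  omega

/-- A shortest connection would exceed the bound and so have at least seven vertices. Its second and
its last but one vertex have no common unused neighbour and see almost nothing of the path, so their
degree sum is too small for a graph on at most `2δ + 1` vertices. -/
theorem Opt.not_joins (hδ : ∀ x ∈ W, δ ≤ dIn G W x) (hW : W.card ≤ 2 * δ + 1)
    (h : Opt G W S bound F C) (ho : o ∉ F) :
    ¬ Joins G ↑(rest W C ∪ C o) (S.s o) (S.t o) := by
  intro hj
  obtain ⟨Y, ⟨hY, hYJ⟩, hmin⟩ := exists_argmin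
    (P := fun Y : Finset V => (Y : Set V) ⊆ ↑(rest W C ∪ C o) ∧ Joins G Y (S.s o) (S.t o))
    Finset.card hj.exists_finset
  have hadd := h.lt_of_add ho (Finset.coe_subset.1 hY) hYJ
  have hsz := h.size_le
  obtain ⟨p, f, hf0, hfp, hinj, hYeq, hcard, hadj, hshort⟩ :=
    hYJ.exists_path_of_minimal hY fun C' h1 h2 => hmin C' ⟨h1, h2⟩
  have hp : 6 ≤ p := by omega
  have hfR : ∀ i, 0 < i → i < p → f i ∈ rest W C := by
    intro i h0 hi
    have hm : f i ∈ Y := by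
      rw [hYeq]
      exact Finset.mem_image_of_mem f (by simp; omega)
    have hm := hY (Finset.mem_coe.2 hm)
    rw [Finset.mem_coe, Finset.mem_union, h.linking.eq o ho, Finset.mem_insert,
      Finset.mem_singleton, ← hf0, ← hfp] at hm
    rcases hm with hm | hm | hm
    · exact hm
    · have := hinj (by simp; omega) (by simp) hm
      omega
    · have := hinj (by simp; omega) (by simp) hm
      omega
  have hx := hfR 1 (by omega) (by omega)
  have hy := hfR (p - 1) (by omega) (by omega)
  set x := f 1 with hxdef
  set y := f (p - 1) with hydef
  set M := Y \ {f 0, f 2, f (p - 2), f p} with hM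
  have hMcard : Y.card ≤ M.card + 4 := by
    have := Finset.le_card_sdiff {f 0, f 2, f (p - 2), f p} Y
    have := Finset.card_le_four (a := f 0) (b := f 2) (c := f (p - 2)) (d := f p)
    rw [← hM] at *
    omega
  have hMi : ∀ v ∈ M, ∃ i, i ≤ p ∧ i ≠ 0 ∧ i ≠ 2 ∧ i ≠ p - 2 ∧ i ≠ p ∧ f i = v := by
    intro v hv
    rw [hM, Finset.mem_sdiff, hYeq] at hv
    obtain ⟨i, hi, rfl⟩ := Finset.mem_image.1 hv.1
    refine ⟨i, by simp at hi; omega, ?_, ?_, ?_, ?_, rfl⟩ <;>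
      (rintro rfl; exact hv.2 (by simp))
  have hM1 : ∀ v ∈ M, ¬ G.Adj x v ∧ ¬ G.Adj y v := by
    intro v hv
    obtain ⟨i, hi, h0, h2, h2', hp', rfl⟩ := hMi v hv
    constructor
    · intro ha
      rcases lt_trichotomy i 1 with hlt | rfl | hlt
      · omega
      · exact G.irrefl ha
      · have := hshort 1 i hlt hi ∅ (by simp) (.of_adj ha (by simp) (by simp))
        simp at this
        omega
    · intro ha
      rcases lt_trichotomy i (p - 1) with hlt | rfl | hlt
      · have := hshort i (p - 1) hlt (by omega) ∅ (by simp) (.of_adj ha.symm (by simp) (by simp))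
        simp at this
        omega
      · exact G.irrefl ha
      · omega
  have hcom : ∀ q ∈ rest W C, G.Adj x q → ¬ G.Adj y q := by
    intro q hq h1 h2
    have := hshort 1 (p - 1) (by omega) (by omega) {q} (by simp [hq])
      (.cons h1 (by simp) (.of_adj h2.symm (by simp) (by simp)))
    simp at this
    omega
  have hRsum : dIn G (rest W C) x + dIn G (rest W C) y + M.card ≤ (rest W C).card := by
    have : ((rest W C).filter (G.Adj x) ∪ (rest W C).filter (G.Adj y) ∪ M).card ≤
        (rest W C).card := by
      refine Finset.card_le_card (Finset.union_subset (Finset.union_subset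
        (Finset.filter_subset _ _) (Finset.filter_subset _ _)) fun v hv => ?_)
      obtain ⟨i, hi, h0, h2, h2', hp', rfl⟩ := hMi v hv
      exact hfR i (by omega) (by omega)
    rwa [Finset.card_union_of_disjoint, Finset.card_union_of_disjoint] at this
    · rw [Finset.disjoint_left]
      intro v hv hv'
      rw [Finset.mem_filter] at hv hv'
      exact hcom v hv.1 hv.2 hv'.2
    · rw [Finset.disjoint_left]
      intro v hv hv'
      simp only [Finset.mem_union, Finset.mem_filter] at hv
      rcases hv with hv | hv
      · exact (hM1 v hv').1 hv.2
      · exact (hM1 v hv').2 hv.2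
  have hpt : ∀ j, dIn G (C j) x + dIn G (C j) y ≤ 2 + (if j ∈ F then 1 else 0) * 4 := by
    intro j
    by_cases hjF : j ∈ F
    · have := (h.exchange hjF hx).1
      have := (h.exchange hjF hy).1
      simp [hjF]
      omega
    · have := h.dIn_le_one hjF (by omega) hx
      have := h.dIn_le_one hjF (by omega) hy
      simp [hjF]
      omega
  have hsum := Finset.sum_le_sum fun j (_ : j ∈ Finset.univ) => hpt j
  simp only [Finset.sum_add_distrib, ← Finset.sum_mul, sum_indicator] at hsum
  have e1 := h.linking.dIn_eq x
  have e2 := h.linking.dIn_eq y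
  have e3 := hδ _ (mem_rest.1 hx).1
  have e4 := hδ _ (mem_rest.1 hy).1
  have e5 := h.linking.card_rest
  simp at hsum
  omega

/-- The closed neighbourhood of `u` in `R`. -/
noncomputable def closedNbhd (G : SimpleGraph V) (R : Finset V) (u : V) : Finset V :=
  insert u (R.filter (G.Adj u))

theorem mem_closedNbhd {R : Finset V} {u v : V} :
    v ∈ closedNbhd G R u ↔ v = u ∨ (v ∈ R ∧ G.Adj u v) := by
  simp [closedNbhd]

theorem joins_of_mem_closedNbhd {R : Finset V} {P : Set V} {u v : V} (hu : u ∈ P) (hv : v ∈ P)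
    (h : v ∈ closedNbhd G R u) : Joins G P u v := by
  rcases mem_closedNbhd.1 h with rfl | h
  · exact .refl hu
  · exact .of_adj h.2 hu hv

theorem closedNbhd_subset {R : Finset V} {u : V} (hu : u ∈ R) : closedNbhd G R u ⊆ R :=
  Finset.insert_subset hu (Finset.filter_subset _ _)

theorem card_closedNbhd (R : Finset V) (u : V) : (closedNbhd G R u).card = dIn G R u + 1 :=
  Finset.card_insert_of_notMem (by simp)

theorem disjoint_closedNbhd {R : Finset V} {u v : V} (hu : u ∈ R) (hv : v ∈ R)
    (h : ¬ Joins G R u v) : Disjoint (closedNbhd G R u) (closedNbhd G R v) := by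
  rw [Finset.disjoint_left]
  intro z hz hz'
  have hzR := closedNbhd_subset hu hz
  exact h ((joins_of_mem_closedNbhd hu hzR hz).trans (joins_of_mem_closedNbhd hv hzR hz').symm)

/-- Three unused vertices with closed neighbourhoods that are disjoint up to `x` would have degree
sum at most `|W| + 6K - 7`, because each linked set contributes at most six more than its size and
each unlinked pair three. This is less than `3δ`. -/
theorem Opt.not_three_far (hδ : ∀ x ∈ W, δ ≤ dIn G W x) (hW : W.card ≤ 2 * δ + 1)
    (hK : 6 * K ≤ δ) (h : Opt G W S bound F C) (ho : o ∉ F) {u₁ u₂ u₃ : V} (x : V)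
    (h1 : u₁ ∈ rest W C) (h2 : u₂ ∈ rest W C) (h3 : u₃ ∈ rest W C)
    (h12 : closedNbhd G (rest W C) u₁ ∩ closedNbhd G (rest W C) u₂ ⊆ {x})
    (h13 : Disjoint (closedNbhd G (rest W C) u₁) (closedNbhd G (rest W C) u₃))
    (h23 : Disjoint (closedNbhd G (rest W C) u₂) (closedNbhd G (rest W C) u₃)) : False := by
  have hun := Finset.card_union_add_card_inter (closedNbhd G (rest W C) u₁)
    (closedNbhd G (rest W C) u₂)
  have hint := Finset.card_le_card h12
  have hsub : (closedNbhd G (rest W C) u₁ ∪ closedNbhd G (rest W C) u₂ ∪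
      closedNbhd G (rest W C) u₃).card ≤ (rest W C).card := Finset.card_le_card
    (Finset.union_subset (Finset.union_subset (closedNbhd_subset h1) (closedNbhd_subset h2))
      (closedNbhd_subset h3))
  rw [Finset.card_union_of_disjoint (Finset.disjoint_union_left.2 ⟨h13, h23⟩)] at hsub
  simp only [card_closedNbhd, Finset.card_singleton] at hun hint hsub
  have hpt : ∀ j, dIn G (C j) u₁ + dIn G (C j) u₂ + dIn G (C j) u₃ ≤
      (C j).card + 1 + (if j ∈ F then 1 else 0) * 5 := by
    intro j
    have := h.linking.two_le j
    by_cases hjF : j ∈ F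
    · have := (h.exchange hjF h1).1
      have := (h.exchange hjF h2).1
      have := (h.exchange hjF h3).1
      have := dIn_le G (C j) u₁
      have := dIn_le G (C j) u₂
      have := dIn_le G (C j) u₃
      simp [hjF]
      omega
    · have hsz := h.size_le
      have := h.dIn_le_one hjF (by omega) h1
      have := h.dIn_le_one hjF (by omega) h2
      have := h.dIn_le_one hjF (by omega) h3
      simp [hjF]
      omega
  have hsum := Finset.sum_le_sum fun j (_ : j ∈ Finset.univ) => hpt j
  simp only [Finset.sum_add_distrib, ← Finset.sum_mul, sum_indicator] at hsum
  have e1 := h.linking.dIn_eq u₁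
  have e2 := h.linking.dIn_eq u₂
  have e3 := h.linking.dIn_eq u₃
  have d1 := hδ _ (mem_rest.1 h1).1
  have d2 := hδ _ (mem_rest.1 h2).1
  have d3 := hδ _ (mem_rest.1 h3).1
  have e5 := h.linking.card_rest
  have e6 := Opt.card_lt ho
  have hsz : size C = ∑ i, (C i).card := rfl
  simp at hsum
  omega

/-- The vertices joined inside `R` to a neighbour of `a`. -/
def reach (G : SimpleGraph V) (R : Finset V) (a : V) : Set V :=
  {v | ∃ b ∈ R, G.Adj a b ∧ Joins G R b v}

theorem reach_subset {R : Finset V} {a v : V} (h : v ∈ reach G R a) : v ∈ R := by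
  obtain ⟨b, -, -, h⟩ := h
  exact h.right_mem

theorem reach_trans {R : Finset V} {a v w : V} (h : v ∈ reach G R a) (h' : Joins G R v w) :
    w ∈ reach G R a := by
  obtain ⟨b, hb, hab, h⟩ := h
  exact ⟨b, hb, hab, h.trans h'⟩

/-- The hypothesis `hab` makes the statement symmetric: `a` and `b` stand for the terminals of the
pair in either order. -/
theorem Opt.not_joins_reach (hδ : ∀ x ∈ W, δ ≤ dIn G W x) (hW : W.card ≤ 2 * δ + 1)
    (h : Opt G W S bound F C) (ho : o ∉ F) {a b : V} (ha : a ∈ C o) (hb : b ∈ C o)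
    (hab : ∀ P : Set V, Joins G P a b → Joins G P (S.s o) (S.t o)) {x y : V}
    (hx : x ∈ reach G (rest W C) a) (hy : y ∈ reach G (rest W C) b) :
    ¬ Joins G (rest W C) x y := by
  intro hxy
  obtain ⟨a', ha', haa', hx⟩ := hx
  obtain ⟨b', hb', hbb', hy⟩ := hy
  refine h.not_joins hδ hW ho (hab _ ?_)
  have hsub : ((rest W C : Finset V) : Set V) ⊆ ↑(rest W C ∪ C o) :=
    Finset.coe_subset.2 Finset.subset_union_left
  have hj := ((hx.trans hxy).trans hy.symm).mono hsub
  have hmem : ∀ v ∈ C o, v ∈ ((rest W C ∪ C o : Finset V) : Set V) := fun v hv =>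
    Finset.mem_coe.2 (Finset.mem_union_right _ hv)
  exact .cons haa' (hmem _ ha) (hj.trans (.of_adj hbb'.symm hj.right_mem (hmem _ hb)))

/-- Otherwise `v`, a neighbour of one terminal and a neighbour of the other lie in three different
components of the unused part, against `not_three_far`. So the unused part falls into exactly the
two sides belonging to the terminals. -/
theorem Opt.reach_cover (hδ : ∀ x ∈ W, δ ≤ dIn G W x) (hW : W.card ≤ 2 * δ + 1)
    (hK : 6 * K ≤ δ) (h : Opt G W S bound F C) (ho : o ∉ F) {v : V} (hv : v ∈ rest W C) :
    v ∈ reach G (rest W C) (S.s o) ∨ v ∈ reach G (rest W C) (S.t o) := by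
  by_contra hcon
  rw [not_or] at hcon
  have hs := h.linking.s_mem o
  have ht := h.linking.t_mem o
  have d1 := h.dIn_rest_ge' hδ hK ho (h.linking.subset o hs)
  have d2 := h.dIn_rest_ge' hδ hK ho (h.linking.subset o ht)
  obtain ⟨a, ha, hsa, -⟩ := exists_adj_of_dIn (x := S.s o) ∅
    (show (∅ : Finset V).card < dIn G (rest W C) _ by simp; omega)
  obtain ⟨b, hb, htb, -⟩ := exists_adj_of_dIn (x := S.t o) ∅
    (show (∅ : Finset V).card < dIn G (rest W C) _ by simp; omega)
  have ha' : a ∈ reach G (rest W C) (S.s o) := ⟨a, ha, hsa, .refl ha⟩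
  have hb' : b ∈ reach G (rest W C) (S.t o) := ⟨b, hb, htb, .refl hb⟩
  have hab := h.not_joins_reach hδ hW ho hs ht (fun _ => id) ha' hb'
  refine h.not_three_far hδ hW hK ho a ha hb hv ?_
    (disjoint_closedNbhd ha hv fun hj => hcon.1 (reach_trans ha' hj))
    (disjoint_closedNbhd hb hv fun hj => hcon.2 (reach_trans hb' hj))
  rw [Finset.disjoint_iff_inter_eq_empty.1 (disjoint_closedNbhd ha hb hab)]
  exact Finset.empty_subset _

/-- Let `x` take the place of `m` in `C i`. The freed vertex `m` has neighbours `w` and `y` on both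
sides, so the terminals of `o` become joined through unused vertices, contradicting `not_joins` for
the new linking. -/
theorem Opt.no_full_triple_aux (hδ : ∀ x ∈ W, δ ≤ dIn G W x) (hW : W.card ≤ 2 * δ + 1)
    (hK : 6 * K ≤ δ) (h : Opt G W S bound F C) (ho : o ∉ F) {a b : V} (ha : a ∈ C o)
    (hb : b ∈ C o) (hab : ∀ P : Set V, Joins G P a b → Joins G P (S.s o) (S.t o))
    {x y w m : V} (hx : x ∈ reach G (rest W C) a) (hy : y ∈ reach G (rest W C) b)
    (hw : w ∈ reach G (rest W C) a) (hwx : w ≠ x) {i : Fin K} (hi : i ∈ F) (hm : m ∈ C i)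
    (hms : m ≠ S.s i) (hmt : m ≠ S.t i) (hxi : ∀ v ∈ C i, G.Adj x v) (hmw : G.Adj m w)
    (hmy : G.Adj m y) : False := by
  have hxR := reach_subset hx
  have hyR := reach_subset hy
  have hwR := reach_subset hw
  have hJm : Joins G (insert x ((C i).erase m) : Finset V) (S.s i) (S.t i) := by
    have b1 := Finset.mem_erase.2 ⟨Ne.symm hms, h.linking.s_mem i⟩
    have b2 := Finset.mem_erase.2 ⟨Ne.symm hmt, h.linking.t_mem i⟩
    exact .cons (hxi _ (h.linking.s_mem i)).symm (Finset.mem_insert_of_mem b1)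
      (.of_adj (hxi _ (h.linking.t_mem i)) (Finset.mem_insert_self _ _)
        (Finset.mem_insert_of_mem b2))
  obtain ⟨C', hopt, hC', -, hrest⟩ := h.swap hi hxR hm hJm
  have hoi : o ≠ i := by rintro rfl; exact ho hi
  refine hopt.not_joins hδ hW ho (hab _ ?_)
  rw [hC' o hoi, hrest]
  have d := h.dIn_rest_ge' hδ hK ho (h.linking.subset o ha)
  obtain ⟨a', ha', haa', ha'x⟩ := exists_adj_of_dIn (x := a) {x}
    (show ({x} : Finset V).card < dIn G (rest W C) _ by simp; omega)
  rw [Finset.mem_singleton] at ha'x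
  have ha'r : a' ∈ reach G (rest W C) a := ⟨a', ha', haa', .refl ha'⟩
  -- The vertex `x` has been used up, so a way from the terminal to `w` around it is needed. It
  -- exists because otherwise the neighbourhoods of `a'` and `w` meet at most in `x`, and with `y`
  -- this contradicts `not_three_far`.
  have hj1 : Joins G {v | v ∈ rest W C ∧ v ≠ x} a' w := by
    by_contra hnj
    refine h.not_three_far hδ hW hK ho x ha' hwR hyR (fun z hz => ?_)
      (disjoint_closedNbhd ha' hyR (h.not_joins_reach hδ hW ho ha hb hab ha'r hy))
      (disjoint_closedNbhd hwR hyR (h.not_joins_reach hδ hW ho ha hb hab hw hy))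
    rw [Finset.mem_inter] at hz
    rw [Finset.mem_singleton]
    by_contra hzx
    have hzR : z ∈ {v | v ∈ rest W C ∧ v ≠ x} := ⟨closedNbhd_subset ha' hz.1, hzx⟩
    exact hnj ((joins_of_mem_closedNbhd (P := {v | v ∈ rest W C ∧ v ≠ x}) ⟨ha', ha'x⟩ hzR hz.1).trans
      (joins_of_mem_closedNbhd (P := {v | v ∈ rest W C ∧ v ≠ x}) ⟨hwR, hwx⟩ hzR hz.2).symm)
  have hj2 : ∃ b', G.Adj b b' ∧ Joins G {v | v ∈ rest W C ∧ v ≠ x} y b' := by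
    obtain ⟨b', hb', hbb', hj⟩ := hy
    refine ⟨b', hbb', hj.reached.symm.mono fun v hv => ⟨hv.right_mem, ?_⟩⟩
    rintro rfl
    exact h.not_joins_reach hδ hW ho ha hb hab hx ⟨b', hb', hbb', .refl hb'⟩ hv.symm
  obtain ⟨b', hbb', hj2⟩ := hj2
  have hsub : {v | v ∈ rest W C ∧ v ≠ x} ⊆
      ((insert m ((rest W C).erase x) ∪ C o : Finset V) : Set V) := fun v hv =>
    Finset.mem_coe.2 (Finset.mem_union_left _ (Finset.mem_insert_of_mem
      (Finset.mem_erase.2 ⟨hv.2, hv.1⟩)))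
  have hmm : m ∈ ((insert m ((rest W C).erase x) ∪ C o : Finset V) : Set V) := by simp
  have hoo : ∀ v ∈ C o, v ∈ ((insert m ((rest W C).erase x) ∪ C o : Finset V) : Set V) :=
    fun v hv => Finset.mem_coe.2 (Finset.mem_union_right _ hv)
  have hj1' := hj1.mono hsub
  have hj2' := hj2.mono hsub
  exact .cons haa' (hoo _ ha) (hj1'.trans (.cons hmw.symm hj1'.right_mem
    (.cons hmy hmm (hj2'.trans (.of_adj hbb'.symm hj2'.right_mem (hoo _ hb))))))

theorem Opt.no_full_triple (hδ : ∀ x ∈ W, δ ≤ dIn G W x) (hW : W.card ≤ 2 * δ + 1)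
    (hK : 6 * K ≤ δ) (h : Opt G W S bound F C) (ho : o ∉ F)
    {x y : V} (hx : x ∈ reach G (rest W C) (S.s o)) (hy : y ∈ reach G (rest W C) (S.t o))
    {i : Fin K} (hi : i ∈ F) (h3 : (C i).card = 3) (hxi : dIn G (C i) x = 3)
    (hyi : dIn G (C i) y = 3) : False := by
  have ax := dIn_eq_card (hxi.trans h3.symm)
  have ay := dIn_eq_card (hyi.trans h3.symm)
  have hs := h.linking.s_mem o
  have ht := h.linking.t_mem o
  obtain ⟨m, hm, hm'⟩ := Finset.exists_mem_notMem_of_card_lt_card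
    (s := {S.s i, S.t i}) (t := C i) (by rw [Finset.card_pair (S.s_ne_t i i)]; omega)
  simp only [Finset.mem_insert, Finset.mem_singleton, not_or] at hm'
  have d := h.dIn_rest_ge' hδ hK ho (h.linking.subset i hm)
  have := Finset.card_le_two (a := x) (b := y)
  obtain ⟨w, hw, hmw, hwxy⟩ := exists_adj_of_dIn (x := m) {x, y}
    (show ({x, y} : Finset V).card < dIn G (rest W C) _ by omega)
  simp only [Finset.mem_insert, Finset.mem_singleton, not_or] at hwxy
  rcases h.reach_cover hδ hW hK ho hw with hw | hw
  · exact h.no_full_triple_aux hδ hW hK ho hs ht (fun _ => id) hx hy hw hwxy.1 hi hm hm'.1 hm'.2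
      ax hmw (ay m hm).symm
  · exact h.no_full_triple_aux hδ hW hK ho ht hs (fun _ h' => h'.symm) hy hx hw hwxy.2 hi hm hm'.1
      hm'.2 ay hmw (ax m hm).symm

/-- Vertices on one side have all their unused neighbours on that side, so each side has minimum
degree at least `δ` minus the largest number of neighbours in the sets `C j`. The sides share fewer
than `2δ + 2` vertices, so one of them is small enough relative to its degree for
`linking_of_dense`. -/
theorem Opt.exists_dense_part (hδ : ∀ x ∈ W, δ ≤ dIn G W x) (hW : W.card ≤ 2 * δ + 1)
    (hK : 6 * K ≤ δ) (h : Opt G W S bound F C) (ho : o ∉ F) :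
    ∃ (U : Finset V) (ε : ℕ), U ⊆ W ∧ U.Nonempty ∧ (∀ x ∈ U, ε ≤ dIn G U x) ∧
      U.card + 2 * K + 3 ≤ 2 * ε ∧ 3 * K + 1 ≤ ε := by
  have hs := h.linking.s_mem o
  have ht := h.linking.t_mem o
  let D : V → ℕ := fun v => ∑ j, dIn G (C j) v
  have hroom : size C + 1 ≤ 4 * (F.card + 1) + 2 * K := by
    have hsz := h.size_le
    omega
  have hf := Opt.card_lt ho
  have key : ∀ a ∈ C o, ∃ U : Finset V, (∀ v, v ∈ U ↔ v ∈ reach G (rest W C) a) ∧ U ⊆ W ∧ ∃ x ∈ U,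
      (∀ v ∈ U, δ - D x ≤ dIn G U v) ∧ 3 * K + 1 ≤ δ - D x := by
    intro a ha
    have hU : ∀ v, v ∈ (rest W C).filter (· ∈ reach G (rest W C) a) ↔ v ∈ reach G (rest W C) a := fun v => by
      rw [Finset.mem_filter]
      exact ⟨fun h => h.2, fun h => ⟨reach_subset h, h⟩⟩
    have d := h.dIn_rest_ge' hδ hK ho (h.linking.subset o ha)
    obtain ⟨b, hb, hab, -⟩ := exists_adj_of_dIn (x := a) ∅
      (show (∅ : Finset V).card < dIn G (rest W C) _ by simp; omega)
    have hbU : b ∈ (rest W C).filter (· ∈ reach G (rest W C) a) := (hU b).2 ⟨b, hb, hab, .refl hb⟩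
    obtain ⟨x, hx, hmax⟩ := Finset.exists_max_image _ D ⟨b, hbU⟩
    have hUW : (rest W C).filter (· ∈ reach G (rest W C) a) ⊆ W := fun v hv =>
      (mem_rest.1 (Finset.mem_filter.1 hv).1).1
    refine ⟨(rest W C).filter (· ∈ reach G (rest W C) a), hU, hUW, x, hx, fun v hv => ?_, ?_⟩
    · have h1 := h.linking.dIn_eq v
      have h2 : dIn G ((rest W C).filter (· ∈ reach G (rest W C) a)) v = dIn G (rest W C) v := by
        rw [dIn, dIn, Finset.filter_filter]
        congr 1
        refine Finset.filter_congr fun w hw => ⟨fun h => h.2, fun h => ⟨?_, h⟩⟩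
        exact reach_trans ((hU v).1 hv) (.of_adj h (reach_subset ((hU v).1 hv)) hw)
      have h3 := hδ v (hUW hv)
      have h4 := hmax v hv
      simp only [D] at h4 ⊢
      omega
    · have hxR := (Finset.mem_filter.1 hx).1
      have hpt : ∀ j, dIn G (C j) x ≤ 1 + (if j ∈ F then 1 else 0) * 2 := by
        intro j
        by_cases hjF : j ∈ F
        · have := (h.exchange hjF hxR).1
          simp [hjF]
          omega
        · have := h.dIn_le_one hjF hroom hxR
          simp [hjF]
          omega
      have hsum := Finset.sum_le_sum fun j (_ : j ∈ Finset.univ) => hpt j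
      simp only [Finset.sum_add_distrib, ← Finset.sum_mul, sum_indicator] at hsum
      simp at hsum
      simp only [D]
      omega
  obtain ⟨U₁, hU₁, hU₁W, x, hx, hdx, hKx⟩ := key _ hs
  obtain ⟨U₂, hU₂, hU₂W, y, hy, hdy, hKy⟩ := key _ ht
  have hxR := reach_subset ((hU₁ x).1 hx)
  have hyR := reach_subset ((hU₂ y).1 hy)
  have hcard : U₁.card + U₂.card ≤ (rest W C).card := by
    rw [← Finset.card_union_of_disjoint]
    · exact Finset.card_le_card (Finset.union_subset (fun v hv => reach_subset ((hU₁ v).1 hv))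
        fun v hv => reach_subset ((hU₂ v).1 hv))
    · rw [Finset.disjoint_left]
      intro v h1 h2
      exact h.not_joins_reach hδ hW ho hs ht (fun _ => id) ((hU₁ v).1 h1) ((hU₂ v).1 h2)
        (.refl (reach_subset ((hU₁ v).1 h1)))
  -- For a linked triple the right side is 11, while full adjacency to both vertices would give 12.
  -- This is the one case that needs `no_full_triple`.
  have hpt : ∀ j, (dIn G (C j) x + dIn G (C j) y) * 2 ≤
      (C j).card + 2 + (if j ∈ F then 1 else 0) * 6 := by
    intro j
    have := h.linking.two_le j
    have := dIn_le G (C j) x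
    have := dIn_le G (C j) y
    by_cases hjF : j ∈ F
    · have := (h.exchange hjF hxR).1
      have := (h.exchange hjF hyR).1
      simp only [hjF, if_true]
      by_contra hlt
      exact h.no_full_triple hδ hW hK ho ((hU₁ x).1 hx) ((hU₂ y).1 hy) hjF (by omega) (by omega)
        (by omega)
    · have := h.dIn_le_one hjF hroom hxR
      have := h.dIn_le_one hjF hroom hyR
      simp [hjF]
      omega
  have hsum := Finset.sum_le_sum fun j (_ : j ∈ Finset.univ) => hpt j
  simp only [Finset.sum_add_distrib, ← Finset.sum_mul, sum_indicator] at hsum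
  have e5 := h.linking.card_rest
  have hsz : size C = ∑ i, (C i).card := rfl
  simp only [Finset.sum_const, Finset.card_univ, Fintype.card_fin, smul_eq_mul] at hsum
  by_cases hd : U₁.card + 2 * K + 3 ≤ 2 * (δ - D x)
  · exact ⟨U₁, _, hU₁W, ⟨x, hx⟩, hdx, hd, hKx⟩
  · refine ⟨U₂, _, hU₂W, ⟨y, hy⟩, hdy, ?_, hKy⟩
    simp only [D] at hd hKx hKy ⊢
    omega

end Sparse

/-- A graph in which all degrees are at least `δ ≥ 6 * K`, and which has at most `2 * δ + 1`
vertices, contains a `K`-linked induced subgraph with at least `2 * K` vertices. -/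
theorem exists_linked_part {δ : ℕ} (hδ : ∀ x ∈ W, δ ≤ dIn G W x) (hW : W.card ≤ 2 * δ + 1)
    (hne : W.Nonempty) (hK : 6 * K ≤ δ) :
    ∃ U ⊆ W, 2 * K ≤ U.card ∧ ∀ S : TerminalPairs V K, (∀ i, S.s i ∈ U ∧ S.t i ∈ U) →
      ∃ C, Linking G U S Finset.univ C := by
  by_cases hall : ∀ S : TerminalPairs V K, (∀ i, S.s i ∈ W ∧ S.t i ∈ W) →
      ∃ C, Linking G W S Finset.univ C
  · refine ⟨W, subset_rfl, ?_, hall⟩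
    obtain ⟨x, hx⟩ := hne
    have := hδ x hx
    have := dIn_lt (G := G) hx
    omega
  push Not at hall
  obtain ⟨S, hS, hno⟩ := hall
  obtain ⟨F, C, h⟩ := exists_opt (G := G) (g := fun f => 4 * f + 2 * K) hS (by simp)
  obtain ⟨o, ho⟩ : ∃ o, o ∉ F := by
    by_contra hall
    push Not at hall
    exact hno C (Finset.eq_univ_iff_forall.2 hall ▸ h.linking)
  obtain ⟨U, ε, hUW, ⟨x, hx⟩, hε, h1, h2⟩ := h.exists_dense_part hδ hW hK ho
  refine ⟨U, hUW, ?_, fun S hS => linking_of_dense hε h1 h2 S hS⟩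
  have := hε x hx
  have := dIn_lt (G := G) hx
  omega

end

/-! ### Linked sets of vertices -/

section

variable {V : Type*}

/-- Every way of pairing up elements of `X` can be realised by disjoint connected subgraphs of `G`,
which moreover avoid the remaining elements of `X`. The pairs are the elements with a common label,
and the colour classes of `c` are the disjoint subgraphs. -/
def Linked (G : SimpleGraph V) (X : Finset V) : Prop :=
  ∀ l : V → ℕ, (∀ n, (X.filter (l · = n)).card ≤ 2) → ∃ c : V → ℕ, (∀ x ∈ X, c x = l x) ∧
    ∀ x ∈ X, ∀ y ∈ X, l x = l y → Joins G {v | c v = l x} x y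

/-- Labels on `X` are doubled and every other vertex receives an odd label of its own. A labelling
of a small set thus extends to a larger one without creating new pairs, and halving recovers the
original labels. -/
theorem exists_fresh_labels [Finite V] (X : Finset V) (l : V → ℕ)
    (hl : ∀ n, (X.filter (l · = n)).card ≤ 2) :
    ∃ l' : V → ℕ, (∀ x ∈ X, l' x = 2 * l x) ∧ (∀ x ∉ X, ∀ y, l' x = l' y → x = y) ∧
      ∀ (Y : Finset V) n, (Y.filter (l' · = n)).card ≤ 2 := by
  obtain ⟨e, he⟩ := Countable.exists_injective_nat V
  set l' : V → ℕ := fun v => if v ∈ X then 2 * l v else 2 * e v + 1 with hl'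
  have h1 : ∀ x ∈ X, l' x = 2 * l x := fun x hx => if_pos hx
  have h2 : ∀ x ∉ X, l' x = 2 * e x + 1 := fun x hx => if_neg hx
  have h3 : ∀ x ∉ X, ∀ y, l' x = l' y → x = y := by
    intro x hx y hxy
    rw [h2 x hx] at hxy
    by_cases hy : y ∈ X
    · rw [h1 y hy] at hxy
      omega
    · rw [h2 y hy] at hxy
      exact he (by omega)
  refine ⟨l', h1, h3, fun Y n => ?_⟩
  by_cases hex : ∃ v ∈ Y.filter (l' · = n), v ∉ X
  · obtain ⟨v, hv, hvX⟩ := hex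
    rw [Finset.mem_filter] at hv
    refine le_trans (Finset.card_le_one.2 fun a ha b hb => ?_) one_le_two
    rw [Finset.mem_filter] at ha hb
    rw [← h3 v hvX a (hv.2.trans ha.2.symm), h3 v hvX b (hv.2.trans hb.2.symm)]
  · push Not at hex
    refine le_trans (Finset.card_le_card fun v hv => ?_) (hl (n / 2))
    have hvX := hex v hv
    rw [Finset.mem_filter] at hv ⊢
    rw [h1 v hvX] at hv
    exact ⟨hvX, by omega⟩

theorem Linked.le {G H : SimpleGraph V} {X : Finset V} (h : Linked G X) (hGH : G ≤ H) :
    Linked H X := by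
  intro l hl
  obtain ⟨c, h1, h2⟩ := h l hl
  exact ⟨c, h1, fun x hx y hy hxy => (h2 x hx y hy hxy).le hGH⟩

theorem Linked.subset [Finite V] {G : SimpleGraph V} {X Y : Finset V} (h : Linked G X)
    (hYX : Y ⊆ X) : Linked G Y := by
  intro l hl
  obtain ⟨l', h1, h2, h3⟩ := exists_fresh_labels Y l hl
  obtain ⟨c, hc1, hc2⟩ := h l' (h3 X)
  refine ⟨fun v => c v / 2, fun x hx => ?_, fun x hx y hy hxy => ?_⟩
  · simp only [hc1 x (hYX hx), h1 x hx]
    omega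
  · refine (hc2 x (hYX hx) y (hYX hy) (by rw [h1 x hx, h1 y hy, hxy])).mono fun v hv => ?_
    simp only [Set.mem_ofPred_eq, h1 x hx] at hv ⊢
    omega

theorem Joins.of_restr {G : SimpleGraph V} {P Q : Set V} {a b : V} (h : Joins (restr G Q) P a b)
    (ha : a ∈ Q) : Joins G (P ∩ Q) a b :=
  h.transfer ⟨h.left_mem, ha⟩ fun _ _ huv hu hv _ => .of_adj huv.1 ⟨hu, huv.2.1⟩ ⟨hv, huv.2.2⟩

/-- Linkedness is transported along disjoint paths. -/
theorem Linked.of_paths {G : SimpleGraph V} {X Q : Finset V} {c π : V → V}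
    (h : ∀ x ∈ X, π x ∈ Q ∧ Joins G {v | c v = x ∧ (v ∈ Q → v = π x)} x (π x))
    (hL : Linked (restr G Q) (X.image π)) : Linked G X := by
  intro l hl
  have hc : ∀ x ∈ X, c (π x) = x := fun x hx => (h x hx).2.right_mem.1
  obtain ⟨c₂, h1, h2⟩ := hL (fun v => l (c v)) (fun n => by
    refine le_trans (Finset.card_le_card (t := (X.filter (l · = n)).image π) fun v hv => ?_)
      (Finset.card_image_le.trans (hl n))
    rw [Finset.mem_filter] at hv
    obtain ⟨x, hx, rfl⟩ := Finset.mem_image.1 hv.1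
    rw [hc x hx] at hv
    exact Finset.mem_image_of_mem π (Finset.mem_filter.2 ⟨hx, hv.2⟩))
  have hc2 : ∀ x ∈ X, c₂ (π x) = l x := fun x hx => by
    rw [h1 _ (Finset.mem_image_of_mem π hx), hc x hx]
  set d : V → ℕ := fun v => if v ∈ Q then c₂ v else l (c v) with hd
  have hpath : ∀ x ∈ X, Joins G {v | d v = l x} x (π x) := fun x hx =>
    (h x hx).2.mono fun v hv => by
      by_cases hvQ : v ∈ Q
      · rw [hv.2 hvQ]
        simp [hd, (h x hx).1, hc2 x hx]
      · simp [hd, hvQ, hv.1]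
  refine ⟨d, fun x hx => (hpath x hx).left_mem, fun x hx y hy hxy => ?_⟩
  have hmid := (h2 _ (Finset.mem_image_of_mem π hx) _ (Finset.mem_image_of_mem π hy)
    (by simp only [hc x hx, hc y hy, hxy])).of_restr (Finset.mem_coe.2 (h x hx).1)
  refine (hpath x hx).trans ((hmid.mono fun v hv => ?_).trans ?_)
  · simp only [Set.mem_inter_iff, Set.mem_ofPred_eq, hc x hx, Finset.mem_coe] at hv
    simp [hd, hv.2, hv.1]
  · rw [hxy]
    exact (hpath y hy).symm

/-- The elements of a set of even size can be paired up in such a way that any two elements with a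
common label are paired. -/
theorem exists_pairing (l : V → ℕ) (K : ℕ) (Y : Finset V) (hY : Y.card = 2 * K)
    (hl : ∀ n, (Y.filter (l · = n)).card ≤ 2) :
    ∃ S : TerminalPairs V K, (∀ i, S.s i ∈ Y ∧ S.t i ∈ Y) ∧ (∀ y ∈ Y, ∃ i, y = S.s i ∨ y = S.t i) ∧
      ∀ x ∈ Y, ∀ y ∈ Y, x ≠ y → l x = l y →
        ∃ i, (x = S.s i ∧ y = S.t i) ∨ (x = S.t i ∧ y = S.s i) := by
  induction K generalizing Y with
  | zero =>
    have : Y = ∅ := Finset.card_eq_zero.1 (by omega)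
    subst this
    exact ⟨⟨fun i => i.elim0, fun i => i.elim0, fun i => i.elim0, fun i => i.elim0,
      fun i => i.elim0⟩, fun i => i.elim0, by simp, by simp⟩
  | succ K ih =>
    obtain ⟨a, b, ha, hb, hab, hpair⟩ : ∃ a b, a ∈ Y ∧ b ∈ Y ∧ a ≠ b ∧
        ∀ x ∈ Y, ∀ y ∈ Y, x ≠ y → l x = l y → (x = a ∨ x = b) →
          (x = a ∧ y = b) ∨ (x = b ∧ y = a) := by
      by_cases hex : ∃ a b, a ∈ Y ∧ b ∈ Y ∧ a ≠ b ∧ l a = l b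
      · obtain ⟨a, b, ha, hb, hab, hlab⟩ := hex
        refine ⟨a, b, ha, hb, hab, fun x hx y hy hxy hlxy hx' => ?_⟩
        have h1 : y = a ∨ y = b := by
          by_contra hy'
          rw [not_or] at hy'
          have hsub : ({a, b, y} : Finset V) ⊆ Y.filter (l · = l a) := by
            intro v
            simp only [Finset.mem_insert, Finset.mem_singleton, Finset.mem_filter]
            rintro (rfl | rfl | rfl)
            · exact ⟨ha, rfl⟩
            · exact ⟨hb, hlab.symm⟩
            · refine ⟨hy, ?_⟩
              rcases hx' with rfl | rfl
              · exact hlxy.symm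
              · rw [← hlxy, hlab]
          have h3 := (Finset.card_le_card hsub).trans (hl _)
          rw [Finset.card_eq_three.2 ⟨a, b, y, hab, Ne.symm hy'.1, Ne.symm hy'.2, rfl⟩] at h3
          omega
        grind
      · push Not at hex
        obtain ⟨a, ha, b, hb, hab⟩ := Finset.one_lt_card.1 (show 1 < Y.card by omega)
        exact ⟨a, b, ha, hb, hab, fun x hx y hy hxy hlxy => absurd hlxy (hex x y hx hy hxy)⟩
    obtain ⟨S, h1, h2, h3⟩ := ih ((Y.erase a).erase b)
      (by
        rw [Finset.card_erase_of_mem (Finset.mem_erase.2 ⟨hab.symm, hb⟩),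
          Finset.card_erase_of_mem ha]
        omega)
      (fun n => (Finset.card_le_card (Finset.filter_subset_filter _
        ((Finset.erase_subset _ _).trans (Finset.erase_subset _ _)))).trans (hl n))
    have hmem : ∀ v, v ∈ (Y.erase a).erase b ↔ v ≠ b ∧ v ≠ a ∧ v ∈ Y := fun v => by
      simp [Finset.mem_erase]
    simp only [hmem] at h1 h2 h3
    refine ⟨⟨Fin.cons a S.s, Fin.cons b S.t, Fin.cons_injective_iff.2 ⟨?_, S.s_injective⟩,
      Fin.cons_injective_iff.2 ⟨?_, S.t_injective⟩, fun i j => ?_⟩, fun i => ?_, fun y hy => ?_,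
      fun x hx y hy hxy hlxy => ?_⟩
    · rintro ⟨i, hi⟩
      exact (h1 i).1.2.1 hi
    · rintro ⟨i, hi⟩
      exact (h1 i).2.1 hi
    · refine Fin.cases ?_ (fun i => ?_) i <;> refine Fin.cases ?_ (fun j => ?_) j
      · simpa using hab
      · simpa using (h1 j).2.2.1.symm
      · simpa using (h1 i).1.1
      · simpa using S.s_ne_t i j
    · refine Fin.cases ?_ (fun i => ?_) i
      · exact ⟨ha, hb⟩
      · exact ⟨(h1 i).1.2.2, (h1 i).2.2.2⟩
    · by_cases hya : y = a
      · exact ⟨0, Or.inl (by simpa using hya)⟩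
      by_cases hyb : y = b
      · exact ⟨0, Or.inr (by simpa using hyb)⟩
      obtain ⟨i, hi⟩ := h2 y ⟨hyb, hya, hy⟩
      exact ⟨i.succ, by simpa using hi⟩
    · by_cases hx' : x = a ∨ x = b
      · exact ⟨0, by simpa using hpair x hx y hy hxy hlxy hx'⟩
      by_cases hy' : y = a ∨ y = b
      · have := hpair y hy x hx hxy.symm hlxy.symm hy'
        exact ⟨0, by simp only [Fin.cons_zero]; tauto⟩
      rw [not_or] at hx' hy'
      obtain ⟨i, hi⟩ := h3 x ⟨hx'.2, hx'.1, hx⟩ y ⟨hy'.2, hy'.1, hy⟩ hxy hlxy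
      exact ⟨i.succ, by simpa using hi⟩

/-- Enlarge `X` to exactly `2K` vertices and pair them so that equal labels are matched. Linkings of
pairs with different labels come along too, but their sets are simply not used. -/
theorem linked_of_linking [Finite V] {G : SimpleGraph V} {U X : Finset V} {K : ℕ}
    (hU : 2 * K ≤ U.card) (hXU : X ⊆ U) (hX : X.card ≤ 2 * K)
    (h : ∀ S : TerminalPairs V K, (∀ i, S.s i ∈ U ∧ S.t i ∈ U) →
      ∃ C, Linking G U S Finset.univ C) : Linked (restr G U) X := by
  obtain ⟨Y, hXY, hYU, hY⟩ := Finset.exists_subsuperset_card_eq hXU hX hU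
  refine Linked.subset (X := Y) (fun l hl => ?_) hXY
  obtain ⟨S, h1, h2, h3⟩ := exists_pairing l K Y hY hl
  obtain ⟨C, hC⟩ := h S fun i => ⟨hYU (h1 i).1, hYU (h1 i).2⟩
  set c : V → ℕ := fun v => if hv : ∃ i, v ∈ C i ∧ l (S.s i) = l (S.t i) then l (S.s hv.choose)
    else l v with hc
  have hc1 : ∀ i, l (S.s i) = l (S.t i) → ∀ v ∈ C i, c v = l (S.s i) := by
    intro i hi v hv
    have hex : ∃ i, v ∈ C i ∧ l (S.s i) = l (S.t i) := ⟨i, hv, hi⟩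
    simp only [hc, dif_pos hex]
    rw [hC.eq_of_mem hex.choose_spec.1 hv]
  have hJ : ∀ i, l (S.s i) = l (S.t i) →
      Joins (restr G U) {v | c v = l (S.s i)} (S.s i) (S.t i) := fun i hi =>
    ((hC.joins i (Finset.mem_univ i)).mono_graph (H := restr G U) fun u v huv hu hv =>
      ⟨huv, hC.subset i hu, hC.subset i hv⟩).mono fun v hv => hc1 i hi v hv
  have hcx : ∀ x ∈ Y, c x = l x := by
    intro x hx
    by_cases hex : ∃ i, x ∈ C i ∧ l (S.s i) = l (S.t i)
    · obtain ⟨i, hi, hl⟩ := hex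
      rw [hc1 i hl x hi]
      obtain ⟨j, rfl | rfl⟩ := h2 x hx
      · rw [hC.eq_of_mem hi (hC.s_mem j)]
      · rw [hl, hC.eq_of_mem hi (hC.t_mem j)]
    · simp only [hc, dif_neg hex]
  refine ⟨c, hcx, fun x hx y hy hxy => ?_⟩
  by_cases hxy' : x = y
  · subst hxy'
    exact .refl (hcx x hx)
  · obtain ⟨i, ⟨rfl, rfl⟩ | ⟨rfl, rfl⟩⟩ := h3 x hx y hy hxy' hxy
    · exact hJ i hxy
    · have := (hJ i hxy.symm).symm
      rwa [← hxy] at this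

end

/-! ### Replacing a linked set by a clique, contraction, and counting edges -/

section

variable {V : Type*}

/-- The complete graph on `Z`. -/
def clique (Z : Finset V) : SimpleGraph V where
  Adj u v := u ∈ Z ∧ v ∈ Z ∧ u ≠ v
  symm := ⟨fun _ _ h => ⟨h.2.1, h.1, h.2.2.symm⟩⟩
  loopless := ⟨fun _ h => h.2.2 rfl⟩

/-- If `Z` is linked inside `Y ∪ Z`, then for the purpose of linking `X` in the rest `Q` of the
graph, the set `Z` may be treated as a clique. -/
theorem Linked.of_clique [Finite V] {G : SimpleGraph V} {X Y Z Q : Finset V}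
    (hYZ : Linked (restr G ↑(Y ∪ Z)) Z) (hX : Linked (restr G Q ⊔ clique Z) X) (hXY : Disjoint X Y)
    (hQY : Disjoint Q Y) (hZQ : Z ⊆ Q) : Linked (restr G ↑(Y ∪ Q)) X := by
  intro l hl
  obtain ⟨c, hc1, hc2⟩ := hX l hl
  -- For each label that occurs on two elements of `X`, a shortest set joining them is chosen, and
  -- the empty set for the other labels. In the clique a shortest path has at most two vertices,
  -- which are consecutive, so each label makes at most one request to the linkage of `Z`.
  have hM : ∀ n, ∃ M : Finset V, (∀ v ∈ M, c v = n) ∧ (Z ∩ M).card ≤ 2 ∧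
      ((∀ x ∈ X, ∀ y ∈ X, x ≠ y → l x = n → l y = n →
        x ∈ M ∧ y ∈ M ∧ Joins (restr G Q ⊔ clique Z) M x y)) ∧
      (M = ∅ ∨ ∀ x ∈ X, l x = n → x ∈ M) := by
    intro n
    by_cases hex : ∃ x ∈ X, ∃ y ∈ X, x ≠ y ∧ l x = n ∧ l y = n
    · obtain ⟨x, hx, y, hy, hxy, rfl, hy'⟩ := hex
      obtain ⟨M, ⟨hMP, hMJ⟩, hmin⟩ := exists_argmin
        (P := fun M : Finset V => (M : Set V) ⊆ {v | c v = l x} ∧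
          Joins (restr G Q ⊔ clique Z) M x y) Finset.card
        (hc2 x hx y hy hy'.symm).exists_finset
      obtain ⟨p, f, hf0, hfp, hinj, hMeq, hcard, hadj, hshort⟩ :=
        hMJ.exists_path_of_minimal hMP fun C' h1 h2 => hmin C' ⟨h1, h2⟩
      have hpair : ∀ a ∈ X, l a = l x → a = x ∨ a = y := by
        intro a ha hax
        by_contra hne
        rw [not_or] at hne
        have hsub : ({x, y, a} : Finset V) ⊆ X.filter (l · = l x) := by
          intro v
          simp only [Finset.mem_insert, Finset.mem_singleton, Finset.mem_filter]
          rintro (rfl | rfl | rfl) <;> simp [*]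
        have h3 := (Finset.card_le_card hsub).trans (hl _)
        rw [Finset.card_eq_three.2 ⟨x, y, a, hxy, Ne.symm hne.1, Ne.symm hne.2, rfl⟩] at h3
        omega
      refine ⟨M, fun v hv => hMP hv, ?_, fun a ha b hb hab hal hbl => ?_, Or.inr fun a ha hal => ?_⟩
      · by_contra hlt
        push Not at hlt
        set I := (Finset.range (p + 1)).filter fun i => f i ∈ Z with hI
        have hZM : Z ∩ M = I.image f := by
          rw [hMeq, hI]
          ext v
          simp only [Finset.mem_inter, Finset.mem_image, Finset.mem_filter]
          constructor
          · rintro ⟨h1, i, h2, rfl⟩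
            exact ⟨i, ⟨h2, h1⟩, rfl⟩
          · rintro ⟨i, ⟨h1, h2⟩, rfl⟩
            exact ⟨h2, i, h1, rfl⟩
        have hI1 : ∀ i ∈ I, ∀ j ∈ I, j ≤ i + 1 := by
          intro i hi j hj
          simp only [hI, Finset.mem_filter, Finset.mem_range] at hi hj
          by_contra hlt
          have hne : f i ≠ f j := fun h => by
            have := hinj (by simp; omega) (by simp; omega) h
            omega
          have := hshort i j (by omega) (by omega) ∅ (by simp)
            (.of_adj (Or.inr ⟨hi.2, hj.2, hne⟩) (by simp) (by simp))
          simp at this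
          omega
        have hIne : I.Nonempty := by
          rw [← Finset.image_nonempty (f := f), ← hZM, ← Finset.card_pos]
          omega
        have hsub : I ⊆ Finset.Icc (I.min' hIne) (I.min' hIne + 1) := fun i hi =>
          Finset.mem_Icc.2 ⟨Finset.min'_le _ _ hi, hI1 _ (Finset.min'_mem _ _) i hi⟩
        have h1 := Finset.card_le_card hsub
        have h2 := Finset.card_image_le (s := I) (f := f)
        rw [← hZM] at h2
        simp at h1
        omega
      · have h1 := hpair a ha hal
        have h2 := hpair b hb hbl
        have h3 := hMJ.left_mem
        have h4 := hMJ.right_mem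
        rcases h1 with rfl | rfl <;> rcases h2 with rfl | rfl
        · exact absurd rfl hab
        · exact ⟨h3, h4, hMJ⟩
        · exact ⟨h4, h3, hMJ.symm⟩
        · exact absurd rfl hab
      · rcases hpair a ha hal with rfl | rfl
        · exact hMJ.left_mem
        · exact hMJ.right_mem
    · push Not at hex
      exact ⟨∅, by simp, by simp, fun x hx y hy hxy h1 h2 => absurd h2 (hex x hx y hy hxy h1),
        Or.inl rfl⟩
  choose M hMc hMZ hMJ hM0 using hM
  -- The vertices of `Z` that matter: those on the chosen paths and those in `X`. All other vertices
  -- of `Z` get fresh labels, so the linkage inside `Y ∪ Z` is not asked to join them to anything.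
  set Z' := Z.filter fun z => z ∈ M (c z) ∨ z ∈ X with hZ'
  obtain ⟨l', hl1, -, hl3⟩ := exists_fresh_labels Z' c (fun n => by
    rcases hM0 n with h0 | h0
    · refine le_trans (Finset.card_le_card fun z hz => ?_) (hl n)
      simp only [hZ', Finset.mem_filter] at hz ⊢
      obtain ⟨⟨-, h1⟩, h2⟩ := hz
      rw [h2, h0] at h1
      have hzX := h1.resolve_left (by simp)
      exact ⟨hzX, by rw [← hc1 z hzX, h2]⟩
    · refine le_trans (Finset.card_le_card fun z hz => ?_) (hMZ n)
      simp only [hZ', Finset.mem_filter, Finset.mem_inter] at hz ⊢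
      obtain ⟨⟨hzZ, h1⟩, h2⟩ := hz
      rw [h2] at h1
      exact ⟨hzZ, h1.elim id fun hzX => h0 z hzX (by rw [← hc1 z hzX, h2])⟩)
  obtain ⟨d, hd1, hd2⟩ := hYZ l' (hl3 Z)
  set e : V → ℕ := fun v => if v ∈ Y ∪ Z then d v / 2 else c v with he
  have heZ : ∀ z ∈ Z', e z = c z := by
    intro z hz
    have hzZ := (Finset.mem_filter.1 hz).1
    simp only [he, if_pos (Finset.mem_union_right Y hzZ), hd1 z hzZ, hl1 z hz]
    omega
  have heM : ∀ n, ∀ v ∈ M n, v ∉ Y → e v = n := by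
    intro n v hv hvY
    by_cases hvZ : v ∈ Z
    · rw [heZ v (Finset.mem_filter.2 ⟨hvZ, Or.inl (by rwa [hMc n v hv])⟩), hMc n v hv]
    · simp [he, hvZ, hvY, hMc n v hv]
  have heX : ∀ x ∈ X, e x = l x := by
    intro x hx
    have hxY := Finset.disjoint_left.1 hXY hx
    by_cases hxZ : x ∈ Z
    · rw [heZ x (Finset.mem_filter.2 ⟨hxZ, Or.inr hx⟩), hc1 x hx]
    · simp [he, hxZ, hxY, hc1 x hx]
  refine ⟨e, heX, fun x hx y hy hxy => ?_⟩
  by_cases hxy' : x = y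
  · subst hxy'
    exact .refl (heX x hx)
  obtain ⟨hxM, hyM, hJ⟩ := hMJ (l x) x hx y hy hxy' rfl hxy.symm
  refine hJ.transfer (heX x hx) fun u v huv hu hv _ => ?_
  rcases huv with huv | ⟨huZ, hvZ, huv⟩
  · have hu' := heM _ u hu (Finset.disjoint_left.1 hQY huv.2.1)
    have hv' := heM _ v hv (Finset.disjoint_left.1 hQY huv.2.2)
    exact .of_adj ⟨huv.1, Finset.mem_coe.2 (Finset.mem_union_right _ huv.2.1),
      Finset.mem_coe.2 (Finset.mem_union_right _ huv.2.2)⟩ hu' hv'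
  · have hu' : u ∈ Z' := Finset.mem_filter.2 ⟨huZ, Or.inl (by rwa [hMc _ u hu])⟩
    have hv' : v ∈ Z' := Finset.mem_filter.2 ⟨hvZ, Or.inl (by rwa [hMc _ v hv])⟩
    have hj := (hd2 u huZ v hvZ (by rw [hl1 u hu', hl1 v hv', hMc _ u hu, hMc _ v hv])).of_restr
      (Finset.mem_coe.2 (Finset.mem_union_right _ huZ))
    have hsub : Y ∪ Z ⊆ Y ∪ Q := Finset.union_subset_union_right hZQ
    refine (hj.mono_graph (H := restr G ↑(Y ∪ Q)) fun a b hab ha hb =>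
      ⟨hab, hsub ha.2, hsub hb.2⟩).mono fun w hw => ?_
    obtain ⟨hw1, hw2⟩ := hw
    simp only [Set.mem_ofPred_eq, hl1 u hu', hMc _ u hu] at hw1
    simp only [Set.mem_ofPred_eq, he, if_pos (Finset.mem_coe.1 hw2), hw1]
    omega

/-- The graph obtained by contracting `v` into `u`. -/
def contract (G : SimpleGraph V) (u v : V) : SimpleGraph V where
  Adj p q := p ≠ v ∧ q ≠ v ∧ p ≠ q ∧ (G.Adj p q ∨ (p = u ∧ G.Adj v q) ∨ (q = u ∧ G.Adj v p))
  symm := ⟨fun p q h => ⟨h.2.1, h.1, h.2.2.1.symm, by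
    rcases h.2.2.2 with h | h | h
    · exact Or.inl h.symm
    · exact Or.inr (Or.inr h)
    · exact Or.inr (Or.inl h)⟩⟩
  loopless := ⟨fun _ h => h.2.2.1 rfl⟩

theorem Linked.of_contract {G : SimpleGraph V} {X : Finset V} {u v : V} (huv : G.Adj u v)
    (hv : v ∉ X) (h : Linked (contract G u v) X) : Linked G X := by
  intro l hl
  obtain ⟨c, hc1, hc2⟩ := h l hl
  have hne : ∀ w, w ≠ v → Function.update c v (c u) w = c w := fun w hw =>
    Function.update_of_ne hw _ _
  have hvv : Function.update c v (c u) v = c u := Function.update_self _ _ _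
  have hX : ∀ x ∈ X, Function.update c v (c u) x = l x := fun x hx => by
    rw [hne x (fun h => hv (h ▸ hx)), hc1 x hx]
  refine ⟨_, hX, fun x hx y hy hxy => ?_⟩
  refine (hc2 x hx y hy hxy).transfer (hX x hx) fun p q hpq hp hq _ => ?_
  obtain ⟨hpv, hqv, -, hadj⟩ := hpq
  have hp' : Function.update c v (c u) p = l x := (hne p hpv).trans hp
  have hq' : Function.update c v (c u) q = l x := (hne q hqv).trans hq
  rcases hadj with hadj | ⟨rfl, hadj⟩ | ⟨rfl, hadj⟩
  · exact .of_adj hadj hp' hq'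
  · exact .cons huv hp' (.of_adj hadj (hvv.trans hp) hq')
  · exact .cons hadj.symm hp' (.of_adj huv.symm (hvv.trans hq) hq')

theorem card_image_edge (v : V) (A : Finset V) : (A.image fun w => s(v, w)).card = A.card :=
  Finset.card_image_of_injective _ fun a b h => by
    rcases Sym2.eq_iff.1 h with ⟨-, h⟩ | ⟨h, h'⟩
    · exact h
    · exact h'.trans h

variable [Fintype V]

/-- The neighbours of `Y` outside `Y`. -/
noncomputable def bd (G : SimpleGraph V) (Y : Finset V) : Finset V :=
  Finset.univ.filter fun v => v ∉ Y ∧ ∃ y ∈ Y, G.Adj y v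

theorem mem_bd {G : SimpleGraph V} {Y : Finset V} {v : V} :
    v ∈ bd G Y ↔ v ∉ Y ∧ ∃ y ∈ Y, G.Adj y v := by
  simp [bd]

/-- The edges with an end in `Y`. -/
noncomputable def touch (G : SimpleGraph V) (Y : Finset V) : Finset (Sym2 V) :=
  Finset.univ.filter fun e => e ∈ G.edgeSet ∧ ∃ y ∈ Y, y ∈ e

theorem mem_touch {G : SimpleGraph V} {Y : Finset V} {a b : V} :
    s(a, b) ∈ touch G Y ↔ G.Adj a b ∧ (a ∈ Y ∨ b ∈ Y) := by
  simp only [touch, Finset.mem_filter, Finset.mem_univ, true_and, SimpleGraph.mem_edgeSet,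
    Sym2.mem_iff]
  constructor
  · rintro ⟨h, y, hy, rfl | rfl⟩ <;> tauto
  · rintro ⟨h, hy | hy⟩
    · exact ⟨h, a, hy, Or.inl rfl⟩
    · exact ⟨h, b, hy, Or.inr rfl⟩

theorem exists_of_mem_touch {G : SimpleGraph V} {Y : Finset V} {e : Sym2 V} (h : e ∈ touch G Y) :
    ∃ a b, e = s(a, b) ∧ G.Adj a b ∧ a ∈ Y := by
  induction e with
  | _ a b =>
    rw [mem_touch] at h
    rcases h with ⟨h, ha | hb⟩
    · exact ⟨a, b, rfl, h, ha⟩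
    · exact ⟨b, a, Sym2.eq_swap, h.symm, hb⟩

theorem touch_mono {G H : SimpleGraph V} {Y Y' : Finset V}
    (h : ∀ a b, G.Adj a b → a ∈ Y → H.Adj a b ∧ (a ∈ Y' ∨ b ∈ Y')) : touch G Y ⊆ touch H Y' := by
  intro e he
  obtain ⟨a, b, rfl, hab, ha⟩ := exists_of_mem_touch he
  rw [mem_touch]
  exact h a b hab ha

theorem sum_dIn_le (G : SimpleGraph V) (A : Finset V) :
    ∑ v ∈ A, dIn G Finset.univ v ≤ 2 * (touch G A).card := by
  have h1 : ∀ v ∈ A, dIn G Finset.univ v =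
      ((touch G A).bipartiteAbove (fun (v : V) (e : Sym2 V) => v ∈ e) v).card := by
    intro v hv
    rw [dIn, ← card_image_edge v]
    congr 1
    ext e
    simp only [Finset.mem_image, Finset.mem_filter, Finset.mem_univ, true_and,
      Finset.mem_bipartiteAbove]
    constructor
    · rintro ⟨w, hw, rfl⟩
      exact ⟨mem_touch.2 ⟨hw, Or.inl hv⟩, by simp⟩
    · rintro ⟨he, hve⟩
      obtain ⟨w, rfl⟩ := Sym2.mem_iff_exists.1 hve
      exact ⟨w, (mem_touch.1 he).1, rfl⟩
  rw [Finset.sum_congr rfl h1, Finset.sum_card_bipartiteAbove_eq_sum_card_bipartiteBelow, mul_comm,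
    ← smul_eq_mul, ← Finset.sum_const]
  refine Finset.sum_le_sum fun e _ => ?_
  induction e with
  | _ a b =>
    refine le_trans (Finset.card_le_card (t := {a, b}) fun v hv => ?_) Finset.card_le_two
    simpa using ((Finset.mem_bipartiteBelow _).1 hv).2

end

/-! ### Massed graphs and rigid separations -/

section

variable {V : Type*}

theorem Linked.empty (G : SimpleGraph V) : Linked G ∅ := fun l _ => ⟨l, by simp, by simp⟩

variable [Fintype V]

/-- The hypothesis of the linkage theorem of Thomas and Wollan, for a graph with vertex set `W` and
a set `X` of roots: there are many edges outside `X`, but not behind small separators. -/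
structure Massed (G : SimpleGraph V) (W X : Finset V) (m : ℕ) : Prop where
  supp : ∀ u v, G.Adj u v → u ∈ W
  subset : X ⊆ W
  large : m * (W \ X).card < (touch G (W \ X)).card
  small : ∀ Y ⊆ W \ X, (bd G Y).card < X.card → (touch G Y).card ≤ m * Y.card

/-- A separation `(W \ Y, Y ∪ Z)` such that `Z` is linked in `Y ∪ Z`. -/
structure Rigid (G : SimpleGraph V) (W X Y Z : Finset V) : Prop where
  nonempty : Y.Nonempty
  subset : Y ⊆ W \ X
  bd_subset : bd G Y ⊆ Z
  disj : Disjoint Y Z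
  subset' : Z ⊆ W
  linked : Linked (restr G ↑(Y ∪ Z)) Z

/-- The linkage theorem for massed graphs with fewer than `n` vertices. -/
def LinkedBelow (V : Type*) [Fintype V] (n m K : ℕ) : Prop :=
  ∀ W : Finset V, W.card < n → ∀ (G : SimpleGraph V) (X : Finset V), Massed G W X m →
    X.card ≤ 2 * K → Linked G X

variable {G : SimpleGraph V} {W X : Finset V} {m K : ℕ}

theorem disjoint_bd (G : SimpleGraph V) (Y : Finset V) : Disjoint Y (bd G Y) :=
  Finset.disjoint_right.2 fun _ hv => (mem_bd.1 hv).1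

theorem bd_subset_of_supp (hs : ∀ u v, G.Adj u v → u ∈ W) (Y : Finset V) : bd G Y ⊆ W := by
  intro v hv
  obtain ⟨-, y, -, hyv⟩ := mem_bd.1 hv
  exact hs v y hyv.symm

/-- Every edge touching `Y` lies within `Y ∪ bd G Y`, so for subsets of `Y` neither the edges
touched nor the boundary change under the restriction. With the boundary as its set of roots, the
part behind it thus becomes a smaller instance of the theorem. -/
theorem Massed.behind_bd {Y : Finset V} (hY : m * Y.card < (touch G Y).card)
    (h : ∀ Y' ⊆ Y, (bd G Y').card < (bd G Y).card → (touch G Y').card ≤ m * Y'.card) :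
    Massed (restr G ↑(Y ∪ bd G Y)) (Y ∪ bd G Y) (bd G Y) m := by
  have hsd : (Y ∪ bd G Y) \ bd G Y = Y := by
    rw [Finset.union_sdiff_right, Finset.sdiff_eq_self_of_disjoint (disjoint_bd G Y)]
  have hadj : ∀ a b, G.Adj a b → a ∈ Y → (restr G ↑(Y ∪ bd G Y)).Adj a b := by
    intro a b hab ha
    refine ⟨hab, Finset.mem_coe.2 (Finset.mem_union_left _ ha), ?_⟩
    rw [Finset.mem_coe, Finset.mem_union, mem_bd]
    by_cases hb : b ∈ Y
    · exact Or.inl hb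
    · exact Or.inr ⟨hb, a, ha, hab⟩
  have hbd : ∀ Y' ⊆ Y, bd (restr G ↑(Y ∪ bd G Y)) Y' = bd G Y' := by
    intro Y' hY'
    ext v
    rw [mem_bd, mem_bd]
    refine and_congr_right fun _ => ⟨?_, ?_⟩
    · rintro ⟨y, hy, hyv⟩
      exact ⟨y, hy, hyv.1⟩
    · rintro ⟨y, hy, hyv⟩
      exact ⟨y, hy, hadj y v hyv (hY' hy)⟩
  refine ⟨fun u v huv => Finset.mem_coe.1 huv.2.1, Finset.subset_union_right, ?_, ?_⟩
  · rw [hsd]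
    refine hY.trans_le (Finset.card_le_card (touch_mono fun a b hab ha => ⟨hadj a b hab ha, Or.inl ha⟩))
  · rw [hsd]
    intro Y' hY' hlt
    rw [hbd Y' hY'] at hlt
    refine (Finset.card_le_card (touch_mono
      (G := restr G ↑(Y ∪ bd G Y)) (H := G) (Y' := Y')
      fun a b hab ha => ⟨hab.1, Or.inl ha⟩)).trans (h Y' hY' hlt)

theorem card_union_bd_lt {Y : Finset V} (hXW : X ⊆ W) (hY : Y ⊆ W \ X)
    (h : (Y ≠ W \ X ∧ (bd G Y).card ≤ X.card) ∨ (bd G Y).card < X.card) :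
    (Y ∪ bd G Y).card < W.card := by
  have h1 := Finset.card_union_of_disjoint (disjoint_bd G Y)
  have h2 := Finset.card_sdiff_add_card_eq_card hXW
  have h3 := Finset.card_le_card hY
  rcases h with ⟨hne, h⟩ | h
  · have := Finset.card_lt_card (Finset.ssubset_iff_subset_ne.2 ⟨hY, hne⟩)
    omega
  · omega

/-- If the second condition for massed graphs fails, then there is a rigid separation. -/
theorem exists_linked_violator (hIH : LinkedBelow V W.card m K) (hXW : X ⊆ W)
    (hX : X.card ≤ 2 * K)
    (h : ∃ Y ⊆ W \ X, (bd G Y).card < X.card ∧ m * Y.card < (touch G Y).card) :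
    ∃ Y ⊆ W \ X, (bd G Y).card < X.card ∧ m * Y.card < (touch G Y).card ∧
      Linked (restr G ↑(Y ∪ bd G Y)) (bd G Y) := by
  obtain ⟨Y, ⟨hY, hlt, hm⟩, hmin⟩ := exists_argmin (P := fun Y : Finset V =>
    Y ⊆ W \ X ∧ (bd G Y).card < X.card ∧ m * Y.card < (touch G Y).card) Finset.card h
  refine ⟨Y, hY, hlt, hm, hIH _ (card_union_bd_lt hXW hY (Or.inr hlt)) _ _
    (Massed.behind_bd hm fun Y' hY' hb => ?_) (by omega)⟩
  by_contra hcon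
  push Not at hcon
  have := hmin Y' ⟨hY'.trans hY, hb.trans hlt, hcon⟩
  rw [Finset.eq_of_subset_of_card_le hY' this] at hb
  omega

theorem nonempty_of_touch {Y : Finset V} (h : m * Y.card < (touch G Y).card) : Y.Nonempty := by
  by_contra hne
  rw [Finset.not_nonempty_iff_eq_empty] at hne
  subst hne
  simp [touch] at h

/-- Rigid separations of small order can be reduced. -/
theorem Massed.linked_of_rigid (hIH : LinkedBelow V W.card m K) (h : Massed G W X m)
    (hX : X.card ≤ 2 * K) (hr : ∃ Y Z, Rigid G W X Y Z ∧ Z.card < X.card) : Linked G X := by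
  -- Take a rigid separation with `Y` as large as possible, remove `Y` and make `Z` a clique. By
  -- `Linked.of_clique` it is enough to link `X` in the smaller graph.
  obtain ⟨⟨Y, Z⟩, ⟨hr, hZ⟩, hmax⟩ := exists_argmin (P := fun p : Finset V × Finset V =>
    Rigid G W X p.1 p.2 ∧ p.2.card < X.card) (fun p => W.card - p.1.card)
    (by obtain ⟨Y, Z, h⟩ := hr; exact ⟨(Y, Z), h⟩)
  simp only at hr hZ hmax
  have hYW : Y ⊆ W := hr.subset.trans Finset.sdiff_subset
  have hXY : Disjoint X Y := Finset.disjoint_right.2 fun v hv => (Finset.mem_sdiff.1 (hr.subset hv)).2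
  set G' := restr G ↑(W \ Y) ⊔ clique Z with hG'
  have hZW : Z ⊆ W \ Y := fun z hz =>
    Finset.mem_sdiff.2 ⟨hr.subset' hz, Finset.disjoint_right.1 hr.disj hz⟩
  have hcardW : (W \ Y).card < W.card := by
    have := Finset.card_sdiff_add_card_eq_card hYW
    have := hr.nonempty.card_pos
    omega
  have hsupp : ∀ u v, G'.Adj u v → u ∈ W \ Y := by
    rintro u v (huv | huv)
    · exact Finset.mem_coe.1 huv.2.1
    · exact hZW huv.1
  have hXW' : X ⊆ W \ Y := Finset.subset_sdiff.2 ⟨h.subset, hXY⟩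
  have hfinal : Linked G' X → Linked G X := by
    intro hL
    refine (hr.linked.of_clique hL hXY Finset.sdiff_disjoint hZW).le (restr_le _ _)
  refine hfinal (hIH _ hcardW _ _ ⟨hsupp, hXW', ?_, ?_⟩ hX)
  · have h1 : touch G (W \ X) ⊆ touch G' ((W \ Y) \ X) ∪ touch G Y := by
      intro e he
      obtain ⟨a, b, rfl, hab, ha⟩ := exists_of_mem_touch he
      rw [Finset.mem_union, mem_touch, mem_touch]
      by_cases haY : a ∈ Y
      · exact Or.inr ⟨hab, Or.inl haY⟩
      by_cases hbY : b ∈ Y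
      · exact Or.inr ⟨hab, Or.inr hbY⟩
      rw [Finset.mem_sdiff] at ha
      refine Or.inl ⟨Or.inl ⟨hab, ?_, ?_⟩, Or.inl ?_⟩
      · exact Finset.mem_coe.2 (Finset.mem_sdiff.2 ⟨ha.1, haY⟩)
      · exact Finset.mem_coe.2 (Finset.mem_sdiff.2 ⟨h.supp _ _ hab.symm, hbY⟩)
      · exact Finset.mem_sdiff.2 ⟨Finset.mem_sdiff.2 ⟨ha.1, haY⟩, ha.2⟩
    have h2 := (Finset.card_le_card h1).trans (Finset.card_union_le _ _)
    have h3 := h.small Y hr.subset ((Finset.card_le_card hr.bd_subset).trans_lt hZ)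
    have h4 := h.large
    have h5 : ((W \ Y) \ X).card + Y.card = (W \ X).card := by
      rw [sdiff_right_comm]
      exact Finset.card_sdiff_add_card_eq_card hr.subset
    rw [← h5, mul_add] at h4
    omega
  · by_contra hcon
    push Not at hcon
    have hIH' : LinkedBelow V (W \ Y).card m K := fun W' hW' => hIH W' (hW'.trans hcardW)
    obtain ⟨Y', hY', hlt, hm, hL⟩ := exists_linked_violator hIH' hXW' hX hcon
    have hYY' : Disjoint Y' Y := Finset.disjoint_left.2 fun v hv =>
      (Finset.mem_sdiff.1 (Finset.mem_sdiff.1 (hY' hv)).1).2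
    have hY'W : Y' ⊆ W \ X := fun v hv => by
      have := hY' hv
      simp only [Finset.mem_sdiff] at this ⊢
      tauto
    have hnb : ∀ y ∈ Y', ∀ v, G.Adj y v → v ∉ Y → G'.Adj y v := by
      intro y hy v hyv hvY
      exact Or.inl ⟨hyv, Finset.mem_coe.2 (Finset.mem_sdiff.1 (hY' hy)).1,
        Finset.mem_coe.2 (Finset.mem_sdiff.2 ⟨h.supp _ _ hyv.symm, hvY⟩)⟩
    -- A violating set that misses `Z` already violates in `G`. If it meets `Z`, the clique lies
    -- entirely in it and its boundary, and merging it with `Y` gives a larger rigid separation.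
    by_cases hZY' : Disjoint Z Y'
    · have hadj : ∀ y ∈ Y', ∀ v, G'.Adj y v → G.Adj y v := by
        rintro y hy v (hyv | hyv)
        · exact hyv.1
        · exact absurd hy (Finset.disjoint_left.1 hZY' hyv.1)
      have h1 := h.small Y' hY'W (lt_of_le_of_lt (Finset.card_le_card fun v hv => ?_) hlt)
      · have h2 : touch G' Y' ⊆ touch G Y' :=
          touch_mono fun a b hab ha => ⟨hadj a ha b hab, Or.inl ha⟩
        have := Finset.card_le_card h2
        omega
      · rw [mem_bd] at hv ⊢
        obtain ⟨hvY', y, hy, hyv⟩ := hv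
        refine ⟨hvY', y, hy, hnb y hy v hyv fun hvY => ?_⟩
        exact Finset.disjoint_right.1 hZY' hy (hr.bd_subset (mem_bd.2
          ⟨Finset.disjoint_left.1 hYY' hy, v, hvY, hyv.symm⟩))
    · rw [Finset.not_disjoint_iff] at hZY'
      obtain ⟨z, hzZ, hzY'⟩ := hZY'
      have hZsub : Z ⊆ Y' ∪ bd G' Y' := by
        intro z' hz'
        rw [Finset.mem_union, mem_bd]
        by_cases hz'Y : z' ∈ Y'
        · exact Or.inl hz'Y
        · exact Or.inr ⟨hz'Y, z, hzY', Or.inr ⟨hzZ, hz', fun h => hz'Y (h ▸ hzY')⟩⟩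
      have hbdY : Disjoint (bd G' Y') Y := Finset.disjoint_left.2 fun v hv =>
        (Finset.mem_sdiff.1 (bd_subset_of_supp hsupp Y' hv)).2
      have hnew : Rigid G W X (Y ∪ Y') (bd G' Y') := by
        refine ⟨hr.nonempty.mono Finset.subset_union_left, Finset.union_subset hr.subset hY'W,
          fun v hv => ?_, Finset.disjoint_union_left.2 ⟨hbdY.symm, disjoint_bd _ _⟩,
          (bd_subset_of_supp hsupp Y').trans Finset.sdiff_subset, ?_⟩
        · obtain ⟨hv1, y, hy, hyv⟩ := mem_bd.1 hv
          rw [Finset.mem_union, not_or] at hv1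
          rcases Finset.mem_union.1 hy with hy | hy
          · have := hZsub (hr.bd_subset (mem_bd.2 ⟨hv1.1, y, hy, hyv⟩))
            exact (Finset.mem_union.1 this).resolve_left hv1.2
          · exact mem_bd.2 ⟨hv1.2, y, hy, hnb y hy v hyv hv1.1⟩
        · have hQ : Disjoint (Y' ∪ bd G' Y') Y := Finset.disjoint_union_left.2 ⟨hYY', hbdY⟩
          have := hr.linked.of_clique (Q := Y' ∪ bd G' Y') (hL.le ?_) hbdY hQ hZsub
          · rwa [Finset.union_assoc]
          · rintro a b ⟨hab | hab, ha, hb⟩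
            · exact Or.inl ⟨hab.1, ha, hb⟩
            · exact Or.inr hab
      have h1 := hmax (Y ∪ Y', bd G' Y') ⟨hnew, hlt⟩
      simp only at h1
      have h2 := Finset.card_le_card (hnew.subset.trans Finset.sdiff_subset)
      rw [Finset.card_union_of_disjoint hYY'.symm] at h1 h2
      have := (Finset.card_pos.2 ⟨z, hzY'⟩)
      omega

/-- A linked core `Y ∪ Z`, attached to the rest of the graph at `Z`, can be used to link `X`. -/
theorem Massed.linked_of_core (hIH : LinkedBelow V W.card m K) (h : Massed G W X m)
    (hX : X.card ≤ 2 * K) {Y Z : Finset V} (hY : Y ⊆ W \ X) (hbd : bd G Y ⊆ Z)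
    (hYZ : Disjoint Y Z) (hZ : Z ⊆ W) (hne : Y.Nonempty ∨ X.card ≤ Z.card)
    (hL : ∀ Z' ⊆ Z, Z'.card ≤ X.card → Linked (restr G ↑(Y ∪ Z)) Z') : Linked G X := by
  have hXY : Disjoint X Y := Finset.disjoint_right.2 fun v hv => (Finset.mem_sdiff.1 (hY hv)).2
  set H := restr G {v | v ∉ Y} with hH
  have hout : ∀ {P : Set V} {a b : V}, Joins H P a b → b ∉ Y → Joins H (P ∩ {v | v ∉ Y}) a b :=
    fun hj hb => hj.symm.transfer (Q := _ ∩ {v | v ∉ Y}) ⟨hj.right_mem, hb⟩ (fun u v huv hu hv _ =>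
      .of_adj huv ⟨hu, huv.2.1⟩ ⟨hv, huv.2.2⟩) |>.symm
  by_cases hall : ∀ T, Sep H T X Z → X.card ≤ T.card
  · obtain ⟨c, π, hcπ⟩ := menger H X Z hall
    have hc : ∀ x ∈ X, c (π x) = x := fun x hx => (hcπ x hx).2.right_mem.1
    refine Linked.of_paths (Q := Y ∪ Z) (c := c) (π := π) (fun x hx =>
      ⟨Finset.mem_union_right _ (hcπ x hx).1, ?_⟩) (hL _ ?_ Finset.card_image_le)
    · have hj := hout (hcπ x hx).2 (Finset.disjoint_right.1 hYZ (hcπ x hx).1)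
      refine (hj.le (restr_le _ _)).mono fun v hv => ⟨hv.1.1, fun hvQ => hv.1.2 ?_⟩
      exact (Finset.mem_union.1 hvQ).resolve_left hv.2
    · intro v hv
      obtain ⟨x, hx, rfl⟩ := Finset.mem_image.1 hv
      exact (hcπ x hx).1
  push Not at hall
  -- Without enough disjoint paths from `X` to `Z` outside `Y` there is a small separator. A minimum
  -- one, together with everything behind it, will form a rigid separation of order below `X.card`,
  -- which can be reduced.
  obtain ⟨T₀, ⟨hT₀, hT₀X⟩, hmin₀⟩ := exists_argmin
    (P := fun T : Finset V => Sep H T X Z ∧ T.card < X.card) Finset.card hall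
  obtain ⟨T, hT, hTX, hmin, hTY⟩ : ∃ T, Sep H T X Z ∧ T.card < X.card ∧
      (∀ T', Sep H T' X Z → T.card ≤ T'.card) ∧ Disjoint Y T := by
    refine ⟨T₀ \ Y, fun x hx z hz hj => hT₀ x hx z hz ((hout hj (Finset.disjoint_right.1 hYZ hz)).mono
      fun v hv hvT => hv.1 (Finset.mem_sdiff.2 ⟨hvT, hv.2⟩)), ?_, fun T' hT' => ?_,
      Finset.disjoint_sdiff⟩
    · exact (Finset.card_le_card Finset.sdiff_subset).trans_lt hT₀X
    · refine (Finset.card_le_card Finset.sdiff_subset).trans ?_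
      by_cases hlt : T'.card < X.card
      · exact hmin₀ T' ⟨hT', hlt⟩
      · omega
  have hTW : T ⊆ W := by
    intro t ht
    by_contra htW
    have := hmin (T.erase t) fun x hx z hz hj => hT x hx z hz (by
      have hj' : Joins H ({v | v ∉ T.erase t} ∩ {v | v ∈ W}) x z :=
        hj.transfer ⟨hj.left_mem, h.subset hx⟩ fun u v huv hu hv _ =>
          .of_adj huv ⟨hu, h.supp _ _ huv.1⟩ ⟨hv, h.supp _ _ huv.1.symm⟩
      refine hj'.mono fun v hv hvT => hv.1 (Finset.mem_erase.2 ⟨?_, hvT⟩)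
      rintro rfl
      exact htW hv.2)
    rw [Finset.card_erase_of_mem ht] at this
    have := Finset.card_pos.2 ⟨t, ht⟩
    omega
  set R : Finset V := Finset.univ.filter fun v => ∃ z ∈ Z, Joins H {v | v ∉ T} v z with hR
  have hmR : ∀ v, v ∈ R ↔ ∃ z ∈ Z, Joins H {v | v ∉ T} v z := fun v => by simp [hR]
  have hRT : Disjoint R T := Finset.disjoint_left.2 fun v hv => by
    obtain ⟨z, -, hj⟩ := (hmR v).1 hv
    exact hj.left_mem
  have hRX : ∀ v ∈ R, v ∉ X := fun v hv hvX => by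
    obtain ⟨z, hz, hj⟩ := (hmR v).1 hv
    exact hT v hvX z hz hj
  have hRW : R ⊆ W := fun v hv => by
    obtain ⟨z, hz, hj⟩ := (hmR v).1 hv
    by_contra hvW
    obtain ⟨u, w, huw, -, huW, -⟩ := hj.symm.exists_exit (A := {v | v ∈ W}) (hZ hz) hvW
    exact huW (h.supp _ _ huw.1.symm)
  have hZR : Z ⊆ (Y ∪ R) ∪ T := fun z hz => by
    by_cases hzT : z ∈ T
    · exact Finset.mem_union_right _ hzT
    · exact Finset.mem_union_left _ (Finset.mem_union_right _ ((hmR z).2 ⟨z, hz, .refl hzT⟩))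
  refine h.linked_of_rigid hIH hX ⟨Y ∪ R, T, ⟨?_, ?_, fun v hv => ?_, ?_, hTW, ?_⟩, hTX⟩
  · rcases hne with hne | hne
    · exact hne.mono Finset.subset_union_left
    · obtain ⟨z, hz, hzT⟩ := Finset.exists_mem_notMem_of_card_lt_card (hTX.trans_le hne)
      exact ⟨z, (Finset.mem_union.1 (hZR hz)).resolve_right hzT⟩
  · exact Finset.union_subset hY fun v hv => Finset.mem_sdiff.2 ⟨hRW hv, hRX v hv⟩
  · obtain ⟨hv1, y, hy, hyv⟩ := mem_bd.1 hv
    by_contra hvT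
    rw [Finset.mem_union, not_or] at hv1
    rcases Finset.mem_union.1 hy with hy | hy
    · exact ((Finset.mem_union.1 (hZR (hbd (mem_bd.2 ⟨hv1.1, y, hy, hyv⟩)))).resolve_right hvT
        |> Finset.mem_union.1).elim hv1.1 hv1.2
    · obtain ⟨z, hz, hj⟩ := (hmR y).1 hy
      by_cases hyY : y ∈ Y
      · exact ((Finset.mem_union.1 (hZR (hbd (mem_bd.2 ⟨hv1.1, y, hyY, hyv⟩)))).resolve_right hvT
          |> Finset.mem_union.1).elim hv1.1 hv1.2
      · exact hv1.2 ((hmR v).2 ⟨z, hz, .cons ⟨hyv.symm, hv1.1, hyY⟩ hvT hj⟩)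
  · exact Finset.disjoint_union_left.2 ⟨hTY, hRT⟩
  · set H' := restr G (↑(Y ∪ R ∪ T) \ ↑Y : Set V) with hH'
    -- By minimality of `T`, Menger's theorem gives disjoint paths from `T` to `Z` on the far side,
    -- and these carry the linkedness of the core to `T`.
    obtain ⟨c, π, hcπ⟩ := menger H' T Z fun T' hT' => hmin T' fun x hx z hz hj => by
      have hzY := Finset.disjoint_right.1 hYZ hz
      have hinT : ∃ t ∈ T, Joins H' {v | v ∉ T'} z t := by
        have hex := hj.symm.exists_exit (A := {v | Joins H ({v | v ∉ T'} \ T) z v})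
        by_cases hzT : z ∈ T
        · exact ⟨z, hzT, .refl hj.right_mem⟩
        obtain ⟨u, t, hut, hu, ht, huT', htT'⟩ := hex (.refl ⟨hj.right_mem, hzT⟩) fun hxz =>
          hT x hx z hz (hxz.symm.mono fun v hv => hv.2)
        have htT : t ∈ T := by
          by_contra htT
          exact ht (hu.trans (.of_adj hut hu.right_mem ⟨htT', htT⟩))
        refine ⟨t, htT, ?_⟩
        have hRmem : ∀ v, Joins H ({v | v ∉ T'} \ T) z v → v ∈ R := fun v hv =>
          (hmR v).2 ⟨z, hz, hv.symm.mono fun w hw => hw.2⟩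
        have hY' : ∀ v, Joins H ({v | v ∉ T'} \ T) z v → v ∉ Y := fun v hv =>
          (hout hv.symm hzY).left_mem.2
        have e1 : Joins H' {v | v ∉ T'} z u :=
          (hu.reached.mono_graph (H := H') fun a b hab ha hb =>
            ⟨hab.1, ⟨by simp [hRmem a ha], hY' a ha⟩, ⟨by simp [hRmem b hb], hY' b hb⟩⟩).mono
              fun v hv => hv.right_mem.1
        refine e1.trans (.of_adj ⟨hut.1, ⟨by simp [hRmem u hu], hY' u hu⟩,
          ⟨by simp [htT], Finset.disjoint_right.1 hTY htT⟩⟩ huT' htT')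
      obtain ⟨t, ht, hjt⟩ := hinT
      exact hT' t ht z hz hjt.symm
    have hout' : ∀ {P : Set V} {a b : V}, Joins H' P a b → b ∉ Y →
        Joins H' (P ∩ {v | v ∉ Y}) a b :=
      fun hj hb => hj.symm.transfer (Q := _ ∩ {v | v ∉ Y}) ⟨hj.right_mem, hb⟩
        (fun u v huv hu hv _ => .of_adj huv ⟨hu, huv.2.1.2⟩ ⟨hv, huv.2.2.2⟩) |>.symm
    refine Linked.of_paths (Q := Y ∪ Z) (c := c) (π := π) (fun x hx =>
      ⟨Finset.mem_union_right _ (hcπ x hx).1, ?_⟩)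
      ((hL (T.image π) ?_ (Finset.card_image_le.trans hTX.le)).le ?_)
    · have hj := hout' (hcπ x hx).2 (Finset.disjoint_right.1 hYZ (hcπ x hx).1)
      refine (hj.le (restr_mono G Set.sdiff_subset)).mono fun v hv =>
        ⟨hv.1.1, fun hvQ => hv.1.2 ?_⟩
      exact (Finset.mem_union.1 hvQ).resolve_left hv.2
    · intro v hv
      obtain ⟨x, hx, rfl⟩ := Finset.mem_image.1 hv
      exact (hcπ x hx).1
    · have hsub : Y ∪ Z ⊆ Y ∪ R ∪ T := Finset.union_subset
        (Finset.subset_union_left.trans Finset.subset_union_left) hZR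
      rintro a b ⟨hab, ha, hb⟩
      exact ⟨⟨hab, hsub ha, hsub hb⟩, ha, hb⟩

/-- The part behind `bd G Y` is itself massed and has fewer vertices, so its boundary is linked
there by induction and `Y` serves as a core. -/
theorem Massed.linked_of_dense (hIH : LinkedBelow V W.card m K) (h : Massed G W X m)
    (hX : X.card ≤ 2 * K) {Y : Finset V} (hY : Y ⊆ W \ X) (hne : Y ≠ W \ X)
    (hbd : (bd G Y).card ≤ X.card) (hm : m * Y.card < (touch G Y).card) : Linked G X := by
  have hL : Linked (restr G ↑(Y ∪ bd G Y)) (bd G Y) :=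
    hIH _ (card_union_bd_lt h.subset hY (Or.inl ⟨hne, hbd⟩)) _ _ (Massed.behind_bd hm fun Y' hY' hb =>
      h.small Y' (hY'.trans hY) (hb.trans_le hbd)) (hbd.trans hX)
  exact h.linked_of_core hIH hX hY subset_rfl (disjoint_bd G Y) (bd_subset_of_supp h.supp Y)
    (Or.inl (nonempty_of_touch hm)) fun Z' hZ' _ => hL.subset hZ'

end

/-! ### Reductions of massed graphs and the linkage theorem -/

section

variable {V : Type*} {G : SimpleGraph V} {W X : Finset V} {m K : ℕ}

/-- The graph obtained from `G` by joining all elements of `X` with different labels. -/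
def joinRoots (G : SimpleGraph V) (X : Finset V) (l : V → ℕ) : SimpleGraph V where
  Adj u v := G.Adj u v ∨ (u ∈ X ∧ v ∈ X ∧ l u ≠ l v)
  symm := ⟨fun _ _ h => h.imp (fun h => h.symm) fun h => ⟨h.2.1, h.1, h.2.2.symm⟩⟩
  loopless := ⟨fun _ h => h.elim G.irrefl fun h => h.2.2 rfl⟩

theorem joinRoots_adj {l : V → ℕ} {a b : V} (ha : a ∈ W \ X) :
    (joinRoots G X l).Adj a b ↔ G.Adj a b :=
  ⟨fun h => h.resolve_right fun h => (Finset.mem_sdiff.1 ha).2 h.1, Or.inl⟩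

variable [Fintype V]

theorem touch_joinRoots {l : V → ℕ} {Y : Finset V} (hY : Y ⊆ W \ X) :
    touch (joinRoots G X l) Y = touch G Y :=
  Finset.Subset.antisymm
    (touch_mono fun _ _ hab ha => ⟨(joinRoots_adj (hY ha)).1 hab, Or.inl ha⟩)
    (touch_mono fun _ _ hab ha => ⟨Or.inl hab, Or.inl ha⟩)

theorem Massed.with_joinRoots (h : Massed G W X m) (l : V → ℕ) : Massed (joinRoots G X l) W X m := by
  refine ⟨fun u v huv => huv.elim (h.supp u v) fun h' => h.subset h'.1, h.subset, ?_,
    fun Y hY hlt => ?_⟩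
  · rw [touch_joinRoots subset_rfl]
    exact h.large
  · rw [touch_joinRoots hY]
    refine h.small Y hY (lt_of_le_of_lt (Finset.card_le_card fun v hv => ?_) hlt)
    rw [mem_bd] at hv ⊢
    obtain ⟨h1, y, hy, hyv⟩ := hv
    exact ⟨h1, y, hy, Or.inl hyv⟩

/-- An edge can be deleted if there are enough edges. -/
theorem Massed.linked_of_delete (hIH : LinkedBelow V W.card m K) (h : Massed G W X m)
    (hX : X.card ≤ 2 * K) (hm : 2 * K ≤ m) (hlarge : m * (W \ X).card + 2 ≤ (touch G (W \ X)).card)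
    (hdel : ∀ G', Massed G' W X m → (touch G' (W \ X)).card < (touch G (W \ X)).card →
      Linked G' X) : Linked G X := by
  obtain ⟨e, he⟩ := Finset.card_pos.1 (show 0 < (touch G (W \ X)).card by omega)
  set G' := G.deleteEdges {e} with hG'
  have hadj : ∀ p q, G'.Adj p q ↔ G.Adj p q ∧ s(p, q) ≠ e := fun p q => by
    rw [hG', SimpleGraph.deleteEdges_adj, Set.mem_singleton_iff]
  have hle : G' ≤ G := SimpleGraph.deleteEdges_le _
  have hcard : (touch G' (W \ X)).card + 1 = (touch G (W \ X)).card := by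
    rw [← Finset.card_erase_add_one he]
    congr 2
    ext f
    induction f with
    | _ p q => rw [Finset.mem_erase, mem_touch, mem_touch, hadj]; tauto
  by_cases hviol : ∃ Y ⊆ W \ X, (bd G' Y).card < X.card ∧ m * Y.card < (touch G' Y).card
  -- A violating set that appears after deletion has lost a boundary vertex, so the deleted edge
  -- runs from some `y ∈ Y` to a vertex outside. Then `Y` without `y` has boundary at most `X.card`
  -- in `G`. It loses at most the edges from `y` to `bd G' Y`, fewer than `m`, so it is still dense.
  · obtain ⟨Y, hY, hlt, hYm⟩ := hviol
    have hbig : ¬ (bd G Y).card < X.card := fun hlt' => by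
      have h1 := h.small Y hY hlt'
      have h2 := Finset.card_le_card (touch_mono (G := G') (H := G) (Y := Y) (Y' := Y)
        fun a b hab ha => ⟨hle hab, Or.inl ha⟩)
      omega
    obtain ⟨v, hv, hv'⟩ := Finset.exists_mem_notMem_of_card_lt_card (s := bd G' Y) (t := bd G Y)
      (by omega)
    obtain ⟨hvY, y, hy, hyv⟩ := mem_bd.1 hv
    have hye : s(y, v) = e := by
      by_contra hne
      exact hv' (mem_bd.2 ⟨hvY, y, hy, (hadj y v).2 ⟨hyv, hne⟩⟩)
    have hYe := Finset.card_erase_add_one hy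
    refine h.linked_of_dense hIH hX (Y := Y.erase y) ((Finset.erase_subset _ _).trans hY) ?_ ?_ ?_
    · intro heq
      have := hY hy
      rw [← heq] at this
      simp at this
    · have hsub : bd G (Y.erase y) ⊆ insert y (bd G' Y) := by
        intro w hw
        obtain ⟨hw1, z, hz, hzw⟩ := mem_bd.1 hw
        rw [Finset.mem_erase] at hz hw1
        rw [Finset.mem_insert]
        by_cases hwy : w = y
        · exact Or.inl hwy
        · have hwY : w ∉ Y := fun h' => hw1 ⟨hwy, h'⟩
          refine Or.inr (mem_bd.2 ⟨hwY, z, hz.2, (hadj z w).2 ⟨hzw, fun he' => ?_⟩⟩)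
          rw [← hye] at he'
          rcases Sym2.eq_iff.1 he' with ⟨h1, -⟩ | ⟨h1, -⟩
          · exact hz.1 h1
          · exact hvY (h1 ▸ hz.2)
      have := (Finset.card_le_card hsub).trans (Finset.card_insert_le _ _)
      omega
    · have hsub : touch G' Y ⊆ touch G (Y.erase y) ∪ (bd G' Y).image fun w => s(y, w) := by
        intro f hf
        obtain ⟨p, q, rfl, hpq, hp⟩ := exists_of_mem_touch hf
        rw [Finset.mem_union, mem_touch, Finset.mem_erase, Finset.mem_erase]
        by_cases hpy : p = y
        · subst hpy
          by_cases hq : q ∈ Y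
          · exact Or.inl ⟨hle hpq, Or.inr ⟨hpq.ne.symm, hq⟩⟩
          · exact Or.inr (Finset.mem_image_of_mem _ (mem_bd.2 ⟨hq, p, hp, hpq⟩))
        · exact Or.inl ⟨hle hpq, Or.inl ⟨hpy, hp⟩⟩
      have h1 := (Finset.card_le_card hsub).trans (Finset.card_union_le _ _)
      rw [card_image_edge] at h1
      rw [← hYe, mul_add] at hYm
      omega
  · push Not at hviol
    exact (hdel G' ⟨fun u v huv => h.supp u v (hle huv), h.subset, by omega, hviol⟩
      (by omega)).le hle

/-- A new edge from `u` to a vertex of `Y` replaces an edge from `v` to that vertex, which is lost.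
-/
theorem card_touch_contract {Y : Finset V} {u v : V} (hu : u ∉ Y) :
    (touch (contract G u v) Y).card ≤ (touch G Y).card := by
  set A := Y.filter fun p => G.Adj v p ∧ ¬ G.Adj u p with hA
  have h1 : touch (contract G u v) Y ⊆
      (touch G Y).filter (fun e => ¬ v ∈ e) ∪ A.image fun w => s(u, w) := by
    intro e he
    obtain ⟨p, q, rfl, ⟨hpv, hqv, hpq, hadj⟩, hp⟩ := exists_of_mem_touch he
    have hnv : ¬ v ∈ s(p, q) := by
      rw [Sym2.mem_iff, not_or]
      exact ⟨hpv.symm, hqv.symm⟩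
    have hpu : p ≠ u := fun h => hu (h ▸ hp)
    rw [Finset.mem_union, Finset.mem_filter, mem_touch]
    by_cases hG : G.Adj p q
    · exact Or.inl ⟨⟨hG, Or.inl hp⟩, hnv⟩
    · rcases hadj with h | ⟨h, -⟩ | ⟨rfl, h⟩
      · exact absurd h hG
      · exact absurd h hpu
      · refine Or.inr (Finset.mem_image.2 ⟨p, Finset.mem_filter.2 ⟨hp, h, fun h' => hG h'.symm⟩,
          Sym2.eq_swap⟩)
  have h2 : A.image (fun w => s(v, w)) ⊆ (touch G Y).filter (fun e => v ∈ e) := by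
    intro e he
    obtain ⟨p, hp, rfl⟩ := Finset.mem_image.1 he
    rw [Finset.mem_filter] at hp
    exact Finset.mem_filter.2 ⟨mem_touch.2 ⟨hp.2.1, Or.inr hp.1⟩, by simp⟩
  have h3 := (Finset.card_le_card h1).trans (Finset.card_union_le _ _)
  have h4 := Finset.card_le_card h2
  rw [card_image_edge] at h3 h4
  have h5 := Finset.card_filter_add_card_filter_not (s := touch G Y) (fun e => v ∈ e)
  omega

/-- The contraction loses the edge `uv`, one edge for each common neighbour, and the edges from `v`
that would turn into a new edge inside `X`. The latter join `v` to a root not adjacent to the root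
`u`, hence with the same label as `u`, and there is at most one such root. This is the origin of the
`2`. -/
theorem card_touch_le_contract {l : V → ℕ} (hl : ∀ n, (X.filter (l · = n)).card ≤ 2)
    (hXX : ∀ p ∈ X, ∀ q ∈ X, p ≠ q → ¬ G.Adj p q → l p = l q) (hs : ∀ a b, G.Adj a b → a ∈ W)
    {u v : V} (huv : G.Adj u v) :
    (touch G (W \ X)).card ≤ (touch (contract G u v) (W.erase v \ X)).card +
      (Finset.univ.filter fun w => G.Adj u w ∧ G.Adj v w).card + 2 := by
  set N := Finset.univ.filter fun w => G.Adj u w ∧ G.Adj v w with hN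
  set A := Finset.univ.filter fun q => G.Adj v q ∧ q ≠ u ∧ ¬ G.Adj u q ∧ ¬ (u ∈ X ∧ q ∈ X) with hA
  set E := Finset.univ.filter fun q => G.Adj v q ∧ q ≠ u ∧ ¬ G.Adj u q ∧ (u ∈ X ∧ q ∈ X) with hE
  have h1 : (touch G (W \ X)).filter (fun e => v ∈ e) ⊆
      ({u} ∪ N ∪ A ∪ E).image fun w => s(v, w) := by
    intro e he
    rw [Finset.mem_filter] at he
    obtain ⟨q, rfl⟩ := Sym2.mem_iff_exists.1 he.2
    have hvq := (mem_touch.1 he.1).1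
    refine Finset.mem_image_of_mem _ ?_
    simp only [Finset.mem_union, Finset.mem_singleton, hN, hA, hE, Finset.mem_filter,
      Finset.mem_univ, true_and]
    tauto
  have hEcard : E.card ≤ 1 := by
    by_cases huX : u ∈ X
    · have hsub : insert u E ⊆ X.filter (l · = l u) := by
        intro q hq
        simp only [Finset.mem_insert, hE, Finset.mem_filter, Finset.mem_univ, true_and] at hq ⊢
        rcases hq with rfl | ⟨-, h2, h3, -, h4⟩
        · exact ⟨huX, rfl⟩
        · exact ⟨h4, (hXX u huX q h4 h2.symm h3).symm⟩
      have := (Finset.card_le_card hsub).trans (hl _)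
      rw [Finset.card_insert_of_notMem (by simp [hE])] at this
      omega
    · have : E = ∅ := by simp [hE, huX]
      simp [this]
  have h2 : (touch G (W \ X)).filter (fun e => ¬ v ∈ e) ∪ A.image (fun w => s(u, w)) ⊆
      touch (contract G u v) (W.erase v \ X) := by
    intro e he
    rcases Finset.mem_union.1 he with he | he
    · rw [Finset.mem_filter] at he
      obtain ⟨a, b, rfl, hab, ha⟩ := exists_of_mem_touch he.1
      have hv := he.2
      rw [Sym2.mem_iff, not_or] at hv
      rw [Finset.mem_sdiff] at ha
      exact mem_touch.2 ⟨⟨Ne.symm hv.1, Ne.symm hv.2, hab.ne, Or.inl hab⟩,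
        Or.inl (Finset.mem_sdiff.2 ⟨Finset.mem_erase.2 ⟨Ne.symm hv.1, ha.1⟩, ha.2⟩)⟩
    · obtain ⟨q, hq, rfl⟩ := Finset.mem_image.1 he
      simp only [hA, Finset.mem_filter, Finset.mem_univ, true_and] at hq
      obtain ⟨q1, q2, q3, q4⟩ := hq
      refine mem_touch.2 ⟨⟨huv.ne, q1.ne.symm, q2.symm, Or.inr (Or.inl ⟨rfl, q1⟩)⟩, ?_⟩
      simp only [Finset.mem_sdiff, Finset.mem_erase]
      have a1 := huv.ne
      have a2 := q1.ne.symm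
      have a3 := hs u v huv
      have a4 := hs q v q1.symm
      tauto
  have hdisj : Disjoint ((touch G (W \ X)).filter (fun e => ¬ v ∈ e))
      (A.image (fun w => s(u, w))) := by
    rw [Finset.disjoint_left]
    intro e he he'
    obtain ⟨q, hq, rfl⟩ := Finset.mem_image.1 he'
    simp only [hA, Finset.mem_filter, Finset.mem_univ, true_and] at hq
    exact hq.2.2.1 (mem_touch.1 (Finset.mem_filter.1 he).1).1
  have h3 := Finset.card_le_card h1
  have h4 := Finset.card_le_card h2
  rw [Finset.card_union_of_disjoint hdisj, card_image_edge] at h4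
  rw [card_image_edge] at h3
  have h5 := Finset.card_filter_add_card_filter_not (s := touch G (W \ X)) (fun e => v ∈ e)
  have h6 := Finset.card_union_le ({u} ∪ N ∪ A) E
  have h7 := Finset.card_union_le ({u} ∪ N) A
  have h8 := Finset.card_union_le {u} N
  rw [Finset.card_singleton] at h8
  omega

/-- An edge `uv` with `v ∉ X` can be contracted, unless its ends have many common neighbours. -/
theorem Massed.linked_of_contract (hIH : LinkedBelow V W.card m K) (h : Massed G W X m)
    (hX : X.card ≤ 2 * K) {l : V → ℕ} (hl : ∀ n, (X.filter (l · = n)).card ≤ 2)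
    (hXX : ∀ p ∈ X, ∀ q ∈ X, p ≠ q → ¬ G.Adj p q → l p = l q) {u v : V} (huv : G.Adj u v)
    (hv : v ∈ W \ X) (hm : (Finset.univ.filter fun w => G.Adj u w ∧ G.Adj v w).card + 2 ≤ m) :
    Linked G X := by
  have hvW := (Finset.mem_sdiff.1 hv).1
  have hvX := (Finset.mem_sdiff.1 hv).2
  have hcardW := Finset.card_erase_lt_of_mem hvW
  have hXW' : X ⊆ W.erase v := fun x hx => Finset.mem_erase.2 ⟨fun h => hvX (h ▸ hx), h.subset hx⟩
  set G' := contract G u v with hG'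
  by_cases hviol : ∃ Y ⊆ W.erase v \ X, (bd G' Y).card < X.card ∧ m * Y.card < (touch G' Y).card
  · obtain ⟨Y, hY, hlt, hYm, hL⟩ := exists_linked_violator
      (fun W' hW' => hIH W' (hW'.trans hcardW)) hXW' hX hviol
    have hvY : v ∉ Y := fun h' => by simpa using hY h'
    have hvbd : v ∉ bd G' Y := fun h' => by
      obtain ⟨-, y, -, hyv⟩ := mem_bd.1 h'
      exact hyv.2.1 rfl
    have hYW : Y ⊆ W \ X := hY.trans (Finset.sdiff_subset_sdiff (Finset.erase_subset _ _) subset_rfl)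
    have hstep : ∀ y ∈ Y, ∀ w, G.Adj y w → w ≠ v → G'.Adj y w := fun y hy w hyw hwv =>
      ⟨fun h' => hvY (h' ▸ hy), hwv, hyw.ne, Or.inl hyw⟩
    -- If the contracted vertex lies in the violating set, undoing the contraction yields a rigid
    -- separation of `G`. If not, the set is dense in `G`, and its boundary grows at most by `v`.
    by_cases huY : u ∈ Y
    · refine h.linked_of_rigid hIH hX ⟨insert v Y, bd G' Y, ⟨by simp,
        Finset.insert_subset hv hYW, fun w hw => ?_, ?_, fun w hw => ?_, ?_⟩, hlt⟩
      · obtain ⟨hw1, y, hy, hyw⟩ := mem_bd.1 hw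
        rw [Finset.mem_insert, not_or] at hw1
        rcases Finset.mem_insert.1 hy with rfl | hy
        · exact mem_bd.2 ⟨hw1.2, u, huY, huv.ne, hw1.1, fun h' => hw1.2 (h' ▸ huY),
            Or.inr (Or.inl ⟨rfl, hyw⟩)⟩
        · exact mem_bd.2 ⟨hw1.2, y, hy, hstep y hy w hyw hw1.1⟩
      · rw [Finset.disjoint_insert_left]
        exact ⟨hvbd, disjoint_bd _ _⟩
      · obtain ⟨hw1, y, hy, hyw⟩ := mem_bd.1 hw
        rcases hyw.2.2.2 with h' | ⟨-, h'⟩ | ⟨rfl, -⟩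
        · exact h.supp _ _ h'.symm
        · exact h.supp _ _ h'.symm
        · exact h.supp _ _ huv
      · refine Linked.of_contract (u := u) (v := v) ⟨huv, by simp [huY], by simp⟩ hvbd
          (hL.le ?_)
        rintro a b ⟨⟨ha1, hb1, hab, hadj⟩, ha, hb⟩
        have ha' : a ∈ ((insert v Y ∪ bd G' Y : Finset V) : Set V) := by
          rw [Finset.insert_union]
          exact Finset.mem_coe.2 (Finset.mem_insert_of_mem ha)
        have hb' : b ∈ ((insert v Y ∪ bd G' Y : Finset V) : Set V) := by
          rw [Finset.insert_union]
          exact Finset.mem_coe.2 (Finset.mem_insert_of_mem hb)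
        have hv' : v ∈ ((insert v Y ∪ bd G' Y : Finset V) : Set V) := by simp
        refine ⟨ha1, hb1, hab, ?_⟩
        rcases hadj with h' | ⟨h1, h'⟩ | ⟨h1, h'⟩
        · exact Or.inl ⟨h', ha', hb'⟩
        · exact Or.inr (Or.inl ⟨h1, h', hv', hb'⟩)
        · exact Or.inr (Or.inr ⟨h1, h', hv', ha'⟩)
    · refine h.linked_of_dense hIH hX hYW (fun h' => hvY (h' ▸ hv)) ?_
        (hYm.trans_le (card_touch_contract huY))
      have hsub : bd G Y ⊆ insert v (bd G' Y) := fun w hw => by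
        obtain ⟨hw1, y, hy, hyw⟩ := mem_bd.1 hw
        rw [Finset.mem_insert]
        by_cases hwv : w = v
        · exact Or.inl hwv
        · exact Or.inr (mem_bd.2 ⟨hw1, y, hy, hstep y hy w hyw hwv⟩)
      have := (Finset.card_le_card hsub).trans (Finset.card_insert_le _ _)
      omega
  · push Not at hviol
    refine Linked.of_contract huv hvX (hIH _ hcardW G' X ⟨fun p q hpq => ?_, hXW', ?_, hviol⟩ hX)
    · refine Finset.mem_erase.2 ⟨hpq.1, ?_⟩
      rcases hpq.2.2.2 with h' | ⟨rfl, h'⟩ | ⟨-, h'⟩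
      · exact h.supp _ _ h'
      · exact h.supp _ _ huv
      · exact h.supp _ _ h'.symm
    · have h1 := card_touch_le_contract hl hXX h.supp huv
      rw [← hG'] at h1
      have h2 := h.large
      have h3 : W.erase v \ X = (W \ X).erase v := by
        rw [Finset.erase_sdiff_comm]
      have h4 := Finset.card_erase_add_one hv
      rw [← h4, mul_add, ← h3] at h2
      omega

/-- The linkage theorem of Thomas and Wollan, with a slightly weaker bound. -/
theorem Massed.linked (h : Massed G W X (6 * K)) (hX : X.card ≤ 2 * K) : Linked G X := by
  induction hn : W.card using Nat.strong_induction_on generalizing G W X with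
  | _ n ih =>
  have hIH : LinkedBelow V W.card (6 * K) K := fun W' hW' G' X' h' hX' =>
    ih _ (hn ▸ hW') h' hX' rfl
  clear ih hn
  induction hr : (touch G (W \ X)).card using Nat.strong_induction_on generalizing G with
  | _ r ih =>
  by_cases hX0 : X = ∅
  · subst hX0
    exact Linked.empty G
  have hXpos : 0 < X.card := Finset.card_pos.2 (Finset.nonempty_iff_ne_empty.2 hX0)
  intro l hl
  -- Roots with different labels may be made adjacent: such an edge joins different colour classes
  -- and is never used. Afterwards only roots with equal labels can be nonadjacent, as the
  -- contraction step requires.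
  suffices hL : Linked (joinRoots G X l) X by
    obtain ⟨c, hc1, hc2⟩ := hL l hl
    refine ⟨c, hc1, fun x hx y hy hxy => (hc2 x hx y hy hxy).mono_graph fun u v huv hu hv => ?_⟩
    refine huv.resolve_right fun ⟨h1, h2, h3⟩ => h3 ?_
    rw [← hc1 u h1, ← hc1 v h2]
    exact hu.trans hv.symm
  have h' := h.with_joinRoots l
  have hXX : ∀ p ∈ X, ∀ q ∈ X, p ≠ q → ¬ (joinRoots G X l).Adj p q → l p = l q := by
    intro p hp q hq _ hpq
    by_contra hne
    exact hpq (Or.inr ⟨hp, hq, hne⟩)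
  rw [← touch_joinRoots (G := G) (l := l) subset_rfl] at hr
  generalize joinRoots G X l = H at *
  -- With at least two edges to spare one edge can be deleted. Otherwise the number of edges is
  -- exactly one above the threshold, the average degree is barely above `12 * K`, and some vertex
  -- outside `X` has degree at most `12 * K`.
  by_cases hdel : 6 * K * (W \ X).card + 2 ≤ (touch H (W \ X)).card
  · exact h'.linked_of_delete hIH hX (by omega) hdel fun G' hG' hlt => ih _ (hr ▸ hlt) hG' rfl
  obtain ⟨v, hv, hdeg⟩ : ∃ v ∈ W \ X, dIn H Finset.univ v ≤ 12 * K := by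
    by_contra hcon
    push Not at hcon
    have h1 := Finset.sum_le_sum fun v (hv : v ∈ W \ X) => Nat.succ_le_of_lt (hcon v hv)
    rw [Finset.sum_const, smul_eq_mul] at h1
    have h2 := sum_dIn_le H (W \ X)
    obtain ⟨v, hv⟩ := nonempty_of_touch h'.large
    have h3 := hcon v hv
    have h4 : dIn H Finset.univ v < W.card := by
      refine lt_of_le_of_lt (Finset.card_le_card (t := W.erase v) fun w hw => ?_)
        (Finset.card_erase_lt_of_mem (Finset.mem_sdiff.1 hv).1)
      have hvw := (Finset.mem_filter.1 hw).2
      exact Finset.mem_erase.2 ⟨hvw.ne.symm, h'.supp _ _ hvw.symm⟩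
    have h5 := Finset.card_sdiff_add_card_eq_card h.subset
    have h6 : (W \ X).card ≤ 2 := by nlinarith
    omega
  have hvX := (Finset.mem_sdiff.1 hv).2
  set N := Finset.univ.filter (H.Adj v) with hN
  have hmN : ∀ w, w ∈ N ↔ H.Adj v w := fun w => by simp [hN]
  by_cases hN0 : N = ∅
  · refine h'.linked_of_rigid hIH hX ⟨{v}, ∅, ⟨by simp, by simpa using hv, fun w hw => ?_, by simp,
      by simp, Linked.empty _⟩, by simpa using hXpos⟩
    obtain ⟨-, y, hy, hyw⟩ := mem_bd.1 hw
    rw [Finset.mem_singleton] at hy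
    subst hy
    rw [← hN0, hmN]
    exact hyw
  by_cases hcom : ∃ u, H.Adj v u ∧
      (Finset.univ.filter fun w => H.Adj u w ∧ H.Adj v w).card + 2 ≤ 6 * K
  · obtain ⟨u, hvu, hu⟩ := hcom
    exact h'.linked_of_contract hIH hX hl hXX hvu.symm hv hu
  push Not at hcom
  have hvN : v ∉ N := by simp [hN]
  -- Since no edge at `v` can be contracted, each neighbour of `v` shares at least `6 * K - 1`
  -- neighbours with it. The closed neighbourhood therefore has minimum degree `6 * K` on at most
  -- `12 * K + 1` vertices, precisely the setting of `exists_linked_part`.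
  have hDdeg : ∀ x ∈ insert v N, 6 * K ≤ dIn H (insert v N) x := by
    have hnb : ∀ u ∈ N, 6 * K ≤ dIn H (insert v N) u := by
      intro u hu
      have h1 := hcom u ((hmN u).1 hu)
      have h2 : insert v (Finset.univ.filter fun w => H.Adj u w ∧ H.Adj v w) ⊆
          (insert v N).filter (H.Adj u) := by
        intro w hw
        rw [Finset.mem_filter, Finset.mem_insert, hmN]
        rcases Finset.mem_insert.1 hw with rfl | hw
        · exact ⟨Or.inl rfl, ((hmN u).1 hu).symm⟩
        · rw [Finset.mem_filter] at hw
          exact ⟨Or.inr hw.2.2, hw.2.1⟩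
      have h3 := Finset.card_le_card h2
      rw [Finset.card_insert_of_notMem (by simp)] at h3
      rw [dIn]
      omega
    intro x hx
    rcases Finset.mem_insert.1 hx with rfl | hx
    · obtain ⟨u, hu⟩ := Finset.nonempty_iff_ne_empty.2 hN0
      have h1 := hnb u hu
      have h2 := dIn_lt (G := H) (Finset.mem_insert_of_mem hu (b := x))
      rw [Finset.card_insert_of_notMem hvN] at h2
      have h3 : N ⊆ (insert x N).filter (H.Adj x) := fun w hw =>
        Finset.mem_filter.2 ⟨Finset.mem_insert_of_mem hw, (hmN w).1 hw⟩
      have h4 := Finset.card_le_card h3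
      rw [dIn]
      omega
    · exact hnb x hx
  obtain ⟨U, hUD, hUcard, hU⟩ := exists_linked_part (G := H) (W := insert v N) (K := K) hDdeg
    (by
      have h1 : N.card = dIn H Finset.univ v := rfl
      rw [Finset.card_insert_of_notMem hvN]
      omega) (by simp) le_rfl
  have hUW : U ⊆ W := fun w hw => by
    rcases Finset.mem_insert.1 (hUD hw) with rfl | hw
    · exact (Finset.mem_sdiff.1 hv).1
    · exact h'.supp _ _ ((hmN w).1 hw).symm
  refine h'.linked_of_core hIH hX (Y := ∅) (Z := U) (by simp) (by simp [bd]) (by simp) hUW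
    (Or.inr (by omega)) fun Z' hZ' hZ'c => ?_
  rw [Finset.empty_union]
  exact linked_of_linking hUcard hZ' (by omega) hU

end

/-! ### Maximum cuts and highly linked bipartite subgraphs -/

section

variable {V : Type*}

/-- The edges of `G` joining vertices of different colours. -/
def cut (G : SimpleGraph V) (χ : V → Bool) : SimpleGraph V where
  Adj u v := G.Adj u v ∧ χ u ≠ χ v
  symm := ⟨fun _ _ h => ⟨h.1.symm, h.2.symm⟩⟩
  loopless := ⟨fun _ h => h.2 rfl⟩

theorem cut_le (G : SimpleGraph V) (χ : V → Bool) : cut G χ ≤ G := fun _ _ h => h.1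

/-- The sum of the degrees in the subgraph induced by `U`. -/
noncomputable def degSum (G : SimpleGraph V) (U : Finset V) : ℕ := ∑ v ∈ U, dIn G U v

variable {G : SimpleGraph V}

theorem dIn_insert {U : Finset V} {v : V} (hv : v ∉ U) (w : V) :
    dIn G (insert v U) w = dIn G U w + if G.Adj w v then 1 else 0 := by
  rw [dIn, Finset.filter_insert]
  split_ifs with h
  · rw [Finset.card_insert_of_notMem (fun h' => hv (Finset.mem_filter.1 h').1)]
    rfl
  · rfl

theorem degSum_insert {U : Finset V} {v : V} (hv : v ∉ U) :
    degSum G (insert v U) = degSum G U + 2 * dIn G U v := by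
  have h1 : ∑ w ∈ U, (if G.Adj w v then 1 else 0) = dIn G U v := by
    rw [dIn, Finset.card_filter]
    exact Finset.sum_congr rfl fun w _ => if_congr (G.adj_comm _ _) rfl rfl
  rw [degSum, Finset.sum_insert hv]
  simp only [dIn_insert hv, Finset.sum_add_distrib, h1, G.irrefl, if_false]
  rw [degSum]
  omega

theorem dIn_mono {U U' : Finset V} (h : U ⊆ U') (v : V) : dIn G U v ≤ dIn G U' v :=
  Finset.card_le_card (Finset.filter_subset_filter _ h)

theorem dIn_congr {H : SimpleGraph V} {U : Finset V} {v : V}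
    (h : ∀ w ∈ U, G.Adj v w ↔ H.Adj v w) : dIn G U v = dIn H U v := by
  rw [dIn, dIn, Finset.filter_congr h]

/-- Every graph has a bipartite spanning subgraph in which all degrees drop by at most half. -/
theorem exists_max_cut [Fintype V] (G : SimpleGraph V) :
    ∃ χ : V → Bool, ∀ v, dIn G Finset.univ v ≤ 2 * dIn (cut G χ) Finset.univ v := by
  obtain ⟨χ, -, hχ⟩ := Finset.exists_max_image (Finset.univ : Finset (V → Bool))
    (fun χ => degSum (cut G χ) Finset.univ) ⟨fun _ => true, Finset.mem_univ _⟩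
  refine ⟨χ, fun v => ?_⟩
  -- Moving `v` to the other side exchanges its cut edges with its remaining edges and affects
  -- nothing else, so at a maximum at least half of its edges are cut.
  set χ' := Function.update χ v (!χ v) with hχ'
  have hne : ∀ w, w ≠ v → χ' w = χ w := fun w hw => Function.update_of_ne hw _ _
  have hv : χ' v = !χ v := Function.update_self _ _ _
  have h1 := hχ χ' (Finset.mem_univ _)
  have hins : insert v (Finset.univ.erase v) = (Finset.univ : Finset V) :=
    Finset.insert_erase (Finset.mem_univ v)
  have hnot : v ∉ Finset.univ.erase v := Finset.notMem_erase v _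
  have hd : ∀ H : SimpleGraph V, dIn H Finset.univ v = dIn H (Finset.univ.erase v) v := by
    intro H
    rw [← hins, dIn_insert hnot]
    simp
  rw [← hins, degSum_insert hnot, degSum_insert hnot] at h1
  have h2 : degSum (cut G χ') (Finset.univ.erase v) = degSum (cut G χ) (Finset.univ.erase v) := by
    refine Finset.sum_congr rfl fun w hw => dIn_congr fun w' hw' => ?_
    simp only [cut, hne w (Finset.ne_of_mem_erase hw), hne w' (Finset.ne_of_mem_erase hw')]
  have h3 : dIn G (Finset.univ.erase v) v ≤
      dIn (cut G χ) (Finset.univ.erase v) v + dIn (cut G χ') (Finset.univ.erase v) v := by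
    refine le_trans (Finset.card_le_card fun w hw => ?_) (Finset.card_union_le _ _)
    rw [Finset.mem_union, Finset.mem_filter, Finset.mem_filter]
    rw [Finset.mem_filter] at hw
    simp only [cut, hne w (Finset.ne_of_mem_erase hw.1), hv]
    cases hvc : χ v <;> cases hwc : χ w <;> simp [hw.1, hw.2]
  rw [hd, hd]
  omega

variable [Fintype V]

/-- Only pairs of roots are missed when the edges touching `U \ X` are counted at both ends, which
accounts for the term `X.card * X.card`. -/
theorem degSum_le_touch {U X : Finset V} (hX : X ⊆ U) :
    degSum G U ≤ 2 * (touch (restr G U) (U \ X)).card + X.card * X.card := by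
  set T := touch (restr G U) (U \ X) with hT
  have h1 : ∑ v ∈ U, (T.filter fun e => v ∈ e).card ≤ 2 * T.card := by
    have h0 := Finset.sum_card_bipartiteAbove_eq_sum_card_bipartiteBelow (s := U) (t := T)
      (fun (v : V) (e : Sym2 V) => v ∈ e)
    refine h0.trans_le ?_
    rw [mul_comm, ← smul_eq_mul, ← Finset.sum_const]
    refine Finset.sum_le_sum fun e _ => ?_
    induction e with
    | _ a b =>
      refine le_trans (Finset.card_le_card (t := {a, b}) fun v hv => ?_) Finset.card_le_two
      simpa using ((Finset.mem_bipartiteBelow _).1 hv).2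
  have h2 : ∀ v ∈ U, dIn G U v ≤ (T.filter fun e => v ∈ e).card +
      if v ∈ X then X.card else 0 := by
    intro v hv
    have himg : ∀ A ⊆ U, (∀ w ∈ A, v ∈ U \ X ∨ w ∈ U \ X) →
        dIn G A v ≤ (T.filter fun e => v ∈ e).card := by
      intro A hA hAX
      rw [dIn, ← card_image_edge v]
      refine Finset.card_le_card fun e he => ?_
      obtain ⟨w, hw, rfl⟩ := Finset.mem_image.1 he
      rw [Finset.mem_filter] at hw
      exact Finset.mem_filter.2 ⟨mem_touch.2 ⟨⟨hw.2, hv, hA hw.1⟩, hAX w hw.1⟩, by simp⟩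
    split_ifs with hvX
    · have h3 := himg (U \ X) Finset.sdiff_subset fun w hw => Or.inr hw
      have h4 := dIn_le G X v
      have h5 : dIn G U v = dIn G (U \ X) v + dIn G X v := by
        rw [← dIn_union Finset.sdiff_disjoint, Finset.sdiff_union_of_subset hX]
      omega
    · exact himg U subset_rfl fun w _ => Or.inl (Finset.mem_sdiff.2 ⟨hv, hvX⟩)
  have h3 := Finset.sum_le_sum h2
  rw [Finset.sum_add_distrib, Finset.sum_ite_mem, Finset.inter_eq_right.2 hX, Finset.sum_const,
    smul_eq_mul] at h3
  rw [degSum]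
  omega

/-- No edge joins `Y` to the vertices beyond its boundary, so every edge lies in one of the two
parts; edges inside the boundary may be counted twice. -/
theorem degSum_le_add {U : Finset V} {Y : Finset V} (hY : Y ⊆ U) :
    degSum G U ≤ degSum G (Y ∪ bd (restr G U) Y) + degSum G (U \ Y) := by
  set Z := bd (restr G U) Y with hZ
  have hZU : Z ⊆ U := fun v hv => by
    obtain ⟨-, y, -, hyv⟩ := mem_bd.1 hv
    exact hyv.2.2
  have key : ∀ v ∈ U, dIn G U v ≤ (if v ∈ Y ∪ Z then dIn G (Y ∪ Z) v else 0) +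
      if v ∈ U \ Y then dIn G (U \ Y) v else 0 := by
    intro v hv
    by_cases hvY : v ∈ Y
    · have : dIn G U v ≤ dIn G (Y ∪ Z) v := Finset.card_le_card fun w hw => by
        rw [Finset.mem_filter] at hw ⊢
        refine ⟨?_, hw.2⟩
        by_cases hwY : w ∈ Y
        · exact Finset.mem_union_left _ hwY
        · exact Finset.mem_union_right _ (mem_bd.2 ⟨hwY, v, hvY, hw.2, hY hvY, hw.1⟩)
      simpa [hvY] using this
    by_cases hvZ : v ∈ Z
    · have h1 : U ⊆ (Y ∪ Z) ∪ (U \ Y) := fun w hw => by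
        by_cases hwY : w ∈ Y <;> simp [hwY, hw]
      have h2 : dIn G U v ≤ dIn G (Y ∪ Z) v + dIn G (U \ Y) v := by
        refine (dIn_mono h1 v).trans ?_
        rw [dIn, Finset.filter_union]
        exact Finset.card_union_le _ _
      simpa [hvY, hvZ, hv] using h2
    · have : dIn G U v ≤ dIn G (U \ Y) v := Finset.card_le_card fun w hw => by
        rw [Finset.mem_filter] at hw ⊢
        refine ⟨Finset.mem_sdiff.2 ⟨hw.1, fun hwY => hvZ ?_⟩, hw.2⟩
        exact mem_bd.2 ⟨hvY, w, hwY, hw.2.symm, hw.1, hv⟩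
      simpa [hvY, hvZ, hv] using this
  have h3 := Finset.sum_le_sum key
  rw [Finset.sum_add_distrib, Finset.sum_ite_mem, Finset.sum_ite_mem,
    Finset.inter_eq_right.2 (Finset.union_subset hY hZU),
    Finset.inter_eq_right.2 Finset.sdiff_subset] at h3
  exact h3

/-- A graph of large minimum degree has a highly linked bipartite subgraph. -/
theorem exists_linked_cut {k : ℕ} (hk : 0 < k) (hdeg : ∀ v, 50 * k ≤ dIn G Finset.univ v)
    (hV : 12 * k ≤ Fintype.card V) :
    ∃ (χ : V → Bool) (U : Finset V), 12 * k ≤ U.card ∧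
      ∀ X ⊆ U, X.card ≤ 4 * k → Linked (restr (cut G χ) U) X := by
  obtain ⟨χ, hχ⟩ := exists_max_cut G
  set B := cut G χ with hB
  -- A minimal set for a Mader-type density condition. The term `100 * k * k` is chosen so that two
  -- parts overlapping in at most `4 * k - 1` vertices cannot both fail the condition; and at `12 *
  -- k` vertices the condition cannot hold for lack of room.
  obtain ⟨U, ⟨hUc, hUd⟩, hmin⟩ := exists_argmin (P := fun U : Finset V => 12 * k ≤ U.card ∧
    25 * k * U.card + 25 * k < degSum B U + 100 * k * k) Finset.card ⟨Finset.univ, by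
      simpa using hV, by
      have h1 : ∑ _v : V, 25 * k ≤ degSum B Finset.univ := Finset.sum_le_sum fun v _ => by
        have h1 := hχ v
        have h2 := hdeg v
        omega
      rw [Finset.sum_const, smul_eq_mul] at h1
      nlinarith⟩
  have hmin' : ∀ U' : Finset V, U'.card < U.card → 12 * k ≤ U'.card →
      degSum B U' + 100 * k * k ≤ 25 * k * U'.card + 25 * k := by
    intro U' hlt h12
    by_contra hcon
    push Not at hcon
    have := hmin U' ⟨h12, hcon⟩
    omega
  have hUgt : 12 * k < U.card := by
    by_contra hle
    have heq : U.card = 12 * k := by omega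
    have h1 : degSum B U ≤ ∑ _v ∈ U, U.card := Finset.sum_le_sum fun v _ => dIn_le _ _ _
    rw [Finset.sum_const, smul_eq_mul] at h1
    rw [heq] at h1 hUd
    nlinarith
  have hdegU : ∀ v ∈ U, 25 * k < 2 * dIn B U v := by
    intro v hv
    have h1 := degSum_insert (G := B) (Finset.notMem_erase v U)
    have h2 := Finset.card_erase_add_one hv
    have h3 := hmin' (U.erase v) (by omega) (by omega)
    have h4 := dIn_mono (G := B) (Finset.erase_subset v U) v
    rw [Finset.insert_erase hv] at h1
    rw [← h2] at hUd
    nlinarith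
  -- Adjacent vertices of a bipartite graph have disjoint neighbourhoods, each with more than `12.5
  -- * k` vertices.
  have hU25 : 25 * k < U.card := by
    obtain ⟨v, hv⟩ := Finset.card_pos.1 (show 0 < U.card by omega)
    have h1 := hdegU v hv
    obtain ⟨w, hw, hvw, -⟩ := exists_adj_of_dIn (G := B) (C := U) (x := v) ∅ (by
      rw [Finset.card_empty]
      omega)
    have h2 := hdegU w hw
    have h3 : dIn B U v + dIn B U w ≤ U.card := by
      rw [dIn, dIn, ← Finset.card_union_of_disjoint]
      · exact Finset.card_le_card (Finset.union_subset (Finset.filter_subset _ _)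
          (Finset.filter_subset _ _))
      · rw [Finset.disjoint_left]
        intro z hz hz'
        have a1 := hvw.2
        have a2 := (Finset.mem_filter.1 hz).2.2
        have a3 := (Finset.mem_filter.1 hz').2.2
        cases h1 : χ v <;> cases h2 : χ w <;> cases h3 : χ z <;> simp_all
    omega
  refine ⟨χ, U, hUc, fun X hXU hX => ?_⟩
  obtain ⟨X', hXX', hX'U, hX'⟩ := Finset.exists_subsuperset_card_eq hXU hX (by omega)
  refine Linked.subset (X := X') ?_ hXX'
  refine Massed.linked (W := U) (K := 2 * k) ⟨fun u v huv => huv.2.1, hX'U, ?_, ?_⟩ (by omega)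
  · have h1 := degSum_le_touch (G := B) hX'U
    have h2 := Finset.card_sdiff_add_card_eq_card hX'U
    rw [hX'] at h1 h2
    rw [← h2] at hUd hU25
    nlinarith
  · intro Y hY hlt
    rcases Y.eq_empty_or_nonempty with rfl | ⟨y, hy⟩
    · simp [touch]
    -- Behind a boundary with fewer than `4 * k` vertices there is nothing at all: both parts of the
    -- separation would have at least `12 * k` vertices and be smaller than `U`, and one of them
    -- would satisfy the density condition.
    exfalso
    have hYU := hY.trans Finset.sdiff_subset
    set Z := bd (restr B U) Y with hZ
    have hZU : Z ⊆ U := fun v hv => by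
      obtain ⟨-, y, -, hyv⟩ := mem_bd.1 hv
      exact hyv.2.2
    obtain ⟨x, hx, hxZ⟩ := Finset.exists_mem_notMem_of_card_lt_card hlt
    have hxY : x ∉ Y := fun h => (Finset.mem_sdiff.1 (hY h)).2 hx
    have c1 : 12 * k ≤ (Y ∪ Z).card := by
      have h1 := hdegU y (hYU hy)
      have h2 : U.filter (B.Adj y) ⊆ Y ∪ Z := fun w hw => by
        rw [Finset.mem_filter] at hw
        by_cases hwY : w ∈ Y
        · exact Finset.mem_union_left _ hwY
        · exact Finset.mem_union_right _ (mem_bd.2 ⟨hwY, y, hy, hw.2, hYU hy, hw.1⟩)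
      have h3 := Finset.card_le_card h2
      rw [dIn] at h1
      omega
    have c2 : 12 * k ≤ (U \ Y).card := by
      have h1 := hdegU x (hX'U hx)
      have h2 : U.filter (B.Adj x) ⊆ U \ Y := fun w hw => by
        rw [Finset.mem_filter] at hw
        refine Finset.mem_sdiff.2 ⟨hw.1, fun hwY => hxZ ?_⟩
        exact mem_bd.2 ⟨hxY, w, hwY, hw.2.symm, hw.1, hX'U hx⟩
      have h3 := Finset.card_le_card h2
      rw [dIn] at h1
      omega
    have l1 : (Y ∪ Z).card < U.card := Finset.card_lt_card (Finset.ssubset_iff_subset_ne.2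
      ⟨Finset.union_subset hYU hZU, fun h => by
        have := hX'U hx
        rw [← h, Finset.mem_union] at this
        exact this.elim hxY hxZ⟩)
    have l2 : (U \ Y).card + Y.card = U.card := Finset.card_sdiff_add_card_eq_card hYU
    have hypos := Finset.card_pos.2 ⟨y, hy⟩
    have d1 := hmin' _ l1 c1
    have d2 := hmin' _ (by omega) c2
    have d3 := degSum_le_add (G := B) hYU
    have d4 : (Y ∪ Z).card = Y.card + Z.card := Finset.card_union_of_disjoint (disjoint_bd _ _)
    rw [← hZ] at d3
    have d5 : Z.card + 1 ≤ 4 * k := by omega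
    rw [d4] at d1
    rw [← l2] at hUd
    nlinarith

end

/-! ### Tutte's theorem -/

section

/-- **Tutte's theorem**, in terms of representatives of the odd components. -/
theorem exists_involution_or_odd_components {H : Type*} [Fintype H] (Γ : SimpleGraph H) :
    (∃ f : H → H, (∀ x, Γ.Adj x (f x)) ∧ ∀ x, f (f x) = x) ∨
      ∃ T R : Finset H, T.card < R.card ∧ (Odd R.card ↔ Odd (Fintype.card H - T.card)) ∧
        (∀ x ∈ R, x ∉ T ∧ Odd (Finset.univ.filter fun y => Joins Γ {v | v ∉ T} x y).card) ∧
        ∀ x ∈ R, ∀ y ∈ R, Joins Γ {v | v ∉ T} x y → x = y := by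
  by_cases hM : ∃ M : Γ.Subgraph, M.IsPerfectMatching
  · left
    obtain ⟨M, hM⟩ := hM
    rw [SimpleGraph.Subgraph.isPerfectMatching_iff] at hM
    choose f hf hf' using hM
    exact ⟨f, fun x => (hf x).adj_sub, fun x => (hf' (f x) x (hf x).symm).symm⟩
  right
  rw [SimpleGraph.tutte] at hM
  push Not at hM
  obtain ⟨u, hu⟩ := hM
  rw [SimpleGraph.IsTutteViolator] at hu
  set Δ := ((⊤ : Γ.Subgraph).deleteVerts u).coe with hΔ
  have hmem : ∀ v, v ∈ ((⊤ : Γ.Subgraph).deleteVerts u).verts ↔ v ∉ u := fun v => by simp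
  have hadj : ∀ x y : ((⊤ : Γ.Subgraph).deleteVerts u).verts, Δ.Adj x y ↔ Γ.Adj x y := by
    intro x y
    have hx := (hmem x).1 x.2
    have hy := (hmem y).1 y.2
    simp [hΔ, hx, hy]
  have hreach : ∀ x y : ((⊤ : Γ.Subgraph).deleteVerts u).verts,
      Δ.Reachable x y ↔ Joins Γ {v | v ∉ u} x y := by
    intro x y
    constructor
    · rintro ⟨w⟩
      induction w with
      | nil => exact .refl ((hmem _).1 (Subtype.prop _))
      | cons h p ih => exact .cons ((hadj _ _).1 h) ((hmem _).1 (Subtype.prop _)) ih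
    · rintro ⟨w, hw⟩
      obtain ⟨x, hx⟩ := x
      obtain ⟨y, hy⟩ := y
      simp only at w hw
      induction w with
      | nil => exact .refl _
      | @cons a b c h p ih =>
        have hb : b ∉ u := hw b (by simp)
        have hstep : Δ.Adj ⟨a, hx⟩ ⟨b, (hmem b).2 hb⟩ := (hadj _ _).2 h
        exact hstep.reachable.trans (ih _ hy fun v hv => hw v (by simp [hv]))
  let rep : Δ.ConnectedComponent → H := fun c => (Quot.out c).1
  have hrep : ∀ c : Δ.ConnectedComponent, Δ.connectedComponentMk (Quot.out c) = c :=
    fun c => Quot.out_eq c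
  have hrepinj : ∀ c d, Joins Γ {v | v ∉ u} (rep c) (rep d) → c = d := by
    intro c d h
    rw [← hrep c, ← hrep d]
    exact SimpleGraph.ConnectedComponent.sound ((hreach _ _).2 h)
  have hTset : ∀ v, v ∉ u.toFinset ↔ v ∉ u := fun v => by simp
  simp only [← Set.mem_toFinset] at hreach hrepinj
  refine ⟨u.toFinset, Δ.oddComponents.toFinset.image rep, ?_, ?_, ?_, ?_⟩
  all_goals
    have hcard : (Δ.oddComponents.toFinset.image rep).card = Δ.oddComponents.ncard := by
      rw [Finset.card_image_of_injective, Set.ncard_eq_toFinset_card']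
      intro c d hcd
      refine hrepinj c d ?_
      rw [hcd]
      exact .refl ((hTset _).2 ((hmem _).1 (Quot.out d).2))
  · rw [hcard, ← Set.ncard_eq_toFinset_card']
    exact hu
  · rw [hcard, SimpleGraph.odd_ncard_oddComponents]
    have : Nat.card ((⊤ : Γ.Subgraph).deleteVerts u).verts = Fintype.card H - u.toFinset.card := by
      rw [Nat.card_coe_set_eq, ← Set.ncard_eq_toFinset_card', ← Nat.card_eq_fintype_card,
        ← Set.ncard_compl]
      congr 1
      ext v
      simp
    rw [this]
  · intro x hx
    obtain ⟨c, hc, rfl⟩ := Finset.mem_image.1 hx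
    refine ⟨(hTset _).2 ((hmem _).1 (Quot.out c).2), ?_⟩
    have hc' : Odd c.supp.ncard := by simpa using hc
    convert hc' using 1
    rw [← Set.ncard_image_of_injective _ Subtype.val_injective, ← Set.ncard_coe_finset]
    congr 1
    ext v
    simp only [Finset.coe_filter, Finset.mem_univ, true_and, Set.mem_ofPred_eq, Set.mem_image,
      SimpleGraph.ConnectedComponent.mem_supp_iff]
    constructor
    · intro h
      have hv : v ∉ u := (hTset v).1 h.right_mem
      refine ⟨⟨v, (hmem v).2 hv⟩, ?_, rfl⟩
      rw [← hrep c]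
      exact SimpleGraph.ConnectedComponent.sound ((hreach _ _).2 h.symm)
    · rintro ⟨w, hw, rfl⟩
      rw [← hrep c] at hw
      exact ((hreach _ _).1 (SimpleGraph.ConnectedComponent.exact hw)).symm
  · intro x hx y hy h
    obtain ⟨c, hc, rfl⟩ := Finset.mem_image.1 hx
    obtain ⟨d, hd, rfl⟩ := Finset.mem_image.1 hy
    rw [hrepinj c d h]

end

/-! ### The layered graph and small odd cycle covers -/

section

variable {V : Type*}

/-- Two copies of every vertex outside `U`, and one copy of every vertex of `U`, in the layer given
by its colour. -/
abbrev Copy (U : Finset V) (χ : V → Bool) : Type _ := {p : V × Bool // p.1 ∈ U → p.2 = χ p.1}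

/-- The layers are copies of `G`, the two copies of a vertex are joined, and there are `z` further
vertices that are joined to all vertices of `U`. -/
def layered (G : SimpleGraph V) (U : Finset V) (χ : V → Bool) (z : ℕ) :
    SimpleGraph (Copy U χ ⊕ Fin z) where
  Adj
    | .inl a, .inl b => (a.1.2 = b.1.2 ∧ G.Adj a.1.1 b.1.1) ∨ (a.1.1 = b.1.1 ∧ a.1.2 ≠ b.1.2)
    | .inl a, .inr _ => a.1.1 ∈ U
    | .inr _, .inl a => a.1.1 ∈ U
    | .inr _, .inr _ => False
  symm := ⟨by
    rintro (a | a) (b | b)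
    · rintro (h | h)
      · exact Or.inl ⟨h.1.symm, h.2.symm⟩
      · exact Or.inr ⟨h.1.symm, h.2.symm⟩
    · exact id
    · exact id
    · exact id⟩
  loopless := ⟨by
    rintro (a | a)
    · rintro (h | h)
      · exact G.irrefl h.2
      · exact h.2 rfl
    · exact id⟩

theorem Copy.ext_iff' {U : Finset V} {χ : V → Bool} {a b : Copy U χ} :
    a = b ↔ a.1.1 = b.1.1 ∧ a.1.2 = b.1.2 := by
  rw [Subtype.ext_iff, Prod.ext_iff]

theorem layered_flip {G : SimpleGraph V} {U : Finset V} {χ : V → Bool} {z : ℕ} {a b : Copy U χ}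
    (h : a.1.1 = b.1.1) (hab : a ≠ b) : (layered G U χ z).Adj (.inl a) (.inl b) :=
  Or.inr ⟨h, fun h' => hab (Copy.ext_iff'.2 ⟨h, h'⟩)⟩

variable [Fintype V] {G : SimpleGraph V} {U : Finset V} {χ : V → Bool} {z : ℕ}

theorem card_copies (U : Finset V) (χ : V → Bool) (v : V) :
    (Finset.univ.filter fun a : Copy U χ => a.1.1 = v).card + (if v ∈ U then 1 else 0) = 2 := by
  by_cases hv : v ∈ U
  · have : (Finset.univ.filter fun a : Copy U χ => a.1.1 = v) = {⟨(v, χ v), fun _ => rfl⟩} := by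
      ext a
      simp only [Finset.mem_filter, Finset.mem_univ, true_and, Finset.mem_singleton, Copy.ext_iff']
      constructor
      · rintro rfl
        exact ⟨rfl, a.2 hv⟩
      · exact fun h => h.1
    simp [this, hv]
  · have : (Finset.univ.filter fun a : Copy U χ => a.1.1 = v) =
        {⟨(v, true), fun h => absurd h hv⟩, ⟨(v, false), fun h => absurd h hv⟩} := by
      ext a
      simp only [Finset.mem_filter, Finset.mem_univ, true_and, Finset.mem_singleton,
        Finset.mem_insert, Copy.ext_iff']
      cases a.1.2 <;> simp
    rw [this, Finset.card_pair (by simp)]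
    simp [hv]

theorem even_card_layered (U : Finset V) (χ : V → Bool) {m : ℕ} (hm : Even m) (hz : z + m = U.card) :
    Even (Fintype.card (Copy U χ ⊕ Fin z)) := by
  have h1 : Fintype.card (Copy U χ) + U.card = 2 * Fintype.card V := by
    have h2 := Finset.card_eq_sum_card_fiberwise (s := (Finset.univ : Finset (Copy U χ)))
      (t := (Finset.univ : Finset V)) (f := fun a => a.1.1) (fun _ _ => Finset.mem_univ _)
    have h3 := Finset.sum_congr (rfl : (Finset.univ : Finset V) = _)
      fun v _ => card_copies U χ v
    rw [Finset.sum_add_distrib, ← h2, Finset.sum_const, Finset.sum_ite_mem, Finset.univ_inter,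
      Finset.sum_const] at h3
    simp at h3
    rw [Fintype.card]
    simp only [Finset.card_univ] at h3 ⊢
    omega
  rw [Fintype.card_sum, Fintype.card_fin]
  obtain ⟨c, hc⟩ := hm
  exact ⟨Fintype.card V - c, by omega⟩

/-- The copies of `v` outside `T`. -/
noncomputable def alive (T : Finset (Copy U χ ⊕ Fin z)) (v : V) : Finset (Copy U χ) :=
  Finset.univ.filter fun a => a.1.1 = v ∧ .inl a ∉ T

theorem mem_alive {T : Finset (Copy U χ ⊕ Fin z)} {v : V} {a : Copy U χ} :
    a ∈ alive T v ↔ a.1.1 = v ∧ .inl a ∉ T := by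
  simp [alive]

theorem card_alive (T : Finset (Copy U χ ⊕ Fin z)) (v : V) :
    (alive T v).card + (T.toLeft.filter fun a => a.1.1 = v).card + (if v ∈ U then 1 else 0) = 2 := by
  rw [← card_copies U χ v, ← Finset.card_union_of_disjoint]
  · congr 2
    ext a
    simp only [Finset.mem_union, mem_alive, Finset.mem_filter, Finset.mem_toLeft, Finset.mem_univ,
      true_and]
    tauto
  · rw [Finset.disjoint_left]
    intro a ha ha'
    exact (mem_alive.1 ha).2 (Finset.mem_toLeft.1 (Finset.mem_filter.1 ha').1)

theorem sum_card_toLeft (T : Finset (Copy U χ ⊕ Fin z)) :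
    ∑ v, (T.toLeft.filter fun a => a.1.1 = v).card = T.toLeft.card :=
  (Finset.card_eq_sum_card_fiberwise fun _ _ => Finset.mem_univ _).symm

/-- The component of `x` after deletion of `T`. -/
noncomputable def comp {H : Type*} [Fintype H] (Γ : SimpleGraph H) (T : Finset H) (x : H) :
    Finset H :=
  Finset.univ.filter fun y => Joins Γ {v | v ∉ T} x y

theorem mem_comp {H : Type*} [Fintype H] {Γ : SimpleGraph H} {T : Finset H} {x y : H} :
    y ∈ comp Γ T x ↔ Joins Γ {v | v ∉ T} x y := by
  simp [comp]

/-- An odd component that contains none of the additional vertices contains a vertex whose other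
copy is deleted or missing. -/
theorem exists_half {T : Finset (Copy U χ ⊕ Fin z)} {x : Copy U χ ⊕ Fin z}
    (hodd : Odd (comp (layered G U χ z) T x).card)
    (hx : ∀ i, .inr i ∉ comp (layered G U χ z) T x) :
    ∃ a, .inl a ∈ comp (layered G U χ z) T x ∧ alive T a.1.1 = {a} := by
  set C := comp (layered G U χ z) T x with hC
  have h1 : C.card = ∑ v, (C.toLeft.filter fun a => a.1.1 = v).card := by
    rw [sum_card_toLeft, ← Finset.card_toLeft_add_card_toRight, add_eq_left, Finset.card_eq_zero,
      Finset.eq_empty_iff_forall_notMem]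
    exact fun i hi => hx i (Finset.mem_toRight.1 hi)
  have h2 : ∃ v, Odd (C.toLeft.filter fun a : Copy U χ => a.1.1 = v).card := by
    by_contra hcon
    push Not at hcon
    -- If no vertex contributed an odd number of copies, the component would be even. Two surviving
    -- copies of a vertex are adjacent and lie in the same component, so the vertex found has only
    -- one.
    rw [h1] at hodd
    exact Nat.not_even_iff_odd.2 hodd (Finset.even_sum _ fun v _ => Nat.not_odd_iff_even.1 (hcon v))
  obtain ⟨v, hv⟩ := h2
  obtain ⟨a, ha⟩ := Finset.card_pos.1 hv.pos
  rw [Finset.mem_filter, Finset.mem_toLeft] at ha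
  obtain ⟨haC, rfl⟩ := ha
  have haT := (mem_comp.1 haC).right_mem
  refine ⟨a, haC, ?_⟩
  by_contra hne
  have haa : a ∈ alive T a.1.1 := mem_alive.2 ⟨rfl, haT⟩
  have hcard := card_alive T a.1.1
  have h2 : 1 < (alive T a.1.1).card := by
    by_contra hle
    exact hne (Finset.eq_singleton_iff_unique_mem.2 ⟨haa, fun b hb =>
      Finset.card_le_one.1 (not_lt.1 hle) b hb a haa⟩)
  have h3 : (C.toLeft.filter fun b => b.1.1 = a.1.1) = alive T a.1.1 := by
    ext b
    rw [Finset.mem_filter, Finset.mem_toLeft, mem_alive]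
    constructor
    · exact fun h => ⟨h.2, (mem_comp.1 h.1).right_mem⟩
    · rintro ⟨hb, hbT⟩
      refine ⟨?_, hb⟩
      by_cases hba : b = a
      · rwa [hba]
      · exact mem_comp.2 ((mem_comp.1 haC).trans
          (.of_adj (layered_flip hb.symm (Ne.symm hba)) haT hbT))
  rw [h3] at hv
  have : (alive T a.1.1).card = 2 := by omega
  rw [this] at hv
  exact absurd hv (by decide)

/-- If the layered graph has no perfect matching, then a small set of vertices meets all odd
cycles. -/
theorem exists_small_cover {m : ℕ} (hm : Even m) (hz : z + m = U.card) (hmU : m < U.card)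
    (hconn : ∀ Y : Finset V, Y.card ≤ m → ∀ a ∉ Y, ∀ b ∉ Y, Joins G {v | v ∉ Y} a b)
    (T R : Finset (Copy U χ ⊕ Fin z)) (hTR : T.card < R.card)
    (hpar : Odd R.card ↔ Odd (Fintype.card (Copy U χ ⊕ Fin z) - T.card))
    (hodd : ∀ x ∈ R, x ∉ T ∧ Odd (comp (layered G U χ z) T x).card)
    (hR : ∀ x ∈ R, ∀ y ∈ R, Joins (layered G U χ z) {v | v ∉ T} x y → x = y) :
    ∃ (X : Finset V) (c : V → Bool), X.card < m ∧
      ∀ u ∉ X, ∀ v ∉ X, G.Adj u v → c u ≠ c v := by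
  set Γ := layered G U χ z with hΓ
  have hTcard := T.card_toLeft_add_card_toRight
  have hTle := Finset.card_le_univ T
  have heven := even_card_layered U χ hm hz
  have hTright : T.toRight.card ≤ z := by simpa using Finset.card_le_univ T.toRight
  have hinj : ∀ x ∈ R, ∀ y ∈ R, ∀ w, w ∈ comp Γ T x → w ∈ comp Γ T y → x = y :=
    fun x hx y hy w h1 h2 => hR x hx y hy ((mem_comp.1 h1).trans (mem_comp.1 h2).symm)
  -- components without additional vertices
  set R₀ := R.filter fun x => ∀ i, .inr i ∉ comp Γ T x with hR₀
  have hhalf : ∀ x ∈ R₀, ∃ a, .inl a ∈ comp Γ T x ∧ alive T a.1.1 = {a} := fun x hx =>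
    exists_half (hodd x (Finset.mem_filter.1 hx).1).2 (Finset.mem_filter.1 hx).2
  obtain ⟨u₀, -⟩ := Finset.card_pos.1 (Nat.zero_lt_of_lt hmU)
  have : Nonempty (Copy U χ) := ⟨⟨(u₀, χ u₀), fun _ => rfl⟩⟩
  choose! φ hφ hφ' using hhalf
  have hφinj : Set.InjOn φ R₀ := fun x hx y hy hxy =>
    hinj x (Finset.mem_filter.1 hx).1 y (Finset.mem_filter.1 hy).1 (.inl (φ x)) (hφ x hx)
      (by rw [hxy]; exact hφ y hy)
  set N := R₀.image φ with hN
  have hNcard : N.card = R₀.card := Finset.card_image_of_injOn hφinj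
  have hNhalf : ∀ a ∈ N, alive T a.1.1 = {a} := fun a ha => by
    obtain ⟨x, hx, rfl⟩ := Finset.mem_image.1 ha
    exact hφ' x hx
  have hNT : ∀ a ∈ N, .inl a ∉ T := fun a ha => by
    have : a ∈ alive T a.1.1 := by
      rw [hNhalf a ha]
      exact Finset.mem_singleton_self a
    exact (mem_alive.1 this).2
  have hNjoin : ∀ a ∈ N, ∀ b ∈ N, Joins Γ {v | v ∉ T} (.inl a) (.inl b) → a = b := by
    intro a ha b hb hab
    obtain ⟨x, hx, rfl⟩ := Finset.mem_image.1 ha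
    obtain ⟨y, hy, rfl⟩ := Finset.mem_image.1 hb
    rw [hinj x (Finset.mem_filter.1 hx).1 y (Finset.mem_filter.1 hy).1 (.inl (φ y))
      (mem_comp.2 ((mem_comp.1 (hφ x hx)).trans hab)) (hφ y hy)]
  have hNinj : Set.InjOn (fun a : Copy U χ => a.1.1) N := fun a ha b hb hab => by
    have h1 := hNhalf a ha
    simp only at hab
    rw [hab, hNhalf b hb] at h1
    exact (Finset.singleton_inj.1 h1).symm
  -- the additional vertices are all deleted
  have hall : ∀ i, .inr i ∈ T := by
    by_contra hcon
    push Not at hcon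
    obtain ⟨i₀, hi₀⟩ := hcon
    have hnoU : (∃ a : Copy U χ, a.1.1 ∈ U ∧ .inl a ∉ T) ∨ ∀ a : Copy U χ, a.1.1 ∈ U → .inl a ∈ T := by
      by_contra h
      push Not at h
      obtain ⟨h1, a, h2, h3⟩ := h
      exact h3 (h1 a h2)
    have hNU : ∀ a ∈ N, a.1.1 ∉ U := by
      intro a ha haU
      obtain ⟨x, hx, rfl⟩ := Finset.mem_image.1 ha
      refine (Finset.mem_filter.1 hx).2 i₀ (mem_comp.2 ((mem_comp.1 (hφ x hx)).trans ?_))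
      exact .of_adj haU (hNT _ ha) hi₀
    -- Each half vertex outside `U` has its other copy deleted, so the half vertices inject into the
    -- deleted copies that do not lie over `U`.
    have hNle : N.card + (T.toLeft.filter fun a => a.1.1 ∈ U).card ≤ T.toLeft.card := by
      rw [← Finset.card_filter_add_card_filter_not (s := T.toLeft) (fun a => a.1.1 ∈ U), add_comm]
      refine Nat.add_le_add_left ?_ _
      refine Finset.card_le_card_of_surjOn (fun b => if h : alive T b.1.1 = ∅ then b else
        (Finset.nonempty_iff_ne_empty.2 h).choose) ?_
      intro a ha
      have h1 := card_alive T a.1.1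
      rw [hNhalf a ha, if_neg (hNU a ha), Finset.card_singleton] at h1
      obtain ⟨b, hb⟩ := Finset.card_pos.1 (show 0 < (T.toLeft.filter fun b => b.1.1 = a.1.1).card by
        omega)
      rw [Finset.mem_filter] at hb
      have hne : alive T b.1.1 ≠ ∅ := by
        rw [hb.2, hNhalf a ha]
        simp
      refine ⟨b, by simp [hb.2, hNU a ha, Finset.mem_toLeft.1 hb.1], ?_⟩
      simp only [dif_neg hne]
      have := (Finset.nonempty_iff_ne_empty.2 hne).choose_spec
      generalize (Finset.nonempty_iff_ne_empty.2 hne).choose = c at this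
      rw [hb.2, hNhalf a ha, Finset.mem_singleton] at this
      exact this
    have hRsplit := Finset.card_filter_add_card_filter_not (s := R)
      (fun x => ∀ i, .inr i ∉ comp Γ T x)
    rw [← hR₀] at hRsplit
    -- If an element of `U` survives, all surviving additional vertices are in its component; then
    -- there is at most one odd component more than half vertices, and parity excludes `T.card + 1`
    -- components. If no element of `U` survives, all `U.card` of their copies count as deleted,
    -- more than compensating for up to `z` components with additional vertices.
    rcases hnoU with ⟨u, huU, huT⟩ | hdead
    · have hone : (R.filter fun x => ¬ ∀ i, .inr i ∉ comp Γ T x).card ≤ 1 := by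
        refine Finset.card_le_one.2 fun x hx y hy => ?_
        rw [Finset.mem_filter] at hx hy
        have key : ∀ x ∈ R, (¬ ∀ i, .inr i ∉ comp Γ T x) → .inl u ∈ comp Γ T x := by
          intro x _ hx
          push Not at hx
          obtain ⟨i, hi⟩ := hx
          exact mem_comp.2 ((mem_comp.1 hi).trans
            (.of_adj (show Γ.Adj (.inr i) (.inl u) from huU) (mem_comp.1 hi).right_mem huT))
        exact hinj x hx.1 y hy.1 _ (key x hx.1 hx.2) (key y hy.1 hy.2)
      have h1 : R.card = T.card + 1 := by omega
      rw [h1] at hpar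
      rcases Nat.even_or_odd T.card with hT | hT
      · have := hpar.1 hT.add_one
        exact Nat.not_even_iff_odd.2 this (heven.tsub hT)
      · have := hpar.2 (Nat.Even.sub_odd hTle heven hT)
        exact Nat.not_even_iff_odd.2 this hT.add_one
    · have h1 : (R.filter fun x => ¬ ∀ i, .inr i ∉ comp Γ T x).card ≤ z := by
        have hex : ∀ x ∈ R.filter fun x => ¬ ∀ i, .inr i ∉ comp Γ T x, ∃ i : Fin z,
            .inr i ∈ comp Γ T x := by
          intro x hx
          have := (Finset.mem_filter.1 hx).2
          push Not at this
          exact this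
        have : Nonempty (Fin z) := ⟨i₀⟩
        choose! ψ hψ using hex
        refine le_of_le_of_eq ?_ (Finset.card_fin z)
        refine Finset.card_le_card_of_injOn ψ (fun _ _ => Finset.mem_univ _) fun x hx y hy hxy => ?_
        exact hinj x (Finset.mem_filter.1 hx).1 y (Finset.mem_filter.1 hy).1 (.inr (ψ x)) (hψ x hx)
          (by rw [hxy]; exact hψ y hy)
      have h2 : U.card ≤ (T.toLeft.filter fun a => a.1.1 ∈ U).card := by
        refine Finset.card_le_card_of_surjOn (fun a => a.1.1) fun u hu => ?_
        exact ⟨⟨(u, χ u), fun _ => rfl⟩, by simp [Finset.mem_coe.1 hu, hdead ⟨(u, χ u), fun _ => rfl⟩ hu], rfl⟩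
      omega
  have hRR₀ : R₀ = R := Finset.filter_true_of_mem fun x _ i hi => (mem_comp.1 hi).right_mem (hall i)
  have hTz : T.toRight.card = z := by
    have : T.toRight = Finset.univ := Finset.eq_univ_iff_forall.2 fun i =>
      Finset.mem_toRight.2 (hall i)
    rw [this, Finset.card_univ, Fintype.card_fin]
  set B := Finset.univ.filter fun v => (alive T v).card ≤ 1 with hB
  have hBcard : B.card ≤ T.toLeft.card + U.card := by
    have h1 : ∀ v : V, (if (alive T v).card ≤ 1 then 1 else 0) ≤
        (T.toLeft.filter fun a => a.1.1 = v).card + if v ∈ U then 1 else 0 := by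
      intro v
      have := card_alive T v
      split_ifs at this ⊢ <;> omega
    have h2 := Finset.sum_le_sum fun v (_ : v ∈ Finset.univ) => h1 v
    rw [Finset.sum_add_distrib, sum_card_toLeft, ← Finset.card_filter] at h2
    simpa [hB] using h2
  set NV := N.image fun a => a.1.1 with hNV
  have hNVcard : NV.card = N.card := Finset.card_image_of_injOn hNinj
  have hNVB : NV ⊆ B := fun v hv => by
    obtain ⟨a, ha, rfl⟩ := Finset.mem_image.1 hv
    simp [hB, hNhalf a ha]
  -- `B` has at most `T.toLeft.card + U.card` elements, and more than `T.toLeft.card + z` of them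
  -- are half vertices chosen in the odd components. So the remainder has fewer than `U.card - z =
  -- m` elements.
  set X := B \ NV with hX
  have hXcard : X.card < m := by
    have := Finset.card_sdiff_add_card_eq_card hNVB
    rw [← hX] at this
    rw [hRR₀] at hNcard
    omega
  have hnotX : ∀ v ∉ X, (∃ a ∈ N, a.1.1 = v) ∨ 2 ≤ (alive T v).card := by
    intro v hv
    by_cases hvB : v ∈ B
    · left
      have : v ∈ NV := by
        by_contra hvN
        exact hv (Finset.mem_sdiff.2 ⟨hvB, hvN⟩)
      exact Finset.mem_image.1 this
    · right
      simp [hB] at hvB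
      omega
  have hfullU : ∀ v, 2 ≤ (alive T v).card → v ∉ U ∧ ∀ a : Copy U χ, a.1.1 = v → .inl a ∉ T := by
    intro v hv
    have h1 := card_alive T v
    have h2 := card_copies U χ v
    have hvU : v ∉ U := by
      intro hvU
      rw [if_pos hvU] at h1
      omega
    refine ⟨hvU, fun a ha haT => ?_⟩
    have : a ∈ T.toLeft.filter fun a => a.1.1 = v :=
      Finset.mem_filter.2 ⟨Finset.mem_toLeft.2 haT, ha⟩
    have := Finset.card_pos.2 ⟨a, this⟩
    omega
  have hnofull : ∀ w ∉ X, ∃ a ∈ N, a.1.1 = w := by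
    intro w hw
    refine (hnotX w hw).resolve_right fun hw2 => ?_
    obtain ⟨hwU, hwT⟩ := hfullU w hw2
    set a₀ : Copy U χ := ⟨(w, true), fun h => absurd h hwU⟩ with ha₀
    -- If `w` keeps both copies, `X` is enlarged by the half vertex in the component of its copies;
    -- there is at most one. From `w` to a vertex of `U` outside `Y` the graph stays connected, and
    -- along the way both copies of each vertex remain in this component, although a vertex of `U`
    -- never has two copies.
    set Y := X ∪ (N.filter fun a => Joins Γ {v | v ∉ T} (.inl a₀) (.inl a)).image
      (fun a => a.1.1) with hY
    have hone : (N.filter fun a => Joins Γ {v | v ∉ T} (.inl a₀) (.inl a)).card ≤ 1 := by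
      refine Finset.card_le_one.2 fun a ha b hb => ?_
      rw [Finset.mem_filter] at ha hb
      exact hNjoin a ha.1 b hb.1 (ha.2.symm.trans hb.2)
    have hYcard : Y.card ≤ m := by
      have h1 := Finset.card_union_le X ((N.filter fun a =>
        Joins Γ {v | v ∉ T} (.inl a₀) (.inl a)).image (fun a => a.1.1))
      have h2 := Finset.card_image_le (s := N.filter fun a =>
        Joins Γ {v | v ∉ T} (.inl a₀) (.inl a)) (f := fun a => a.1.1)
      rw [← hY] at h1
      omega
    obtain ⟨u, huU, huY⟩ := Finset.exists_mem_notMem_of_card_lt_card (lt_of_le_of_lt hYcard hmU)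
    have hwY : w ∉ Y := by
      intro h
      rcases Finset.mem_union.1 h with h | h
      · exact hw h
      · obtain ⟨a, ha, rfl⟩ := Finset.mem_image.1 h
        rw [hNhalf a (Finset.mem_filter.1 ha).1, Finset.card_singleton] at hw2
        omega
    obtain ⟨p, q, hpq, hp, hq, hpY, hqY⟩ := (hconn Y hYcard w hwY u huY).exists_exit
      (A := {v | 2 ≤ (alive T v).card ∧ ∀ a : Copy U χ, a.1.1 = v →
        Joins Γ {v | v ∉ T} (.inl a₀) (.inl a)})
      ⟨hw2, fun a ha => by
        by_cases haa : a₀ = a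
        · rw [haa]
          exact .refl (hwT a ha)
        · exact .of_adj (layered_flip ha.symm haa) (hwT _ rfl) (hwT _ ha)⟩
      (fun h => (hfullU u h.1).1 huU)
    have hqX : q ∉ X := fun h => hqY (Finset.mem_union_left _ h)
    have hpU := (hfullU p hp.1).1
    have hstep : ∀ b : Copy U χ, b.1.1 = q → .inl b ∉ T →
        Joins Γ {v | v ∉ T} (.inl a₀) (.inl b) := by
      intro b hb hbT
      have h1 := hp.2 ⟨(p, b.1.2), fun h => absurd h hpU⟩ rfl
      exact h1.trans (.of_adj (Or.inl ⟨rfl, by rw [hb]; exact hpq⟩) h1.right_mem hbT)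
    rcases hnotX q hqX with ⟨b, hb, hbq⟩ | hq2
    · exact hqY (Finset.mem_union_right _ (Finset.mem_image.2 ⟨b, Finset.mem_filter.2
        ⟨hb, hstep b hbq (hNT b hb)⟩, hbq⟩))
    · exact hq ⟨hq2, fun b hb => hstep b hb ((hfullU q hq2).2 b hb)⟩
  choose! α hα hα' using hnofull
  -- Outside `X` every vertex has a chosen half copy, and different half copies lie in different
  -- components. So adjacent vertices must have theirs in different layers, and the layers form a
  -- proper colouring.
  refine ⟨X, fun v => (α v).1.2, hXcard, fun u hu v hv huv hc => ?_⟩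
  have hadj : Γ.Adj (.inl (α u)) (.inl (α v)) := Or.inl ⟨hc, by rw [hα' u hu, hα' v hv]; exact huv⟩
  have := hNjoin _ (hα u hu) _ (hα v hv) (.of_adj hadj (hNT _ (hα u hu)) (hNT _ (hα v hv)))
  have h1 := congrArg (fun a : Copy U χ => a.1.1) this
  simp only [hα' u hu, hα' v hv] at h1
  exact huv.ne h1

end

/-! ### Paths of the wrong parity from a perfect matching -/

section

variable {V : Type*} {G : SimpleGraph V} {U : Finset V} {χ : V → Bool} {z : ℕ}
  {f : Copy U χ ⊕ Fin z → Copy U χ ⊕ Fin z}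

/-- The projection of a perfect matching of the layered graph. -/
def proj (f : Copy U χ ⊕ Fin z → Copy U χ ⊕ Fin z) : SimpleGraph V :=
  .fromRel fun v w => ∃ a b : Copy U χ, a.1.1 = v ∧ b.1.1 = w ∧ f (.inl a) = .inl b

theorem proj_adj (hff : ∀ x, f (f x) = x) {v w : V} : (proj f).Adj v w ↔
    v ≠ w ∧ ∃ a b : Copy U χ, a.1.1 = v ∧ b.1.1 = w ∧ f (.inl a) = .inl b := by
  rw [proj, SimpleGraph.fromRel_adj]
  refine and_congr_right fun _ => or_iff_left_of_imp ?_
  rintro ⟨a, b, ha, hb, hab⟩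
  exact ⟨b, a, hb, ha, by rw [← hab, hff]⟩

theorem Copy.eq_of_mem {a b : Copy U χ} (h : a.1.1 = b.1.1) (ha : a.1.1 ∈ U) : a = b :=
  Copy.ext_iff'.2 ⟨h, by rw [a.2 ha, b.2 (h ▸ ha), h]⟩

theorem layered_adj_of_ne {a b : Copy U χ} (h : (layered G U χ z).Adj (.inl a) (.inl b))
    (hab : a.1.1 ≠ b.1.1) : a.1.2 = b.1.2 ∧ G.Adj a.1.1 b.1.1 :=
  h.resolve_right fun h => hab h.1

theorem proj_le (hf : ∀ x, (layered G U χ z).Adj x (f x)) (hff : ∀ x, f (f x) = x) :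
    proj f ≤ G := by
  intro v w hvw
  obtain ⟨hne, a, b, rfl, rfl, hab⟩ := (proj_adj hff).1 hvw
  have := hf (.inl a)
  rw [hab] at this
  exact (layered_adj_of_ne this hne).2

/-- Along a path of the projected matching, the layers alternate. -/
theorem exists_breaking_of_path (hf : ∀ x, (layered G U χ z).Adj x (f x))
    (hff : ∀ x, f (f x) = x) {v b : V} (p : (proj f).Walk v b) (hp : p.IsPath) (hb : b ∈ U)
    (hvb : v ≠ b) :
    ∃ (κ : V → Bool) (e : V) (a a' : Copy U χ), a.1.1 = v ∧ f (.inl a) = .inl a' ∧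
      a'.1.1 ∈ p.support ∧ a'.1.1 ≠ v ∧
      Joins (cut G κ) {w | w ∈ p.support ∧ w ≠ b ∧ (w ∈ U → w = v)} e v ∧ G.Adj e b ∧
      κ e = χ b ∧ κ v = a.1.2 := by
  induction p with
  | nil => exact absurd rfl hvb
  | @cons v w b h p ih =>
    rw [SimpleGraph.Walk.cons_isPath_iff] at hp
    obtain ⟨hne, a, a', rfl, rfl, haa⟩ := (proj_adj hff).1 h
    have hadj := hf (.inl a)
    rw [haa] at hadj
    obtain ⟨hlay, hG⟩ := layered_adj_of_ne hadj hne
    by_cases hwb : a'.1.1 = b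
    · subst hwb
      -- The last edge stays within a layer, and the single copy of the end in `U` fixes this layer
      -- as the colour of that end. Hence the last edge is monochromatic when its first vertex is
      -- coloured by its layer.
      refine ⟨fun _ => χ a'.1.1, a.1.1, a, a', rfl, haa, by simp, hne.symm, ?_, hG, rfl, ?_⟩
      · exact .refl ⟨by simp, hvb, fun _ => rfl⟩
      · rw [hlay, a'.2 hb]
    · obtain ⟨κ, e, c, c', hc, hcc, hc'p, hc'ne, hj, heb, he, hκ⟩ := ih hp.1 hb hwb
      have hca : c ≠ a' := by
        rintro rfl
        rw [← haa, hff, Sum.inl.injEq] at hcc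
        rw [← hcc] at hc'p
        exact hp.2 hc'p
      have hwU : a'.1.1 ∉ U := fun hU => hca (Copy.eq_of_mem hc (hc ▸ hU))
      have hlay' : c.1.2 ≠ a'.1.2 := fun h' => hca (Copy.ext_iff'.2 ⟨hc, h'⟩)
      have hev : e ≠ a.1.1 := by
        rintro rfl
        exact hp.2 hj.left_mem.1
      -- An inner vertex is entered through one copy and left through the other, which lies in the
      -- other layer. Colouring each vertex by the layer in which it is left therefore makes all
      -- edges but the last bichromatic.
      refine ⟨Function.update κ a.1.1 a.1.2, e, a, a', rfl, haa, by simp, hne.symm, ?_, heb, ?_, ?_⟩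
      · refine Joins.trans (b := a'.1.1) ?_ (.of_adj ⟨hG.symm, ?_⟩ ?_ ?_)
        · refine (hj.mono_graph (H := cut G (Function.update κ a.1.1 a.1.2)) ?_).mono ?_
          · intro x y hxy hx hy
            refine ⟨hxy.1, ?_⟩
            rw [Function.update_of_ne, Function.update_of_ne]
            · exact hxy.2
            · rintro rfl
              exact hp.2 hy.1
            · rintro rfl
              exact hp.2 hx.1
          · rintro x ⟨h1, h2, h3⟩
            refine ⟨by simp [h1], h2, fun hx => absurd hx ?_⟩
            by_cases hxw : x = a'.1.1
            · rwa [hxw]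
            · exact fun hx => hxw (h3 hx)
        · rw [Function.update_of_ne hne.symm, Function.update_self, hκ, hlay]
          exact hlay'
        · exact ⟨by simp, hwb, fun h => absurd h hwU⟩
        · exact ⟨by simp, hvb, fun _ => rfl⟩
      · rw [Function.update_of_ne hev, he]
      · rw [Function.update_self]

variable [Fintype V]

/-- The elements of `U` that are matched inside the layers. -/
noncomputable def matched (U : Finset V) (χ : V → Bool) (f : Copy U χ ⊕ Fin z → Copy U χ ⊕ Fin z) :
    Finset V :=
  U.filter fun u => ∃ a b : Copy U χ, a.1.1 = u ∧ f (.inl a) = .inl b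

theorem card_le_matched (hff : ∀ x, f (f x) = x) : U.card ≤ (matched U χ f).card + z := by
  rw [← Finset.card_filter_add_card_filter_not (s := U)
    (fun u => ∃ a b : Copy U χ, a.1.1 = u ∧ f (.inl a) = .inl b)]
  refine Nat.add_le_add_left (le_of_le_of_eq ?_ (Finset.card_fin z)) _
  have hex : ∀ u ∈ U.filter fun u => ¬ ∃ a b : Copy U χ, a.1.1 = u ∧ f (.inl a) = .inl b,
      ∃ i, f (.inl ⟨(u, χ u), fun _ => rfl⟩) = .inr i := by
    intro u hu
    rcases h : f (.inl ⟨(u, χ u), fun _ => rfl⟩) with b | i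
    · exact absurd ⟨_, b, rfl, h⟩ (Finset.mem_filter.1 hu).2
    · exact ⟨i, rfl⟩
  refine Finset.card_le_card_of_forall_subsingleton
    (fun u i => f (.inl ⟨(u, χ u), fun _ => rfl⟩) = .inr i)
    (fun u hu => (hex u hu).imp fun i hi => ⟨Finset.mem_univ i, hi⟩) fun i _ u hu v hv => ?_
  have h := hu.2.trans hv.2.symm
  rw [(Function.LeftInverse.injective hff).eq_iff, Sum.inl.injEq] at h
  exact congrArg (fun a : Copy U χ => a.1.1) h

/-- The vertices that are joined to `u` by the projected matching. -/
noncomputable def orbit (f : Copy U χ ⊕ Fin z → Copy U χ ⊕ Fin z) (u : V) : Finset V :=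
  Finset.univ.filter fun v => Joins (proj f) Set.univ u v

theorem mem_orbit {u v : V} : v ∈ orbit f u ↔ Joins (proj f) Set.univ u v := by
  simp [orbit]

theorem orbit_closed (hff : ∀ x, f (f x) = x) {u : V} {a b : Copy U χ} (ha : a.1.1 ∈ orbit f u)
    (hab : f (.inl a) = .inl b) : b.1.1 ∈ orbit f u := by
  by_cases hne : a.1.1 = b.1.1
  · rwa [← hne]
  · exact mem_orbit.2 ((mem_orbit.1 ha).trans
      (.of_adj ((proj_adj hff).2 ⟨hne, a, b, rfl, rfl, hab⟩) trivial trivial))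

/-- A vertex outside `U` is not adjacent to the additional vertices. A vertex of `U` other than `u`
has a single copy, and that copy is already matched along the edge by which the vertex is reached.
-/
theorem orbit_matched (hf : ∀ x, (layered G U χ z).Adj x (f x)) (hff : ∀ x, f (f x) = x) {u : V}
    (hu : u ∈ matched U χ f) (a : Copy U χ) (ha : a.1.1 ∈ orbit f u) :
    ∃ b, f (.inl a) = .inl b := by
  by_cases haU : a.1.1 ∈ U
  · by_cases hau : u = a.1.1
    · obtain ⟨-, c, b, hc, hcb⟩ := Finset.mem_filter.1 hu
      have : a = c := Copy.eq_of_mem (by rw [hc, hau]) haU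
      exact ⟨b, this ▸ hcb⟩
    · obtain ⟨x, y, hxy, hx, hy, -⟩ := (mem_orbit.1 ha).exists_exit (A := {v | v ≠ a.1.1}) hau
        (by simp)
      simp only [ne_eq, Set.mem_ofPred_eq, not_not] at hy
      obtain ⟨-, c, d, -, hd, hcd⟩ := (proj_adj hff).1 hxy
      have : a = d := Copy.eq_of_mem (by rw [hd, hy]) haU
      exact ⟨c, by rw [this, ← hcd, hff]⟩
  · have := hf (.inl a)
    rcases hfa : f (.inl a) with b | i
    · exact ⟨b, rfl⟩
    · rw [hfa] at this
      exact absurd this haU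

/-- The copies of the vertices of `D`. -/
noncomputable def copiesOver (U : Finset V) (χ : V → Bool) (D : Finset V) : Finset (Copy U χ) :=
  Finset.univ.filter fun a => a.1.1 ∈ D

theorem mem_copiesOver {D : Finset V} {a : Copy U χ} : a ∈ copiesOver U χ D ↔ a.1.1 ∈ D := by simp [copiesOver]

theorem card_copiesOver (D : Finset V) : (copiesOver U χ D).card + (D.filter (· ∈ U)).card = 2 * D.card := by
  rw [Finset.card_eq_sum_card_fiberwise (s := copiesOver U χ D) (t := D) (f := fun a => a.1.1)
    (fun a ha => mem_copiesOver.1 ha), Finset.card_filter, ← Finset.sum_add_distrib, mul_comm,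
    ← smul_eq_mul, ← Finset.sum_const]
  refine Finset.sum_congr rfl fun v hv => ?_
  rw [← card_copies U χ v]
  congr 2
  ext a
  simp only [Finset.mem_filter, mem_copiesOver, Finset.mem_univ, true_and, and_iff_right_iff_imp]
  rintro rfl
  exact hv

/-- The matching restricts to a fixed-point-free involution on the copies over the orbit, so their
number is even. It differs from twice the size of the orbit by the number of elements of `U`. -/
theorem even_orbit (hf : ∀ x, (layered G U χ z).Adj x (f x)) (hff : ∀ x, f (f x) = x) {u : V}
    (hu : u ∈ matched U χ f) : Even ((orbit f u).filter (· ∈ U)).card := by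
  have h1 := card_copiesOver (χ := χ) (U := U) (orbit f u)
  have h2 : Even (copiesOver U χ (orbit f u)).card := by
    choose! g hg using orbit_matched hf hff hu
    have : ∑ a ∈ copiesOver U χ (orbit f u), (1 : ZMod 2) = 0 := by
      refine Finset.sum_involution (fun a _ => g a) ?_ ?_ ?_ ?_
      · exact fun _ _ => by decide
      · intro a ha _ hga
        have := hf (.inl a)
        rw [hg a (mem_copiesOver.1 ha), hga] at this
        exact this.ne rfl
      · exact fun a ha => mem_copiesOver.2 (orbit_closed hff (mem_copiesOver.1 ha) (hg a (mem_copiesOver.1 ha)))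
      · intro a ha
        have h3 := hg a (mem_copiesOver.1 ha)
        have h4 := hg (g a) (orbit_closed hff (mem_copiesOver.1 ha) h3)
        rw [← h3, hff, Sum.inl.injEq] at h4
        exact h4.symm
    rw [Finset.sum_const, nsmul_one] at this
    exact (ZMod.natCast_eq_zero_iff_even).1 this
  exact (Nat.even_add.1 (h1 ▸ even_two_mul _)).1 h2

theorem orbit_le_two (hff : ∀ x, f (f x) = x) {u : V} (hu : u ∈ matched U χ f) :
    ((orbit f u).filter (· ∈ U)).card ≤ 2 := by
  -- Copies over `D` that are matched to something not over `D`. Starting from `{u}`, this number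
  -- plus the number of elements of `U` in `D` never exceeds 2: adding a vertex uses up one such
  -- copy and one copy of the new vertex.
  set out : Finset V → Finset (Copy U χ) := fun D =>
    (copiesOver U χ D).filter fun a => ∀ b ∈ copiesOver U χ D, f (.inl a) ≠ .inl b with hout
  have huU := (Finset.mem_filter.1 hu).1
  have hex : ∃ D : Finset V, u ∈ D ∧ D ⊆ orbit f u ∧
      (out D).card + (D.filter (· ∈ U)).card ≤ 2 := by
    refine ⟨{u}, by simp, by simp [mem_orbit, Joins.refl], ?_⟩
    have h1 := card_copiesOver (χ := χ) (U := U) {u}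
    have h2 := Finset.card_filter_le (copiesOver U χ {u}) fun a => ∀ b ∈ copiesOver U χ {u},
      f (.inl a) ≠ .inl b
    simp only [Finset.card_singleton, mul_one] at h1
    change (out {u}).card ≤ _ at h2
    omega
  obtain ⟨D, ⟨huD, hD, hcard⟩, hmin⟩ := exists_argmin (fun D : Finset V => Fintype.card V - D.card) hex
  have hDeq : D = orbit f u := by
    by_contra hne
    obtain ⟨v, hv, hvD⟩ := Finset.exists_of_ssubset (hD.ssubset_of_ne hne)
    obtain ⟨p, q, hpq, hp, hq, -⟩ := (mem_orbit.1 hv).exists_exit (A := {v | v ∈ D}) huD hvD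
    simp only [Set.mem_ofPred_eq] at hp hq
    obtain ⟨-, a, b, ha, hb, hab⟩ := (proj_adj hff).1 hpq
    have hqorb : q ∈ orbit f u := mem_orbit.2 ((mem_orbit.1 (hD hp)).trans (.of_adj hpq trivial trivial))
    have haout : a ∈ out D := by
      refine Finset.mem_filter.2 ⟨mem_copiesOver.2 (ha ▸ hp), fun c hc hac => ?_⟩
      rw [hab, Sum.inl.injEq] at hac
      rw [← hac, mem_copiesOver, hb] at hc
      exact hq hc
    have hsub : out (insert q D) ⊆ (out D).erase a ∪ (copiesOver U χ {q}).erase b := by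
      intro c hc
      obtain ⟨hc1, hc2⟩ := Finset.mem_filter.1 hc
      rw [mem_copiesOver, Finset.mem_insert] at hc1
      rw [Finset.mem_union, Finset.mem_erase, Finset.mem_erase]
      rcases hc1 with hc1 | hc1
      · refine Or.inr ⟨?_, mem_copiesOver.2 (by simpa using hc1)⟩
        rintro rfl
        exact hc2 a (mem_copiesOver.2 (Finset.mem_insert_of_mem (ha ▸ hp))) (by rw [← hab, hff])
      · refine Or.inl ⟨?_, Finset.mem_filter.2 ⟨mem_copiesOver.2 hc1, fun d hd =>
          hc2 d (mem_copiesOver.2 (Finset.mem_insert_of_mem (mem_copiesOver.1 hd)))⟩⟩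
        rintro rfl
        exact hc2 b (mem_copiesOver.2 (hb ▸ Finset.mem_insert_self q D)) hab
    have h1 := (Finset.card_le_card hsub).trans (Finset.card_union_le _ _)
    rw [Finset.card_erase_of_mem haout, Finset.card_erase_of_mem (mem_copiesOver.2 (by simp [hb]))] at h1
    have h2 := card_copiesOver (χ := χ) (U := U) {q}
    have h3 : ((insert q D).filter (· ∈ U)).card =
        (D.filter (· ∈ U)).card + (({q} : Finset V).filter (· ∈ U)).card := by
      rw [Finset.insert_eq, Finset.filter_union, Finset.card_union_of_disjoint, add_comm]
      exact Finset.disjoint_filter_filter (Finset.disjoint_singleton_left.2 hq)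
    have h4 := Finset.card_pos.2 ⟨a, haout⟩
    have h5 : 0 < (copiesOver U χ {q}).card := Finset.card_pos.2 ⟨b, mem_copiesOver.2 (by simp [hb])⟩
    have h6 := hmin (insert q D) ⟨Finset.mem_insert_of_mem huD,
      Finset.insert_subset hqorb hD, by simp only [Finset.card_singleton] at h2; omega⟩
    have h7 := Finset.card_le_univ (insert q D)
    rw [Finset.card_insert_of_notMem hq] at h6 h7
    omega
  rw [← hDeq]
  omega

theorem exists_ne_mem_orbit (hf : ∀ x, (layered G U χ z).Adj x (f x)) (hff : ∀ x, f (f x) = x)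
    {u : V} (hu : u ∈ matched U χ f) : ∃ b ∈ U, b ≠ u ∧ Joins (proj f) Set.univ u b := by
  have h1 : u ∈ (orbit f u).filter (· ∈ U) :=
    Finset.mem_filter.2 ⟨mem_orbit.2 (.refl trivial), (Finset.mem_filter.1 hu).1⟩
  obtain ⟨c, hc⟩ := even_orbit hf hff hu
  have h2 := Finset.card_pos.2 ⟨u, h1⟩
  obtain ⟨b, hb, hbu⟩ := Finset.exists_mem_ne
    (s := (orbit f u).filter (· ∈ U)) (by omega) u
  rw [Finset.mem_filter, mem_orbit] at hb
  exact ⟨b, hb.2, hbu, hb.1⟩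

/-- If every set of vertices that meets all odd cycles is large, then there are many paths with both
ends in `U` that have the wrong parity with respect to `χ`. -/
theorem exists_breaking_graph {m : ℕ} (hm : Even m) (hmU : m < U.card)
    (hconn : ∀ Y : Finset V, Y.card ≤ m → ∀ a ∉ Y, ∀ b ∉ Y, Joins G {v | v ∉ Y} a b)
    (hcov : ∀ (X : Finset V) (c : V → Bool), (∀ u ∉ X, ∀ v ∉ X, G.Adj u v → c u ≠ c v) →
      m ≤ X.card) :
    ∃ (F : SimpleGraph V) (M : Finset V), F ≤ G ∧ M ⊆ U ∧ m ≤ M.card ∧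
      (∀ u ∈ M, (M.filter fun v => Joins F Set.univ u v).card ≤ 2) ∧
      ∀ u ∈ M, ∃ (κ : V → Bool) (e b : V), b ∈ U ∧ b ≠ u ∧ Joins F Set.univ u b ∧ G.Adj e b ∧
        κ e = χ b ∧ κ u = χ u ∧
        Joins (cut G κ) {v | Joins F Set.univ u v ∧ v ≠ b ∧ (v ∈ U → v = u)} e u := by
  -- At most `z` elements of `U` can be matched to additional vertices, so a perfect matching leaves
  -- at least `m` of them matched inside the layers.
  obtain ⟨z, hz⟩ : ∃ z, z + m = U.card := ⟨U.card - m, by omega⟩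
  rcases exists_involution_or_odd_components (layered G U χ z) with ⟨f, hf, hff⟩ |
    ⟨T, R, hTR, hpar, hodd, hR⟩
  · refine ⟨proj f, matched U χ f, proj_le hf hff, Finset.filter_subset _ _, ?_, ?_, ?_⟩
    · have := card_le_matched hff
      omega
    · intro u hu
      refine (Finset.card_le_card ?_).trans (orbit_le_two hff hu)
      intro v hv
      rw [Finset.mem_filter] at hv ⊢
      exact ⟨mem_orbit.2 hv.2, (Finset.mem_filter.1 hv.1).1⟩
    · intro u hu
      obtain ⟨b, hbU, hbu, w, -⟩ := exists_ne_mem_orbit hf hff hu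
      obtain ⟨κ, e, a, a', ha, -, -, -, hj, heb, he, hκ⟩ := exists_breaking_of_path hf hff
        (w.toPath : (proj f).Walk u b) w.toPath.2 hbU hbu.symm
      have huU := (Finset.mem_filter.1 hu).1
      refine ⟨κ, e, b, hbU, hbu, ⟨w, fun _ _ => trivial⟩, heb, he, ?_, hj.mono ?_⟩
      · rw [hκ, a.2 (ha ▸ huU), ha]
      · rintro v ⟨h1, h2, h3⟩
        exact ⟨⟨(w.toPath : (proj f).Walk u b).takeUntil v h1, fun _ _ => trivial⟩, h2, h3⟩
  · obtain ⟨X, c, hX, hc⟩ := exists_small_cover hm hz hmU hconn T R hTR hpar hodd hR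
    exact absurd (hcov X c hc) (not_le.2 hX)

end

/-! ### Recolouring along paths and rerouting paths along a subgraph -/

section

variable {V : Type*} {G : SimpleGraph V}

theorem cut_adj {χ : V → Bool} {u v : V} : (cut G χ).Adj u v ↔ G.Adj u v ∧ χ u ≠ χ v := Iff.rfl

/-- A path can be coloured properly with prescribed colour of its last vertex. -/
theorem Joins.exists_colouring {P : Set V} {x y : V} (h : Joins G P x y) (β : Bool) :
    ∃ κ : V → Bool, κ y = β ∧ Joins (cut G κ) P x y := by
  obtain ⟨w, hw⟩ := h
  have hw' : ∀ v ∈ (w.toPath : G.Walk x y).support, v ∈ P := fun v hv =>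
    hw v (w.support_toPath_subset_support hv)
  suffices h : ∀ {x y : V} (p : G.Walk x y), p.IsPath →
      ∃ κ : V → Bool, κ y = β ∧ Joins (cut G κ) {v | v ∈ p.support} x y by
    obtain ⟨κ, h1, h2⟩ := h _ w.toPath.2
    exact ⟨κ, h1, h2.mono hw'⟩
  intro x y p hp
  induction p with
  | nil => exact ⟨fun _ => β, rfl, .refl (by simp)⟩
  | @cons x x' y h p ih =>
    rw [SimpleGraph.Walk.cons_isPath_iff] at hp
    obtain ⟨κ, h1, h2⟩ := ih hp.1
    refine ⟨Function.update κ x (!κ x'), ?_, ?_⟩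
    · rw [Function.update_of_ne, h1]
      rintro rfl
      exact hp.2 p.end_mem_support
    · refine .cons (b := x') ⟨h, ?_⟩ (by simp) ?_
      · rw [Function.update_self, Function.update_of_ne h.ne.symm]
        simp
      · refine (h2.mono_graph (H := cut G (Function.update κ x (!κ x'))) fun u v huv hu hv =>
          ⟨huv.1, ?_⟩).mono fun v hv => by
          simpa using Or.inr hv
        rw [Function.update_of_ne, Function.update_of_ne]
        · exact huv.2
        · rintro rfl
          exact hp.2 hv
        · rintro rfl
          exact hp.2 hu

/-- Disjoint paths into `U`, each with its own colouring, extend a colouring of `U`. -/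
theorem exists_linked_recolouring [Finite V] {χ : V → Bool} {U T : Finset V} {n : ℕ}
    (hL : ∀ X ⊆ U, X.card ≤ n → Linked (restr (cut G χ) U) X) (hT : T.card ≤ n) (c : V → V)
    (R : V → Bool → Prop)
    (h : ∀ x ∈ T, ∃ (κ : V → Bool) (y : V), y ∈ U ∧ κ y = χ y ∧ R x (κ x) ∧
      Joins (cut G κ) {v | c v = x ∧ (v ∈ U → v = y)} x y) :
    ∃ χ' : V → Bool, (∀ u ∈ U, χ' u = χ u) ∧ (∀ x ∈ T, R x (χ' x)) ∧ Linked (cut G χ') T := by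
  choose! κ π h1 h2 h3 h4 using h
  -- Each path keeps its own colouring outside `U`. The colourings agree with `χ` at the ends in
  -- `U`, so every path runs in the new cut, and `R` records the colour received by the starting
  -- vertex.
  set χ' : V → Bool := fun v => if v ∈ U then χ v else κ (c v) v with hχ'
  have hU : ∀ u ∈ U, χ' u = χ u := fun u hu => if_pos hu
  have hκ : ∀ x ∈ T, ∀ v, c v = x → (v ∈ U → v = π x) → χ' v = κ x v := by
    intro x hx v hv hvU
    by_cases hvu : v ∈ U
    · rw [hU v hvu, hvU hvu, h2 x hx]
    · rw [hχ']
      simp only [if_neg hvu, hv]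
  refine ⟨χ', hU, fun x hx => ?_, ?_⟩
  · have := (h4 x hx).left_mem
    rw [hκ x hx x this.1 this.2]
    exact h3 x hx
  · refine Linked.of_paths (Q := U) (c := c) (π := π) (fun x hx => ⟨h1 x hx, ?_⟩) ?_
    · refine (h4 x hx).mono_graph fun u v huv hu hv => ⟨huv.1, ?_⟩
      rw [hκ x hx u hu.1 hu.2, hκ x hx v hv.1 hv.2]
      exact huv.2
    · refine Linked.le (G := restr (cut G χ) U) (hL _ ?_ (Finset.card_image_le.trans hT)) ?_
      · intro v hv
        obtain ⟨x, hx, rfl⟩ := Finset.mem_image.1 hv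
        exact h1 x hx
      · rintro u v ⟨huv, hu, hv⟩
        exact ⟨⟨huv.1, by rw [hU u hu, hU v hv]; exact huv.2⟩, hu, hv⟩

/-- Disjoint paths that use as few edges outside `F` as possible end in every component of `F` that
they meet, if this component meets `U`. -/
theorem exists_disjoint_paths_along [Finite V] {F : SimpleGraph V} {T U : Finset V} (hF : F ≤ G)
    (h : DisjointPaths G T U) :
    ∃ (c π : V → V) (hit : V → Prop), (∀ v ∈ U, hit v → ∃ x ∈ T, v = π x) ∧
      (∀ x ∈ T, π x ∈ U ∧ Joins G {v | hit v ∧ c v = x ∧ (v ∈ U → v = π x)} x (π x)) ∧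
      ∀ u ∈ U, ∀ v, hit v → Joins F Set.univ u v → ∃ x ∈ T, Joins F Set.univ u (π x) := by
  -- `N` is a smallest set of edges that, together with `F`, supports the disjoint paths.
  obtain ⟨N, ⟨hNG, c, π, hN⟩, hmin⟩ := exists_argmin (fun N : SimpleGraph V => N.edgeSet.ncard)
    (P := fun N => N ≤ G ∧ DisjointPaths (N ⊔ F) T U) ⟨G, le_rfl, h.le le_sup_left⟩
  have hpath : ∀ x : {x // x ∈ T}, ∃ p : (N ⊔ F).Walk x (π x), p.IsPath ∧
      ∀ v ∈ p.support, c v = x ∧ (v ∈ U → v = π x) := by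
    rintro ⟨x, hx⟩
    obtain ⟨w, hw⟩ := (hN x hx).2
    exact ⟨w.toPath, w.toPath.2, fun v hv => hw v (w.support_toPath_subset_support hv)⟩
  choose p hp hpc using hpath
  set hit : V → Prop := fun v => ∃ x, v ∈ (p x).support with hhit
  have hle : N ⊔ F ≤ G := sup_le hNG hF
  have hitU : ∀ v ∈ U, hit v → ∃ x ∈ T, v = π x := by
    rintro v hv ⟨x, hx⟩
    exact ⟨x, x.2, (hpc x v hx).2 hv⟩
  refine ⟨c, π, hit, hitU, fun x hx => ⟨(hN x hx).1, ?_⟩, fun u hu v hv huv => ?_⟩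
  · exact Joins.le ⟨p ⟨x, hx⟩, fun v hv => ⟨⟨_, hv⟩, hpc ⟨x, hx⟩ v hv⟩⟩ hle
  by_contra hcon
  push Not at hcon
  have hUhit : ∀ q ∈ U, Joins F Set.univ u q → ¬ hit q := by
    intro q hq huq hqh
    obtain ⟨x, hx, rfl⟩ := hitU q hq hqh
    exact hcon x hx huq
  -- a path of `F` from the disjoint paths to `U`
  obtain ⟨w, q, hw, hwU, hqU, huw, huq, hwq⟩ : ∃ w q, hit w ∧ w ∉ U ∧ q ∈ U ∧
      Joins F Set.univ u w ∧ Joins F Set.univ u q ∧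
      Joins F {v | (v ∉ U ∧ ¬ hit v) ∨ v = w ∨ v = q} w q := by
    rcases huv.symm.first (Q := {v | v ∈ U}) hu with hvU | ⟨x, q, hvx, hxq, hq, -⟩
    · exact absurd hv (hUhit v hvU huv)
    have hux : Joins F Set.univ u x := huv.trans (hvx.mono fun _ _ => trivial)
    have huq := hux.trans (.of_adj hxq trivial trivial)
    rcases hvx.symm.first (Q := {v | hit v}) hv with hx | ⟨y, w, hxy, hyw, hw, -, hwU⟩
    · exact ⟨x, q, hx, hvx.right_mem.2, hq, hux, huq, .of_adj hxq (by simp) (by simp)⟩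
    · have huy := hux.trans (hxy.mono fun _ _ => trivial)
      refine ⟨w, q, hw, hwU, hq, huy.trans (.of_adj hyw trivial trivial), huq, ?_⟩
      have hmono : (Set.univ \ {v | v ∈ U}) \ {v | hit v} ⊆
          {v | (v ∉ U ∧ ¬ hit v) ∨ v = w ∨ v = q} := fun v hv => Or.inl ⟨hv.1.2, hv.2⟩
      exact .cons hyw.symm (by simp) ((hxy.mono hmono).symm.trans
        (.of_adj hxq (hmono hxy.left_mem) (by simp)))
  obtain ⟨x, hx⟩ := hw
  have hwπ : π x ≠ w := by
    rintro rfl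
    exact hwU (hN x x.2).1
  -- Beyond `w` the path of `x` still has to leave the component of `F`, by an edge of `N` not in
  -- `F`. Redirecting the path at `w` along `F` to `q` makes this edge dispensable, against
  -- minimality.
  obtain ⟨d, hd, hdS, hdS'⟩ := ((p x).dropUntil w hx).exists_boundary_dart
    {v | Joins F Set.univ u v} huw (hcon x x.2)
  have hdF : ¬ F.Adj d.fst d.snd := fun hF => hdS' (hdS.trans (.of_adj hF trivial trivial))
  have hdN : N.Adj d.fst d.snd := d.adj.resolve_right hdF
  have hdx : d.fst ∈ (p x).support :=
    (p x).support_dropUntil_subset_support hx (SimpleGraph.Walk.dart_fst_mem_support_of_mem_darts _ hd)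
  have hdtake : s(d.fst, d.snd) ∉ ((p x).takeUntil w hx).edges := by
    have h1 := (hp x).isTrail.edges_nodup
    rw [← (p x).take_spec hx, SimpleGraph.Walk.edges_append, List.nodup_append'] at h1
    intro h2
    exact h1.2.2 h2 (List.mem_map_of_mem hd)
  set N' := N.deleteEdges {s(d.fst, d.snd)} with hN'
  have hstep : ∀ a b, (N ⊔ F).Adj a b → s(a, b) ≠ s(d.fst, d.snd) → (N' ⊔ F).Adj a b := by
    intro a b hab hne
    exact hab.imp (fun h => SimpleGraph.deleteEdges_adj.2 ⟨h, hne⟩) id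
  have hlt : N'.edgeSet.ncard < N.edgeSet.ncard := by
    refine Set.ncard_lt_ncard ⟨?_, fun hsub => ?_⟩ (Set.toFinite _)
    · rw [hN', SimpleGraph.edgeSet_deleteEdges]
      exact Set.sdiff_subset
    · have h1 := hsub (show s(d.fst, d.snd) ∈ N.edgeSet from hdN)
      rw [hN', SimpleGraph.edgeSet_deleteEdges] at h1
      exact h1.2 rfl
  refine absurd (hmin N' ⟨(SimpleGraph.deleteEdges_le _).trans hNG,
    fun v => if hit v then c v else x, Function.update π x q, fun y hy => ?_⟩) (not_le.2 hlt)
  by_cases hyx : y = x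
  · subst hyx
    rw [Function.update_self]
    refine ⟨hqU, Joins.trans (b := w) ?_ ?_⟩
    · refine ⟨((p x).takeUntil w hx).transfer (N' ⊔ F) ?_, fun v hv => ?_⟩
      · intro e he
        have h2 := SimpleGraph.Walk.edges_subset_edgeSet _ he
        induction e with
        | _ a b => exact hstep a b h2 fun h3 => hdtake (h3 ▸ he)
      · rw [SimpleGraph.Walk.support_transfer] at hv
        have hv' := (p x).support_takeUntil_subset_support hx hv
        have hvh : hit v := ⟨x, hv'⟩
        refine ⟨(if_pos hvh).trans (hpc x v hv').1, fun hvU => ?_⟩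
        exfalso
        rw [(hpc x v hv').2 hvU] at hv
        exact SimpleGraph.Walk.endpoint_notMem_support_takeUntil (hp x) hx hwπ hv
    · refine (hwq.le le_sup_right).mono ?_
      rintro v (⟨h1, h2⟩ | rfl | rfl)
      · exact ⟨if_neg h2, fun h => absurd h h1⟩
      · exact ⟨(if_pos ⟨x, hx⟩).trans (hpc x v hx).1, fun h => absurd h hwU⟩
      · exact ⟨if_neg (hUhit v hqU huq), fun _ => rfl⟩
  · rw [Function.update_of_ne hyx]
    refine ⟨(hN y hy).1, ?_⟩
    have h1 : Joins (N ⊔ F) {v | v ∈ (p ⟨y, hy⟩).support} y (π y) := ⟨p ⟨y, hy⟩, fun v hv => hv⟩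
    refine (h1.mono_graph fun a b hab ha hb => hstep a b hab fun he => hyx ?_).mono fun v hv => ?_
    · have h2 : d.fst ∈ (p ⟨y, hy⟩).support := by
        rcases Sym2.eq_iff.1 he with ⟨rfl, -⟩ | ⟨-, rfl⟩
        · exact ha
        · exact hb
      exact (hpc ⟨y, hy⟩ _ h2).1.symm.trans (hpc x _ hdx).1
    · exact ⟨(if_pos ⟨_, hv⟩).trans (hpc ⟨y, hy⟩ v hv).1, (hpc ⟨y, hy⟩ v hv).2⟩

end

/-! ### Linked monochromatic edges when all odd cycle covers are large -/

section

variable {V : Type*} {G : SimpleGraph V}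

theorem joins_univ_iff {u v : V} : Joins G Set.univ u v ↔ G.Reachable u v :=
  ⟨fun ⟨w, _⟩ => ⟨w⟩, fun ⟨w⟩ => ⟨w, fun _ _ => trivial⟩⟩

theorem disjointPaths_of_connected [Finite V] {T U : Finset V} {n : ℕ}
    (hconn : ∀ Y : Finset V, Y.card < n → ∀ a ∉ Y, ∀ b ∉ Y, Joins G {v | v ∉ Y} a b)
    (hTn : T.card ≤ n) (hTU : T.card ≤ U.card) : DisjointPaths G T U := by
  refine menger G T U fun Y hY => ?_
  by_contra! hlt
  obtain ⟨x, hx, hxY⟩ := Finset.exists_mem_notMem_of_card_lt_card hlt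
  obtain ⟨q, hq, hqY⟩ := Finset.exists_mem_notMem_of_card_lt_card (hlt.trans_le hTU)
  exact hY x hx q hq (hconn Y (hlt.trans_le hTn) x hxY q hqY)

/-- Elements in different components, if the components are small. -/
theorem exists_pairwise_not_joins (F : SimpleGraph V) {M : Finset V} {k : ℕ}
    (h2 : ∀ u ∈ M, (M.filter fun v => Joins F Set.univ u v).card ≤ 2) (hM : 2 * k ≤ M.card) :
    ∃ u : Fin k → V, (∀ i, u i ∈ M) ∧ ∀ i j, Joins F Set.univ (u i) (u j) → i = j := by
  have h1 : M.card ≤ 2 * (M.image F.connectedComponentMk).card := by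
    refine Finset.card_le_mul_card_image _ _ fun C hC => ?_
    obtain ⟨u, hu, rfl⟩ := Finset.mem_image.1 hC
    refine (Finset.card_le_card fun v hv => ?_).trans (h2 u hu)
    rw [Finset.mem_filter] at hv ⊢
    exact ⟨hv.1, joins_univ_iff.2 (SimpleGraph.ConnectedComponent.eq.1 hv.2.symm)⟩
  obtain ⟨φ⟩ := Function.Embedding.nonempty_of_card_le
    (α := Fin k) (β := M.image F.connectedComponentMk) (by
      rw [Fintype.card_fin, Fintype.card_coe]
      omega)
  have h3 : ∀ i, ∃ u ∈ M, F.connectedComponentMk u = φ i := fun i => Finset.mem_image.1 (φ i).2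
  choose u hu hφ using h3
  refine ⟨u, hu, fun i j hij => φ.injective (Subtype.ext ?_)⟩
  rw [← hφ, ← hφ]
  exact SimpleGraph.ConnectedComponent.eq.2 (joins_univ_iff.1 hij)

/-- Each of the at most `2 * k` paths from `T` to `U` spoils at most two of the `6 * k` elements of
`M`, by ending in their component. The remaining `2 * k` lie in at least `k` components, and each of
these contains a path of the wrong parity, whose last edge becomes monochromatic after recolouring.
-/
theorem exists_linked_breaking [Fintype V] {k : ℕ} (hk : 0 < k) (hV : 12 * k ≤ Fintype.card V)
    (hdeg : ∀ v, 50 * k ≤ dIn G Finset.univ v)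
    (hconn : ∀ Y : Finset V, Y.card < 50 * k → ∀ a ∉ Y, ∀ b ∉ Y, Joins G {v | v ∉ Y} a b)
    (hcov : ∀ (X : Finset V) (c : V → Bool), (∀ u ∉ X, ∀ v ∉ X, G.Adj u v → c u ≠ c v) →
      6 * k ≤ X.card) {T : Finset V} (hT : T.card ≤ 2 * k) :
    ∃ (χ : V → Bool) (a b : Fin k → V),
      (∀ i, G.Adj (a i) (b i) ∧ χ (a i) = χ (b i) ∧ a i ∉ T ∧ b i ∉ T) ∧
      (∀ i j, i ≠ j → a i ≠ a j ∧ a i ≠ b j ∧ b i ≠ b j) ∧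
      Linked (cut G χ) (T ∪ Finset.univ.image a ∪ Finset.univ.image b) := by
  obtain ⟨χ, U, hUc, hL⟩ := exists_linked_cut hk hdeg hV
  obtain ⟨F, M, hF, hMU, hMc, hM2, hM⟩ := exists_breaking_graph (G := G) (U := U) (χ := χ)
    (m := 6 * k) ⟨3 * k, by ring⟩ (by omega) (fun Y hY => hconn Y (by omega)) hcov
  obtain ⟨c, π, hit, hitU, hpaths, hmeet⟩ := exists_disjoint_paths_along hF
    (disjointPaths_of_connected (T := T) (U := U) hconn (by omega) (by omega))
  -- many components avoid the paths
  have hMhit : (M.filter fun u => ∃ v, hit v ∧ Joins F Set.univ u v).card ≤ T.card * 2 := by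
    refine le_trans (Finset.card_le_card ?_) (Finset.card_biUnion_le_card_mul T
      (fun x => M.filter fun u => Joins F Set.univ u (π x)) 2 fun x _ => ?_)
    · intro u hu
      obtain ⟨huM, v, hv, huv⟩ := Finset.mem_filter.1 hu
      obtain ⟨x, hx, hux⟩ := hmeet u (hMU huM) v hv huv
      exact Finset.mem_biUnion.2 ⟨x, hx, Finset.mem_filter.2 ⟨huM, hux⟩⟩
    · rcases (M.filter fun u => Joins F Set.univ u (π x)).eq_empty_or_nonempty with h0 | ⟨u, hu⟩
      · rw [h0]
        simp
      · rw [Finset.mem_filter] at hu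
        refine (Finset.card_le_card fun v hv => ?_).trans (hM2 u hu.1)
        rw [Finset.mem_filter] at hv ⊢
        exact ⟨hv.1, hu.2.trans hv.2.symm⟩
  have hsplit := Finset.card_filter_add_card_filter_not (s := M)
    (fun u => ∃ v, hit v ∧ Joins F Set.univ u v)
  obtain ⟨u, huM, hu⟩ := exists_pairwise_not_joins F (k := k)
    (M := M.filter fun u => ¬ ∃ v, hit v ∧ Joins F Set.univ u v)
    (fun u hu => (Finset.card_le_card (Finset.filter_subset_filter _
      (Finset.filter_subset _ _))).trans (hM2 u (Finset.mem_filter.1 hu).1)) (by omega)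
  simp only [Finset.mem_filter, not_exists, not_and] at huM
  choose κ a b hbU hbu hub hab hκa hκu hj using fun i => hM (u i) (huM i).1
  have hua : ∀ i, Joins F Set.univ (u i) (a i) := fun i => (hj i).left_mem.1
  have hane : ∀ i, a i ≠ b i := fun i => (hj i).left_mem.2.1
  have hidx : ∀ i j v, Joins F Set.univ (u i) v → Joins F Set.univ (u j) v → i = j :=
    fun i j v h1 h2 => hu i j (h1.trans h2.symm)
  have hnh : ∀ i v, Joins F Set.univ (u i) v → ¬ hit v := fun i v h1 h2 => (huM i).2 v h2 h1
  have hTh : ∀ x ∈ T, hit x := fun x hx => (hpaths x hx).2.left_mem.1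
  have haT : ∀ i, a i ∉ T := fun i h => hnh i _ (hua i) (hTh _ h)
  have hbT : ∀ i, b i ∉ T := fun i h => hnh i _ (hub i) (hTh _ h)
  -- The new paths start in `T`, in the `a i` (running along `F` to `u i`), and in the `b i`, which
  -- are in `U` already. Each vertex is labelled by the start of its path.
  set c' : V → V := fun v => if hit v then c v else
    if h : ∃ i, Joins F Set.univ (u i) v then (if v = b h.choose then v else a h.choose) else v
    with hc'
  have hc'1 : ∀ v, hit v → c' v = c v := fun v hv => if_pos hv
  have hc'2 : ∀ i v, Joins F Set.univ (u i) v → v ≠ b i → c' v = a i := by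
    intro i v hv hvb
    have hex : ∃ i, Joins F Set.univ (u i) v := ⟨i, hv⟩
    have heq : hex.choose = i := hidx _ _ v hex.choose_spec hv
    rw [hc']
    simp only [if_neg (hnh i v hv), dif_pos hex, heq, if_neg hvb]
  have hc'3 : ∀ i, c' (b i) = b i := by
    intro i
    have hex : ∃ j, Joins F Set.univ (u j) (b i) := ⟨i, hub i⟩
    have heq : hex.choose = i := hidx _ _ _ hex.choose_spec (hub i)
    rw [hc']
    simp only [if_neg (hnh i _ (hub i)), dif_pos hex, heq, if_pos]
  have hadist : ∀ i j, a i = a j → i = j := fun i j h => hidx i j _ (hua i) (h ▸ hua j)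
  have habdist : ∀ i j, a i = b j → i = j := fun i j h => hidx i j _ (hua i) (h ▸ hub j)
  obtain ⟨χ', hχU, hχ', hlink⟩ := exists_linked_recolouring
    (T := T ∪ Finset.univ.image a ∪ Finset.univ.image b) hL (by
      have h1 := Finset.card_union_le (T ∪ Finset.univ.image a) (Finset.univ.image b)
      have h2 := Finset.card_union_le T (Finset.univ.image a)
      have h3 := Finset.card_image_le (s := (Finset.univ : Finset (Fin k))) (f := a)
      have h4 := Finset.card_image_le (s := (Finset.univ : Finset (Fin k))) (f := b)
      rw [Finset.card_fin] at h3 h4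
      omega) c' (fun x β => ∀ i, x = a i → β = χ (b i)) (by
      intro x hx
      simp only [Finset.mem_union, Finset.mem_image, Finset.mem_univ, true_and] at hx
      rcases hx with (hx | ⟨i, rfl⟩) | ⟨i, rfl⟩
      · obtain ⟨κ, h1, h2⟩ := (hpaths x hx).2.exists_colouring (χ (π x))
        refine ⟨κ, π x, (hpaths x hx).1, h1, fun i hi => absurd hx (hi ▸ haT i), h2.mono ?_⟩
        rintro v ⟨h3, h4, h5⟩
        exact ⟨(hc'1 v h3).trans h4, h5⟩
      · refine ⟨κ i, u i, hMU (huM i).1, hκu i, fun j hj => ?_, (hj i).mono ?_⟩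
        · rw [← hadist i j hj, hκa]
        · rintro v ⟨h1, h2, h3⟩
          exact ⟨hc'2 i v h1 h2, h3⟩
      · refine ⟨χ, b i, hbU i, rfl, fun j hj => ?_, .refl ⟨hc'3 i, fun _ => rfl⟩⟩
        rw [habdist j i hj.symm])
  refine ⟨χ', a, b, fun i => ⟨hab i, ?_, haT i, hbT i⟩, fun i j hij => ⟨fun h => hij (hadist i j h),
    fun h => hij (habdist i j h), fun h => hij (hidx i j _ (hub i) (h ▸ hub j))⟩, hlink⟩
  rw [hχ' (a i) (by simp) i rfl, hχU _ (hbU i)]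

end

/-! ### Linked cuts in the presence of a small odd cycle cover -/

section

variable {V : Type*} {G : SimpleGraph V} [Fintype V]

/-- A highly connected graph that is bipartite up to few vertices has a highly linked bipartite
subgraph. -/
theorem linked_restr_cut {k : ℕ} (hdeg : ∀ v, 50 * k ≤ dIn G Finset.univ v)
    (hconn : ∀ Y : Finset V, Y.card < 50 * k → ∀ a ∉ Y, ∀ b ∉ Y, Joins G {v | v ∉ Y} a b)
    {X₀ U : Finset V} (hX₀ : X₀.card < 6 * k) (hU : ∀ v, v ∈ U ↔ v ∉ X₀) {χ : V → Bool}
    (hχ : ∀ u ∉ X₀, ∀ v ∉ X₀, G.Adj u v → χ u ≠ χ v) (hUc : 4 * k < U.card) {X : Finset V}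
    (hXU : X ⊆ U) (hX : X.card ≤ 4 * k) : Linked (restr (cut G χ) U) X := by
  obtain ⟨X', hXX', hX'U, hX'⟩ := Finset.exists_subsuperset_card_eq hXU hX hUc.le
  refine Linked.subset (X := X') ?_ hXX'
  set B := restr (cut G χ) U with hB
  have hBadj : ∀ u ∈ U, ∀ v ∈ U, G.Adj u v → B.Adj u v := fun u hu v hv huv =>
    ⟨⟨huv, hχ u ((hU u).1 hu) v ((hU v).1 hv) huv⟩, hu, hv⟩
  refine Massed.linked (W := U) (K := 2 * k) ⟨fun u v huv => huv.2.1, hX'U, ?_, ?_⟩ (by omega)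
  · have h1 := sum_dIn_le B (U \ X')
    -- A vertex outside the cover loses fewer than `6 * k` of its `50 * k` neighbours, so about `22
    -- * k` edges per vertex remain, well above the `12 * k` required for `4 * k` roots.
    have h2 : ∑ _v ∈ U \ X', 44 * k ≤ ∑ v ∈ U \ X', dIn B Finset.univ v := by
      refine Finset.sum_le_sum fun v hv => ?_
      have hvU := (Finset.mem_sdiff.1 hv).1
      have h3 : Finset.univ.filter (G.Adj v) ⊆ Finset.univ.filter (B.Adj v) ∪ X₀ := by
        intro w hw
        rw [Finset.mem_filter] at hw
        by_cases hwX : w ∈ X₀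
        · exact Finset.mem_union_right _ hwX
        · exact Finset.mem_union_left _ (Finset.mem_filter.2 ⟨hw.1,
            hBadj v hvU w ((hU w).2 hwX) hw.2⟩)
      have h4 := (Finset.card_le_card h3).trans (Finset.card_union_le _ _)
      have h5 := hdeg v
      rw [dIn] at h5 ⊢
      omega
    rw [Finset.sum_const, smul_eq_mul] at h2
    have h3 := Finset.card_sdiff_add_card_eq_card hX'U
    nlinarith
  · intro Y hY hlt
    rcases Y.eq_empty_or_nonempty with rfl | ⟨y, hy⟩
    · simp [touch]
    exfalso
    obtain ⟨x, hx, hxZ⟩ := Finset.exists_mem_notMem_of_card_lt_card hlt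
    have hxY : x ∉ Y := fun h => (Finset.mem_sdiff.1 (hY h)).2 hx
    have hYU : Y ⊆ U := hY.trans Finset.sdiff_subset
    -- The boundary together with the cover has fewer than `10 * k` vertices and cannot separate
    -- `G`, so small separators have nothing behind them.
    have h1 := Finset.card_union_le X₀ (bd B Y)
    obtain ⟨p, q, hpq, hp, hq, -, hqP⟩ := (hconn (X₀ ∪ bd B Y) (by omega) y (by
        rw [Finset.mem_union, not_or]
        exact ⟨(hU y).1 (hYU hy), fun h => (mem_bd.1 h).1 hy⟩) x (by
        rw [Finset.mem_union, not_or]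
        exact ⟨(hU x).1 (hX'U hx), hxZ⟩)).exists_exit (A := {v | v ∈ Y}) hy hxY
    simp only [Finset.mem_union, not_or] at hqP
    exact hqP.2 (mem_bd.2 ⟨hq, p, hp, hBadj p (hYU hp) q ((hU q).2 hqP.1) hpq⟩)

theorem linked_cut {k : ℕ} (hV : 50 * k < Fintype.card V)
    (hdeg : ∀ v, 50 * k ≤ dIn G Finset.univ v)
    (hconn : ∀ Y : Finset V, Y.card < 50 * k → ∀ a ∉ Y, ∀ b ∉ Y, Joins G {v | v ∉ Y} a b)
    {X₀ U : Finset V} (hX₀ : X₀.card < 6 * k) (hU : ∀ v, v ∈ U ↔ v ∉ X₀) {χ : V → Bool}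
    (hχ : ∀ u ∉ X₀, ∀ v ∉ X₀, G.Adj u v → χ u ≠ χ v)
    (hχ' : ∀ x ∈ X₀, dIn G U x ≤ 2 * dIn (cut G χ) U x) {T : Finset V} (hT : T.card ≤ 4 * k) :
    Linked (cut G χ) T := by
  have hUeq : Finset.univ \ X₀ = U := by
    ext v
    simp [hU]
  have hUc := Finset.card_sdiff_add_card_eq_card (Finset.subset_univ X₀)
  rw [hUeq, Finset.card_univ] at hUc
  have hpaths : DisjointPaths (cut G χ) T U := by
    refine menger _ T U fun Y hY => ?_
    by_contra! hlt
    obtain ⟨x, hx, hxY⟩ := Finset.exists_mem_notMem_of_card_lt_card hlt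
    by_cases hxU : x ∈ U
    · exact hY x hx x hxU (.refl hxY)
    · have hxX : x ∈ X₀ := by
        by_contra h
        exact hxU ((hU x).2 h)
      have h1 := hχ' x hxX
      have h2 := hdeg x
      have h3 : Finset.univ.filter (G.Adj x) ⊆ U.filter (G.Adj x) ∪ X₀ := by
        intro w hw
        rw [Finset.mem_filter] at hw
        by_cases hwX : w ∈ X₀
        · exact Finset.mem_union_right _ hwX
        · exact Finset.mem_union_left _ (Finset.mem_filter.2 ⟨(hU w).2 hwX, hw.2⟩)
      have h4 := (Finset.card_le_card h3).trans (Finset.card_union_le _ _)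
      -- More than half of `44 * k` neighbours lie across the cut, so a set with fewer than `4 * k`
      -- vertices cannot cut `x` off from `U`.
      obtain ⟨q, hq, hxq, hqY⟩ := exists_adj_of_dIn (G := cut G χ) (C := U) (x := x) Y (by
        rw [dIn] at h1 h2
        omega)
      exact hY x hx q hq (.of_adj hxq hxY hqY)
  obtain ⟨c, π, h⟩ := hpaths
  refine Linked.of_paths h (linked_restr_cut hdeg hconn hX₀ hU hχ (by omega) ?_
    (Finset.card_image_le.trans hT))
  intro v hv
  obtain ⟨x, hx, rfl⟩ := Finset.mem_image.1 hv
  exact (h x hx).1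

end

/-! ### Paths of prescribed parity -/

section

variable {V : Type*} {G : SimpleGraph V}

/-- Disjoint pairs of elements of a linked set can be joined by disjoint connected sets. -/
theorem Linked.exists_disjoint [Finite V] {X : Finset V} (h : Linked G X) {ι : Type*} [Finite ι]
    {x y : ι → V} (hx : ∀ i, x i ∈ X) (hy : ∀ i, y i ∈ X)
    (hdis : ∀ i j, i ≠ j → x i ≠ x j ∧ x i ≠ y j ∧ y i ≠ y j) :
    ∃ C : ι → Set V, (∀ i j v, v ∈ C i → v ∈ C j → i = j) ∧ ∀ i, Joins G (C i) (x i) (y i) := by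
  obtain ⟨e, he⟩ := Countable.exists_injective_nat ι
  have huniq : ∀ v i j, (v = x i ∨ v = y i) → (v = x j ∨ v = y j) → i = j := by
    intro v i j hi hj
    by_contra hij
    have h1 := hdis i j hij
    have h2 := hdis j i (Ne.symm hij)
    rcases hi with rfl | rfl <;> rcases hj with hj | hj
    · exact h1.1 hj
    · exact h1.2.1 hj
    · exact h2.2.1 hj.symm
    · exact h1.2.2 hj
  set l : V → ℕ := fun v => if h : ∃ i, v = x i ∨ v = y i then e h.choose else 0 with hl
  have hl' : ∀ v i, (v = x i ∨ v = y i) → l v = e i := by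
    intro v i hv
    have hex : ∃ i, v = x i ∨ v = y i := ⟨i, hv⟩
    rw [hl]
    simp only [dif_pos hex, huniq v _ i hex.choose_spec hv]
  obtain ⟨c, -, hc⟩ := h.subset (Y := X.filter fun v => ∃ i, v = x i ∨ v = y i)
    (Finset.filter_subset _ _) l (fun n => by
      by_cases hex : ∃ i, e i = n
      · obtain ⟨i, rfl⟩ := hex
        refine le_trans (Finset.card_le_card fun v hv => ?_) (Finset.card_le_two (a := x i) (b := y i))
        rw [Finset.mem_filter, Finset.mem_filter] at hv
        obtain ⟨⟨-, j, hj⟩, hv⟩ := hv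
        rw [hl' v j hj] at hv
        rw [← he hv]
        simpa using hj
      · rw [Finset.card_eq_zero.2]
        · exact Nat.zero_le _
        · refine Finset.filter_eq_empty_iff.2 fun v hv hvn => hex ?_
          obtain ⟨-, j, hj⟩ := Finset.mem_filter.1 hv
          exact ⟨j, (hl' v j hj).symm.trans hvn⟩)
  refine ⟨fun i => {v | c v = e i}, fun i j v hi hj => he (hi.symm.trans hj), fun i => ?_⟩
  have := hc (x i) (Finset.mem_filter.2 ⟨hx i, i, Or.inl rfl⟩) (y i)
    (Finset.mem_filter.2 ⟨hy i, i, Or.inr rfl⟩) (by rw [hl' _ i (Or.inl rfl), hl' _ i (Or.inr rfl)])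
  rwa [hl' _ i (Or.inl rfl)] at this

theorem odd_length_iff {χ : V → Bool} {u v : V} (w : G.Walk u v)
    (h : ∀ d ∈ w.darts, χ d.fst ≠ χ d.snd) : Odd w.length ↔ χ u ≠ χ v := by
  induction w with
  | nil => simp
  | @cons u v w hadj p ih =>
    have h1 := h ⟨(u, v), hadj⟩ (by simp)
    have h2 := ih fun d hd => h d (by simp [hd])
    rw [SimpleGraph.Walk.length_cons, Nat.odd_add_one, h2]
    simp only at h1
    revert h1
    cases χ u <;> cases χ v <;> cases χ w <;> simp

theorem Joins.exists_path {χ : V → Bool} {P : Set V} {u v : V} (h : Joins (cut G χ) P u v) :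
    ∃ p : G.Walk u v, p.IsPath ∧ (∀ x ∈ p.support, x ∈ P) ∧ (Odd p.length ↔ χ u ≠ χ v) := by
  obtain ⟨w, hw⟩ := h
  refine ⟨(w.toPath : (cut G χ).Walk u v).mapLe (cut_le G χ), ?_, fun x hx => ?_, ?_⟩
  · exact (SimpleGraph.Walk.isPath_mapLe _).2 w.toPath.2
  · rw [SimpleGraph.Walk.support_mapLe_eq_support] at hx
    exact hw x (w.support_toPath_subset_support hx)
  · rw [SimpleGraph.Walk.length_map]
    exact odd_length_iff _ fun d _ => d.adj.2

/-- Two disjoint paths of a bipartite subgraph and an edge joining them. -/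
theorem Joins.exists_path_append {χ : V → Bool} {P Q : Set V} {s a b t : V}
    (h : Joins (cut G χ) P s a) (h' : Joins (cut G χ) Q b t) (hab : G.Adj a b) (hχ : χ a = χ b)
    (hPQ : ∀ v ∈ P, v ∉ Q) :
    ∃ p : G.Walk s t, p.IsPath ∧ (∀ x ∈ p.support, x ∈ P ∨ x ∈ Q) ∧
      (Odd p.length ↔ χ s = χ t) := by
  obtain ⟨p, hp, hpP, hpl⟩ := h.exists_path
  obtain ⟨q, hq, hqQ, hql⟩ := h'.exists_path
  have hsupp : (p.append (.cons hab q)).support = p.support ++ q.support := by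
    rw [SimpleGraph.Walk.support_append]
    simp
  refine ⟨p.append (.cons hab q), ?_, fun x hx => ?_, ?_⟩
  · rw [SimpleGraph.Walk.isPath_def, hsupp, List.nodup_append']
    exact ⟨hp.support_nodup, hq.support_nodup, fun x hx hx' => hPQ x (hpP x hx) (hqQ x hx')⟩
  · rw [hsupp, List.mem_append] at hx
    exact hx.imp (hpP x) (hqQ x)
  · rw [SimpleGraph.Walk.length_append, SimpleGraph.Walk.length_cons, ← add_assoc, Nat.odd_add_one,
      Nat.odd_add, hpl, ← Nat.not_odd_iff_even, hql, hχ]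
    cases χ s <;> cases χ b <;> cases χ t <;> simp

/-- Disjoint paths of prescribed parities from disjoint paths of a bipartite subgraph and
monochromatic edges. -/
theorem exists_parity_paths [Finite V] {k : ℕ} (S : TerminalPairs V k) (O : Set (Fin k))
    {χ : V → Bool} {a b : Fin k → V} (hab : ∀ i, G.Adj (a i) (b i)) (hχ : ∀ i, χ (a i) = χ (b i))
    (hS : ∀ i j, i ≠ j → a i ≠ S.s j ∧ a i ≠ S.t j ∧ b i ≠ S.s j ∧ b i ≠ S.t j)
    (hdis : ∀ i j, i ≠ j → a i ≠ a j ∧ a i ≠ b j ∧ b i ≠ b j) {T : Finset V}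
    (hT : ∀ i, S.s i ∈ T ∧ S.t i ∈ T ∧ a i ∈ T ∧ b i ∈ T) (hL : Linked (cut G χ) T) :
    ∃ P : ∀ i, G.Walk (S.s i) (S.t i), (∀ i, (P i).IsPath) ∧
      (∀ i j, i ≠ j → ∀ v, v ∈ (P i).support → v ∉ (P j).support) ∧
      ∀ i, Odd (P i).length ↔ i ∈ O := by
  -- The edges are oriented so that `a i` can be joined to `S.s i` and `b i` to `S.t i`. The cases
  -- `a i = S.s i` and `b i = S.t i` remain possible and give trivial paths.
  wlog hor : ∀ i, a i ≠ S.t i ∧ b i ≠ S.s i generalizing a b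
  · refine this (a := fun i => if a i = S.t i ∨ b i = S.s i then b i else a i)
      (b := fun i => if a i = S.t i ∨ b i = S.s i then a i else b i) ?_ ?_ ?_ ?_ ?_ ?_
    · intro i
      split_ifs
      · exact (hab i).symm
      · exact hab i
    · intro i
      split_ifs
      · exact (hχ i).symm
      · exact hχ i
    · intro i j hij
      have := hS i j hij
      split_ifs <;> tauto
    · intro i j hij
      have h1 := hdis i j hij
      have h2 := hdis j i hij.symm
      refine ⟨?_, ?_, ?_⟩ <;> split_ifs <;> tauto
    · intro i
      have := hT i
      split_ifs <;> tauto
    · intro i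
      have h1 := (hab i).ne
      have h2 := S.s_ne_t i i
      split_ifs with h
      · rcases h with h | h
        · rw [h] at h1 ⊢
          exact ⟨h1.symm, h2.symm⟩
        · rw [h] at h1 ⊢
          exact ⟨h2, h1⟩
      · tauto
  -- The pairs for which a path in the cut has the wrong parity; only these are routed through their
  -- monochromatic edge, by two paths instead of one.
  set bad : Fin k → Prop := fun i => ¬ (i ∈ O ↔ χ (S.s i) ≠ χ (S.t i)) with hbad
  have hst : ∀ i j, S.s i ≠ S.t j := S.s_ne_t
  have hss : ∀ i j, i ≠ j → S.s i ≠ S.s j := fun i j h h' => h (S.s_injective h')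
  have htt : ∀ i j, i ≠ j → S.t i ≠ S.t j := fun i j h h' => h (S.t_injective h')
  obtain ⟨C, hC, hCj⟩ := hL.exists_disjoint (ι := Fin k ⊕ {i // bad i})
    (x := Sum.elim S.s fun i => b i) (y := Sum.elim (fun i => if bad i then a i else S.t i)
      fun i => S.t i) (by
      rintro (i | i)
      · exact (hT i).1
      · exact (hT i).2.2.2) (by
      rintro (i | i)
      · simp only [Sum.elim_inl]
        split_ifs
        · exact (hT i).2.2.1
        · exact (hT i).2.1
      · exact (hT i).2.1) (by
      rintro (i | ⟨i, hi⟩) (j | ⟨j, hj⟩) hij <;> simp only [Sum.elim_inl, Sum.elim_inr]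
      · have hij' : i ≠ j := fun h => hij (by rw [h])
        refine ⟨hss i j hij', ?_, ?_⟩
        · split_ifs
          · exact (hS j i hij'.symm).1.symm
          · exact hst i j
        · split_ifs
          · exact (hdis i j hij').1
          · exact (hS i j hij').2.1
          · exact (hS j i hij'.symm).2.1.symm
          · exact htt i j hij'
      · by_cases hij' : i = j
        · subst hij'
          rw [if_pos hj]
          exact ⟨(hor i).2.symm, hst i i, (hor i).1⟩
        · refine ⟨(hS j i (Ne.symm hij')).2.2.1.symm, hst i j, ?_⟩
          split_ifs
          · exact (hS i j hij').2.1
          · exact htt i j hij'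
      · by_cases hij' : i = j
        · subst hij'
          rw [if_pos hi]
          exact ⟨(hor i).2, (hab i).ne.symm, (hor i).1.symm⟩
        · refine ⟨(hS i j hij').2.2.1, ?_, ?_⟩
          · split_ifs
            · exact (hdis j i (Ne.symm hij')).2.1.symm
            · exact (hS i j hij').2.2.2
          · split_ifs
            · exact (hS j i (Ne.symm hij')).2.1.symm
            · exact htt i j hij'
      · have hij' : i ≠ j := fun h => hij (by subst h; rfl)
        exact ⟨(hdis i j hij').2.2, (hS i j hij').2.2.2, htt i j hij'⟩)
  have hex : ∀ i, ∃ p : G.Walk (S.s i) (S.t i), p.IsPath ∧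
      (∀ v ∈ p.support, v ∈ C (.inl i) ∨ ∃ h : bad i, v ∈ C (.inr ⟨i, h⟩)) ∧
      (Odd p.length ↔ i ∈ O) := by
    intro i
    have h1 := hCj (.inl i)
    simp only [Sum.elim_inl] at h1
    by_cases hi : bad i
    · rw [if_pos hi] at h1
      obtain ⟨p, hp, hpC, hpl⟩ := h1.exists_path_append (hCj (.inr ⟨i, hi⟩)) (hab i) (hχ i)
        fun v hv hv' => by simpa using hC _ _ v hv hv'
      refine ⟨p, hp, fun v hv => (hpC v hv).imp id fun h => ⟨hi, h⟩, ?_⟩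
      simp only [Sum.elim_inr] at hpl
      simp only [hbad] at hi
      tauto
    · rw [if_neg hi] at h1
      obtain ⟨p, hp, hpC, hpl⟩ := h1.exists_path
      exact ⟨p, hp, fun v hv => Or.inl (hpC v hv), hpl.trans (not_not.1 hi).symm⟩
  choose P hP hPC hPO using hex
  refine ⟨P, hP, fun i j hij v hi hj => hij ?_, hPO⟩
  rcases hPC i v hi with h1 | ⟨hi', h1⟩ <;> rcases hPC j v hj with h2 | ⟨hj', h2⟩ <;>
    simpa using hC _ _ v h1 h2

end

/-! ### Connectivity, nice partitions, and the two directions of the theorem -/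

section

variable {V : Type*} {G : SimpleGraph V}

theorem IsVertexConnected.joins {n : ℕ} (hG : IsVertexConnected G n) {Y : Finset V}
    (hY : Y.card < n) {a b : V} (ha : a ∉ Y) (hb : b ∉ Y) : Joins G {v | v ∉ Y} a b := by
  obtain ⟨w⟩ := (hG.2 Y (by rwa [Set.ncard_coe_finset])).preconnected ⟨a, by simpa using ha⟩
    ⟨b, by simpa using hb⟩
  refine ⟨w.map (SimpleGraph.Embedding.induce _).toHom, fun v hv => ?_⟩
  obtain ⟨x, -, rfl⟩ := List.mem_map.1 ((SimpleGraph.Walk.support_map _ w) ▸ hv)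
  simp

/-- A vertex of smaller degree would be separated from the rest by its neighbours. -/
theorem IsVertexConnected.le_dIn [Fintype V] {n : ℕ} (hG : IsVertexConnected G n) (v : V) :
    n ≤ dIn G Finset.univ v := by
  by_contra! hlt
  have h1 : (insert v (Finset.univ.filter (G.Adj v))).card < (Finset.univ : Finset V).card := by
    have h2 := Finset.card_insert_le v (Finset.univ.filter (G.Adj v))
    have h3 := hG.1
    rw [Nat.card_eq_fintype_card] at h3
    rw [Finset.card_univ]
    rw [dIn] at hlt
    omega
  obtain ⟨w, -, hw⟩ := Finset.exists_mem_notMem_of_card_lt_card h1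
  rw [Finset.mem_insert, not_or] at hw
  obtain ⟨p, q, hpq, hp, -, -, hq⟩ := (hG.joins hlt (a := v) (b := w) (by simp) hw.2).exists_exit
    (A := {x | x = v}) rfl hw.1
  simp only [Set.mem_ofPred_eq] at hp
  subst hp
  exact hq (by simpa using hpq)

theorem isOddCycleCover_of_colouring {X : Set V} (c : V → Bool)
    (hc : ∀ u ∉ X, ∀ v ∉ X, G.Adj u v → c u ≠ c v) : IsOddCycleCover G X := by
  refine ⟨fun v => if c v then 0 else 1, fun {u v} huv => ?_⟩
  have := hc u u.2 v v.2 huv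
  cases h1 : c u <;> cases h2 : c v <;> simp_all

theorem exists_isNicePartition (G : SimpleGraph V) [Finite V] : ∃ A B, IsNicePartition G A B := by
  obtain ⟨X, hX, hmin⟩ := exists_argmin (P := IsOddCycleCover G) Set.ncard ⟨Set.univ,
    isOddCycleCover_of_colouring (fun _ => true) fun u hu => absurd (Set.mem_univ u) hu⟩
  obtain ⟨c⟩ := hX
  set A₀ : Set V := {v | ∃ h : v ∉ X, c ⟨v, h⟩ = 0} with hA₀
  set B₀ : Set V := {v | ∃ h : v ∉ X, c ⟨v, h⟩ ≠ 0} with hB₀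
  -- Vertices of the cover go to the side opposite to the majority of their neighbours outside the
  -- cover; ties end up in the complement, which is allowed.
  set A : Set V := A₀ ∪ {v | v ∈ X ∧ degreeInto G v A₀ < degreeInto G v B₀} with hA
  have h1 : A \ X = A₀ := by
    ext v
    constructor
    · rintro ⟨h | h, hv⟩
      · exact h
      · exact absurd h.1 hv
    · exact fun h => ⟨Or.inl h, h.1⟩
  have h2 : Aᶜ \ X = B₀ := by
    ext v
    constructor
    · rintro ⟨h, hv⟩
      exact ⟨hv, fun h' => h (Or.inl ⟨hv, h'⟩)⟩
    · rintro ⟨hv, h⟩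
      refine ⟨?_, hv⟩
      rintro (⟨_, h'⟩ | h')
      · exact h h'
      · exact hv h'.1
  refine ⟨A, Aᶜ, ⟨disjoint_compl_right, Set.union_compl_self A⟩, X, ⟨⟨c⟩, hmin⟩, ?_⟩
  rw [h1, h2]
  refine ⟨?_, fun v hv h => Or.inr ⟨hv, h⟩, fun v hv h => ?_⟩
  · rw [eq_bot_iff]
    rintro u v ⟨huv, ⟨⟨hu, hu'⟩, hv, hv'⟩ | ⟨⟨hu, hu'⟩, hv, hv'⟩⟩
    · exact c.valid (v := ⟨u, hu⟩) (w := ⟨v, hv⟩) huv (hu'.trans hv'.symm)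
    · exact c.valid (v := ⟨u, hu⟩) (w := ⟨v, hv⟩) huv (by omega)
  · rintro (h' | h')
    · exact h'.choose hv
    · exact lt_asymm h h'.2

/-- Paths of the wrong parity contain parity breaking edges. -/
theorem IsParityLinked.exists_matching {k : ℕ} (h : IsParityLinked G k) (S : TerminalPairs V k)
    {A B : Set V} (hAB : IsPartition A B) : ∃ m, IsParityBreakingMatching G A B S m := by
  -- Odd length is prescribed exactly for pairs on the same side, so no path can alternate between
  -- the two sides all the way.
  obtain ⟨P, -, hdis, hP⟩ := h S {i | S.s i ∈ A ↔ S.t i ∈ A}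
  have hex : ∀ i, ∃ d ∈ (P i).darts, (d.fst ∈ A ↔ d.snd ∈ A) := by
    intro i
    by_contra! hcon
    have h1 := odd_length_iff (χ := fun v => decide (v ∈ A)) (P i) fun d hd => by
      have := hcon d hd
      simp only [ne_eq, decide_eq_decide]
      tauto
    rw [hP i] at h1
    simp only [Set.mem_ofPred_eq, ne_eq, decide_eq_decide] at h1
    tauto
  choose d hd hdA using hex
  have hsupp : ∀ i v, v ∈ (d i).edge → v ∈ (P i).support := by
    intro i v hv
    rcases Sym2.mem_iff.1 hv with rfl | rfl
    · exact (P i).dart_fst_mem_support_of_mem_darts (hd i)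
    · exact (P i).dart_snd_mem_support_of_mem_darts (hd i)
  refine ⟨fun i => (d i).edge, fun i => ⟨(d i).adj, ?_⟩, fun i j hij v hi hj =>
    hdis i j hij v (hsupp i v hi) (hsupp j v hj), fun i j hij => ⟨fun hi =>
    hdis i j hij _ (hsupp i _ hi) (P j).start_mem_support, fun hi =>
    hdis i j hij _ (hsupp i _ hi) (P j).end_mem_support⟩⟩
  have hB : ∀ v, v ∉ A → v ∈ B := fun v hv =>
    ((Set.ext_iff.1 hAB.2 v).2 trivial).resolve_left hv
  by_cases h1 : (d i).fst ∈ A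
  · exact Or.inl ⟨h1, (hdA i).1 h1⟩
  · exact Or.inr ⟨hB _ h1, hB _ fun h2 => h1 ((hdA i).2 h2)⟩

/-- Membership in `A` serves as the colouring. Its cut is proper outside the cover, and the majority
condition of a nice partition guarantees that vertices of the cover have at least half of their
outside neighbours across the cut. -/
theorem exists_parity_paths_of_nice [Fintype V] {k : ℕ} (hG : IsVertexConnected G (50 * k))
    {A B : Set V} (hAB : IsPartition A B) {X : Set V} (hX : X.ncard < 6 * k)
    (hbot : insideGraph G (A \ X) (B \ X) = ⊥)
    (hA : ∀ v ∈ X, degreeInto G v (A \ X) < degreeInto G v (B \ X) → v ∈ A)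
    (hB : ∀ v ∈ X, degreeInto G v (B \ X) < degreeInto G v (A \ X) → v ∈ B)
    (S : TerminalPairs V k) (O : Set (Fin k)) {m : Fin k → Sym2 V}
    (hm : IsParityBreakingMatching G A B S m) :
    ∃ P : ∀ i, G.Walk (S.s i) (S.t i), (∀ i, (P i).IsPath) ∧
      (∀ i j, i ≠ j → ∀ v, v ∈ (P i).support → v ∉ (P j).support) ∧
      ∀ i, Odd (P i).length ↔ i ∈ O := by
  have hBA : ∀ v, v ∈ B ↔ v ∉ A := fun v => ⟨fun h h' => Set.disjoint_left.1 hAB.1 h' h,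
    fun h => ((Set.ext_iff.1 hAB.2 v).2 trivial).resolve_left h⟩
  set χ : V → Bool := fun v => decide (v ∈ A) with hχ
  have hdeg : ∀ (U : Finset V) (Z : Set V) (H : SimpleGraph V) (v : V),
      (∀ w, (w ∈ U ∧ H.Adj v w) ↔ (G.Adj v w ∧ w ∈ Z)) → dIn H U v = degreeInto G v Z := by
    intro U Z H v h
    rw [dIn, degreeInto, ← Set.ncard_coe_finset]
    congr 1
    ext w
    simpa using h w
  set U : Finset V := Finset.univ.filter fun v => v ∉ X with hU
  have hUX : ∀ v, v ∈ U ↔ v ∉ X := fun v => by simp [hU]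
  have hsplit : ∀ v, dIn G U v = degreeInto G v (A \ X) + degreeInto G v (B \ X) := by
    intro v
    rw [hdeg U (A \ X ∪ B \ X) G v]
    · rw [degreeInto, Set.inter_union_distrib_left, Set.ncard_union_eq]
      · rfl
      · exact (hAB.1.mono (Set.inter_subset_right.trans Set.sdiff_subset)
          (Set.inter_subset_right.trans Set.sdiff_subset))
    · intro w
      have := hUX w
      simp only [Set.mem_union, Set.mem_sdiff, hBA w]
      tauto
  have hcutA : ∀ v, v ∈ A → dIn (cut G χ) U v = degreeInto G v (B \ X) := fun v hv =>
    hdeg _ _ _ v fun w => by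
      simp only [hUX, cut_adj, hχ, Set.mem_sdiff, hBA w, hv, ne_eq, decide_eq_decide]
      tauto
  have hcutB : ∀ v, v ∉ A → dIn (cut G χ) U v = degreeInto G v (A \ X) := fun v hv =>
    hdeg _ _ _ v fun w => by
      simp only [hUX, cut_adj, hχ, Set.mem_sdiff, hv, ne_eq, decide_eq_decide]
      tauto
  choose a b hab using fun i => Sym2.exists.1 ⟨m i, rfl⟩
  have hmem : ∀ i v, v ∈ m i ↔ v = a i ∨ v = b i := fun i v => by rw [hab i, Sym2.mem_iff]
  have hin : ∀ i, (insideGraph G A B).Adj (a i) (b i) := fun i => by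
    have := hm.1 i
    rwa [hab i, SimpleGraph.mem_edgeSet] at this
  have hcol : ∀ i, χ (a i) = χ (b i) := fun i => by
    have h := (hin i).2
    simp only [hBA] at h
    simp only [hχ, decide_eq_decide]
    tauto
  set T : Finset V := Finset.univ.image S.s ∪ Finset.univ.image S.t ∪
    (Finset.univ.image a ∪ Finset.univ.image b) with hT
  have hTcard : T.card ≤ 4 * k := by
    have h1 : ∀ g : Fin k → V, (Finset.univ.image g).card ≤ k := fun g =>
      Finset.card_image_le.trans_eq (Finset.card_fin k)
    have h2 := Finset.card_union_le (Finset.univ.image S.s ∪ Finset.univ.image S.t)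
      (Finset.univ.image a ∪ Finset.univ.image b)
    have h3 := Finset.card_union_le (Finset.univ.image S.s) (Finset.univ.image S.t)
    rw [← hT] at h2
    have h4 := Finset.card_union_le (Finset.univ.image a) (Finset.univ.image b)
    have := h1 S.s
    have := h1 S.t
    have := h1 a
    have := h1 b
    omega
  refine exists_parity_paths S O (fun i => (hin i).1) hcol (fun i j hij => ?_) (fun i j hij => ?_)
    (T := T) (fun i => by simp [hT]) (linked_cut (X₀ := X.toFinset) (U := U) ?_ hG.le_dIn
    (fun Y hY a ha b hb => hG.joins hY ha hb) ?_ (by simpa using hUX) ?_ ?_ hTcard)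
  · have h1 := hm.2.2 i j hij
    simp only [hmem, not_or] at h1
    exact ⟨Ne.symm h1.1.1, Ne.symm h1.2.1, Ne.symm h1.1.2, Ne.symm h1.2.2⟩
  · have h1 := hm.2.1 i j hij
    simp only [hmem, not_or] at h1
    exact ⟨(h1 _ (Or.inl rfl)).1, (h1 _ (Or.inl rfl)).2, (h1 _ (Or.inr rfl)).2⟩
  · rw [← Nat.card_eq_fintype_card]
    exact hG.1
  · rwa [← Set.ncard_eq_toFinset_card']
  · intro u hu v hv huv hc
    rw [Set.mem_toFinset] at hu hv
    have h1 : ¬ (insideGraph G (A \ X) (B \ X)).Adj u v := by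
      rw [hbot]
      exact id
    simp only [hχ, decide_eq_decide] at hc
    refine h1 ⟨huv, ?_⟩
    simp only [Set.mem_sdiff, hBA]
    tauto
  · intro x hx
    rw [Set.mem_toFinset] at hx
    rw [hsplit x]
    by_cases hxA : x ∈ A
    · rw [hcutA x hxA]
      have := mt (hB x hx) (fun h => (hBA x).1 h hxA)
      omega
    · rw [hcutB x hxA]
      have := mt (hA x hx) hxA
      omega

theorem exists_parity_paths_of_large_cover [Fintype V] {k : ℕ} (hk : 0 < k)
    (hG : IsVertexConnected G (50 * k))
    (hcov : ∀ (X : Finset V) (c : V → Bool), (∀ u ∉ X, ∀ v ∉ X, G.Adj u v → c u ≠ c v) →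
      6 * k ≤ X.card) (S : TerminalPairs V k) (O : Set (Fin k)) :
    ∃ P : ∀ i, G.Walk (S.s i) (S.t i), (∀ i, (P i).IsPath) ∧
      (∀ i j, i ≠ j → ∀ v, v ∈ (P i).support → v ∉ (P j).support) ∧
      ∀ i, Odd (P i).length ↔ i ∈ O := by
  set T : Finset V := Finset.univ.image S.s ∪ Finset.univ.image S.t with hT
  have hTcard : T.card ≤ 2 * k := by
    have h1 : ∀ g : Fin k → V, (Finset.univ.image g).card ≤ k := fun g =>
      Finset.card_image_le.trans_eq (Finset.card_fin k)
    have h3 := Finset.card_union_le (Finset.univ.image S.s) (Finset.univ.image S.t)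
    rw [← hT] at h3
    have := h1 S.s
    have := h1 S.t
    omega
  have hV := hG.1
  rw [Nat.card_eq_fintype_card] at hV
  obtain ⟨χ, a, b, h1, h2, h3⟩ := exists_linked_breaking hk (by omega) hG.le_dIn
    (fun Y hY a ha b hb => hG.joins hY ha hb) hcov hTcard
  have hsT : ∀ i, S.s i ∈ T := fun i => by simp [hT]
  have htT : ∀ i, S.t i ∈ T := fun i => by simp [hT]
  refine exists_parity_paths S O (fun i => (h1 i).1) (fun i => (h1 i).2.1) (fun i j _ => ?_) h2
    (fun i => ?_) h3
  · have := (h1 i).2.2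
    exact ⟨fun h => this.1 (h ▸ hsT j), fun h => this.1 (h ▸ htT j), fun h => this.2 (h ▸ hsT j),
      fun h => this.2 (h ▸ htT j)⟩
  · simp [hsT i, htT i]

end

end ParityLinkage

theorem mainTheorem6 {V : Type*} [Finite V] (G : SimpleGraph V) (k : ℕ)
    (hG : ParityLinkage.IsVertexConnected G (50 * k)) :
    Xor (ParityLinkage.IsParityLinked G k)
      (∃ S : ParityLinkage.TerminalPairs V k,
        ∀ A B : Set V, ParityLinkage.IsNicePartition G A B →
          ¬ ∃ m : Fin k → Sym2 V, ParityLinkage.IsParityBreakingMatching G A B S m) := by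
  obtain ⟨A₀, B₀, h₀⟩ := ParityLinkage.exists_isNicePartition G
  by_cases hlink : ParityLinkage.IsParityLinked G k
  · exact Or.inl ⟨hlink, fun ⟨S, hS⟩ => hS A₀ B₀ h₀ (hlink.exists_matching S h₀.1)⟩
  refine Or.inr ⟨?_, hlink⟩
  by_contra! hS
  refine hlink fun S O => ?_
  rcases Nat.eq_zero_or_pos k with rfl | hk
  · exact ⟨fun i => i.elim0, fun i => i.elim0, fun i => i.elim0, fun i => i.elim0⟩
  have := Fintype.ofFinite V
  by_cases hcov : ∀ (X : Finset V) (c : V → Bool),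
      (∀ u ∉ X, ∀ v ∉ X, G.Adj u v → c u ≠ c v) → 6 * k ≤ X.card
  · exact ParityLinkage.exists_parity_paths_of_large_cover hk hG hcov S O
  · push Not at hcov
    obtain ⟨X, c, hc, hX⟩ := hcov
    obtain ⟨A, B, ⟨hAB, Y, hY, hbot, hA, hB⟩, m, hm⟩ := hS S
    -- The cover belonging to the nice partition is minimum, hence at most as large as the small
    -- cover `X`.
    refine ParityLinkage.exists_parity_paths_of_nice hG hAB (lt_of_le_of_lt (hY.2 X
      (ParityLinkage.isOddCycleCover_of_colouring c hc)) ?_) hbot hA hB S O hm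
    rwa [Set.ncard_coe_finset]
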